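/- Let $\mathcal H$ be the upper half plane, $\tau=x+iy\in\mathcal H$, $q=e^{2\pi i\tau}$, $(z;q)_n=\prod_{j=0}^{n-1}(1-zq^j)$, $\zeta_c^a=e^{2\pi i a/c}$, and let $\sqrt{\cdot}$ denote the principal square root. Let $$\mathcal O(z;\tau)=\sum_{n=0}^\infty\frac{(-1;q)_n\,q^{n(n+1)/2}}{(zq;q)_n(z^{-1}q;q)_n}$$ be the overpartition rank function, and let $g_{0,b}(z)=\sum_{n\in\mathbb Z}n\,e^{\pi i n^2z+2\pi i nb}$. For integers $a,c$ with $c>0$ and $c\nmid 2a$ put $$\mathcal M(a,c;\tau)=\mathcal O(\zeta_c^a;\tau)-i\sqrt2\,\frac{1-\zeta_c^a}{1+\zeta_c^a}\int_{-\overline\tau}^{i\infty}\frac{g_{0,\frac12-\frac{2a}{c}}(2z)}{\sqrt{-i(z+\tau)}}\,dz .$$ For $k\in\frac12+\mathbb Z$ and a congruence subgroup $\Gamma\subseteq\Gamma_0(4)$ of $\mathrm{SL}_2(\mathbb Z)$, a harmonic weak Maass form of weight $k$ on $\Gamma$ is a smooth function $F:\mathcal H\to\mathbb C$ such that 1. $F(A\tau)=\left(\frac{\gamma}{\delta}\right)^{2k}\epsilon(\delta)^{-2k}(\gamma\tau+\delta)^kF(\tau)$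 for all $A=\begin{pmatrix}\alpha&\beta\\ \gamma&\delta\end{pmatrix}\in\Gamma$, where $\epsilon(\delta)=1$ if $\delta\equiv1\pmod 4$ and $\epsilon(\delta)=i$ otherwise, and $\left(\frac{\gamma}{\delta}\right)$ is the Jacobi symbol extended to negative $\delta$ by $\left(\frac{\gamma}{\delta}\right)=-\left(\frac{\gamma}{|\delta|}\right)$ if $\gamma,\delta<0$ and $\left(\frac{\gamma}{\delta}\right)=\left(\frac{\gamma}{|\delta|}\right)$ otherwise, with $\left(\frac{0}{\pm1}\right)=1$; 2. $\Delta_kF=0$, where $\Delta_k=-y^2\left(\frac{\partial^2}{\partial x^2}+\frac{\partial^2}{\partial y^2}\right)+iky\left(\frac{\partial}{\partial x}+i\frac{\partial}{\partial y}\right)$; 3. for every $B=\begin{pmatrix}\alpha&\beta\\ \gamma&\delta\end{pmatrix}\in\mathrm{SL}_2(\mathbb Z)$ there is a real $C$ with $(\gamma\tau+\delta)^{-k}F(B\tau)=O(e^{Cy})$ as $y\to\infty$, uniformly in $x$. **Theorem.** Let $a,c$ be integers with $c>0$ and $c\nmid 2a$. Then $\mathcal M(a,c;\tau)$ is a harmonic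 weak Maass form of weight $\frac12$ on $\Gamma=\Gamma_1(4)\cap\Gamma_1(c)\cap\Gamma_0(16)\cap\Gamma_0(c^2)$. In particular, for all $\begin{pmatrix}\alpha&\beta\\ \gamma&\delta\end{pmatrix}\in\Gamma$ and $\tau\in\mathcal H$, $$\mathcal M\left(a,c;\frac{\alpha\tau+\beta}{\gamma\tau+\delta}\right)=\left(\frac{\gamma}{\delta}\right)\sqrt{\gamma\tau+\delta}\;\mathcal M(a,c;\tau).$$ -/

import Mathlib

open scoped MatrixGroups ContDiff UpperHalfPlane ComplexConjugate

namespace OverpartitionRank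

noncomputable section

/-! ### Half-integral weight harmonic weak Maass forms -/

/-- The Jacobi symbol `(m/n)` extended to all odd integers `n`:
it is `(m/|n|)`, except that it is `-(m/|n|)` when both `m` and `n` are negative. -/
def extJacobi (m n : ℤ) : ℤ :=
  if m < 0 ∧ n < 0 then -jacobiSym m n.natAbs else jacobiSym m n.natAbs

/-- `ε(δ) = 1` if `δ ≡ 1 (mod 4)` and `ε(δ) = i` otherwise. -/
def epsilonFactor (δ : ℤ) : ℂ := if δ % 4 = 1 then 1 else Complex.I

/-- The principal branch of the complex square root. -/
def csqrt (w : ℂ) : ℂ := w ^ (1 / 2 : ℂ)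

/-- The factor `(A : τ) = γ τ + δ` for `A = (α, β; γ, δ)`. -/
def autFactor (A : SL(2, ℤ)) (τ : ℍ) : ℂ := ((A 1 0 : ℤ) : ℂ) * (τ : ℂ) + ((A 1 1 : ℤ) : ℂ)

/-- The partial derivative `∂/∂x` on `ℂ`, with `τ = x + i y`. -/
def partialX (f : ℂ → ℂ) (z : ℂ) : ℂ := fderiv ℝ f z 1

/-- The partial derivative `∂/∂y` on `ℂ`, with `τ = x + i y`. -/
def partialY (f : ℂ → ℂ) (z : ℂ) : ℂ := fderiv ℝ f z Complex.I

/-- The weight `k` hyperbolic Laplacian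
`Δ_k = -y² (∂²/∂x² + ∂²/∂y²) + i k y (∂/∂x + i ∂/∂y)`. -/
def hyperbolicLaplacian (k : ℝ) (f : ℂ → ℂ) (z : ℂ) : ℂ :=
  -((z.im : ℂ) ^ 2) * (partialX (partialX f) z + partialY (partialY f) z) +
    Complex.I * (k : ℂ) * (z.im : ℂ) * (partialX f z + Complex.I * partialY f z)

/-- `F` is a harmonic weak Maass form of half-integral weight `κ / 2` (with `κ` odd) on the
congruence subgroup `Γ ⊆ Γ₀(4)`. -/
structure IsHarmonicWeakMaassForm (κ : ℤ) (Γ : Subgroup SL(2, ℤ)) (F : ℍ → ℂ) : Prop where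
  odd : Odd κ
  isCongruenceSubgroup : CongruenceSubgroup.IsCongruenceSubgroup Γ
  le_Gamma0_four : Γ ≤ CongruenceSubgroup.Gamma0 4
  /-- `F(Aτ) = (γ/δ)^κ ε(δ)^(-κ) (γτ+δ)^(κ/2) F(τ)` for `A ∈ Γ`. -/
  transform : ∀ A ∈ Γ, ∀ τ : ℍ,
    F (A • τ) = ((extJacobi (A 1 0) (A 1 1) : ℤ) : ℂ) ^ κ * epsilonFactor (A 1 1) ^ (-κ) *
      csqrt (autFactor A τ) ^ κ * F τ
  /-- `F` is smooth on the upper half plane, as a function of two real variables. -/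
  smooth : ContDiffOn ℝ ∞ (F ∘ UpperHalfPlane.ofComplex) {z : ℂ | 0 < z.im}
  harmonic : ∀ τ : ℍ,
    hyperbolicLaplacian ((κ : ℝ) / 2) (F ∘ UpperHalfPlane.ofComplex) (τ : ℂ) = 0
  /-- At most linear exponential growth at every cusp. -/
  growth : ∀ B : SL(2, ℤ), ∃ C : ℝ,
    (fun τ : ℍ => csqrt (autFactor B τ) ^ (-κ) * F (B • τ))
      =O[UpperHalfPlane.atImInfty] fun τ : ℍ => Real.exp (C * τ.im)

/-! ### The overpartition rank function and its completion -/

/-- The finite `q`-Pochhammer symbol `(z; q)_n = ∏_{j < n} (1 - z q^j)`. -/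
def qPochhammer (z q : ℂ) (n : ℕ) : ℂ := ∏ j ∈ Finset.range n, (1 - z * q ^ j)

/-- `q = exp(2 π i τ)`. -/
def qOf (τ : ℍ) : ℂ := Complex.exp (2 * Real.pi * Complex.I * (τ : ℂ))

/-- The overpartition rank function
`𝒪(z; τ) = ∑_{n ≥ 0} (-1; q)_n q^(n(n+1)/2) / ((z q; q)_n (z⁻¹ q; q)_n)`. -/
def rankFunction (z : ℂ) (τ : ℍ) : ℂ :=
  ∑' n : ℕ, qPochhammer (-1) (qOf τ) n * qOf τ ^ (n * (n + 1) / 2) /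
    (qPochhammer (z * qOf τ) (qOf τ) n * qPochhammer (z⁻¹ * qOf τ) (qOf τ) n)

/-- `ζ_c^a = exp(2 π i a / c)`. -/
def zetaPow (a : ℤ) (c : ℕ) : ℂ := Complex.exp (2 * Real.pi * Complex.I * (a : ℂ) / (c : ℂ))

/-- The unary theta function `g_{a,b}(z) = ∑_{n ∈ ℤ + a} n exp(π i n² z + 2 π i n b)`. -/
def unaryTheta (a b : ℝ) (z : ℂ) : ℂ :=
  ∑' m : ℤ, ((m : ℂ) + (a : ℂ)) *
    Complex.exp (Real.pi * Complex.I * ((m : ℂ) + (a : ℂ)) ^ 2 * z +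
      2 * Real.pi * Complex.I * ((m : ℂ) + (a : ℂ)) * (b : ℂ))

/-- The contour integral of `f` from `w` to `i∞` along the vertical ray `z = w + i t`, `t > 0`. -/
def integralToIInfty (w : ℂ) (f : ℂ → ℂ) : ℂ :=
  ∫ t in Set.Ioi (0 : ℝ), Complex.I * f (w + Complex.I * (t : ℂ))

/-- The completion of the overpartition rank function at `z = ζ_c^a`:
`ℳ(a, c; τ) = 𝒪(ζ_c^a; τ) - i √2 (1 - ζ_c^a) / (1 + ζ_c^a) *
  ∫_{-conj τ}^{i∞} g_{0, 1/2 - 2a/c}(2z) / √(-i (z + τ)) dz`. -/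
def completedRank (a : ℤ) (c : ℕ) (τ : ℍ) : ℂ :=
  rankFunction (zetaPow a c) τ -
    Complex.I * (Real.sqrt 2 : ℂ) * ((1 - zetaPow a c) / (1 + zetaPow a c)) *
      integralToIInfty (-conj (τ : ℂ)) fun z =>
        unaryTheta 0 (1 / 2 - 2 * (a : ℝ) / (c : ℝ)) (2 * z) /
          csqrt (-Complex.I * (z + (τ : ℂ)))

/-- The group `Γ₁(4) ∩ Γ₁(c) ∩ Γ₀(16) ∩ Γ₀(c²)`. -/
def levelGroup (c : ℕ) : Subgroup SL(2, ℤ) :=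
  CongruenceSubgroup.Gamma1 4 ⊓ CongruenceSubgroup.Gamma1 c ⊓
    CongruenceSubgroup.Gamma0 16 ⊓ CongruenceSubgroup.Gamma0 (c ^ 2)

end

end OverpartitionRank

namespace OverpartitionRank

open Complex Filter Topology Set MeasureTheory

/-! Put z = exp(2πiu). The function `normRank`, that is (1+z)/(1-z) times the rank function, has
period 1 in u, and under u ↦ u+τ it is multiplied by -exp(2πi(τ+2u)) up to an elementary
inhomogeneous term. This is a telescoping sum, `rankSeries_mul_q`. The non-holomorphic series
`completion` has the same multiplier and the opposite inhomogeneous term (`completion_add_tau`), so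
their sum `rankHat` is quasi-periodic for the lattice ℤτ+ℤ. Its failure to be holomorphic in u is
explicit: the antiholomorphic derivative is an elementary factor times a conjugated theta function
(`hasDbarAt_completion`).

Modularity is then a uniqueness statement. The theta function transforms under Γ₀(4)
(`thetaTransforms`). Hence, when 16 ∣ γ and δ ≡ 1 mod 4, the two sides of the expected
transformation law of `rankHat` have the same antiholomorphic derivative, and their difference is
holomorphic off the lattice, quasi-periodic, and has at most simple poles. Multiplied by the square
of an odd theta function and an exponential it becomes a bounded entire function that vanishes at 0,
so it is zero (`eq_zero_of_quasiPeriodic`, `rankHat_smul`).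

At the real point x = a/c the completion is the integral in the theorem (`completion_eq_integral`),
and the congruences modulo c and c² make (γτ+δ)x a lattice translate of x, which gives
`completedRank_smul`. For harmonicity, applying ∂/∂x + i∂/∂y in τ leaves y^(-1/2) times an
antiholomorphic function, which the remaining first-order factor of the weight 1/2 Laplacian
annihilates (`hasFDerivAt_shadow`). Growth at all cusps follows from one bound by K exp(4/Im τ) on
the whole half plane, together with invariance of the absolute value of each slashed form under
translation by 16c². -/

/-! ### The rank series and its `q`-difference equation -/

/-- `exp(2 π i x)`. -/
noncomputable def expTwoPi (x : ℂ) : ℂ := cexp (2 * Real.pi * I * x)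

lemma expTwoPi_add (x y : ℂ) : expTwoPi (x + y) = expTwoPi x * expTwoPi y := by
  simp only [expTwoPi, mul_add, Complex.exp_add]

lemma expTwoPi_sub (x y : ℂ) : expTwoPi (x - y) = expTwoPi x / expTwoPi y := by
  simp only [expTwoPi, mul_sub, Complex.exp_sub]

lemma expTwoPi_ne_zero (x : ℂ) : expTwoPi x ≠ 0 := Complex.exp_ne_zero _

lemma expTwoPi_neg (x : ℂ) : expTwoPi (-x) = (expTwoPi x)⁻¹ := by
  simp only [expTwoPi, mul_neg, Complex.exp_neg]

lemma expTwoPi_intCast (n : ℤ) : expTwoPi n = 1 := by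
  rw [expTwoPi, mul_comm]
  exact Complex.exp_int_mul_two_pi_mul_I n

lemma expTwoPi_zero : expTwoPi 0 = 1 := by simp [expTwoPi]

lemma expTwoPi_one : expTwoPi 1 = 1 := by exact_mod_cast expTwoPi_intCast 1

lemma expTwoPi_half : expTwoPi (1 / 2) = -1 := by
  rw [expTwoPi, ← Complex.exp_pi_mul_I]
  congr 1
  ring

lemma expTwoPi_int_mul (n : ℤ) (x : ℂ) : expTwoPi (n * x) = expTwoPi x ^ n := by
  rw [expTwoPi, expTwoPi, ← Complex.exp_int_mul]
  congr 1
  ring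

lemma expTwoPi_nat_mul (n : ℕ) (x : ℂ) : expTwoPi (n * x) = expTwoPi x ^ n := by
  exact_mod_cast expTwoPi_int_mul n x

lemma norm_expTwoPi (x : ℂ) : ‖expTwoPi x‖ = Real.exp (-2 * Real.pi * x.im) := by
  rw [expTwoPi, Complex.norm_exp]
  congr 1
  simp

lemma norm_expTwoPi_lt_one {τ : ℂ} (hτ : 0 < τ.im) : ‖expTwoPi τ‖ < 1 := by
  rw [norm_expTwoPi, Real.exp_lt_one_iff]
  nlinarith [Real.pi_pos]

lemma expTwoPi_eq_one_iff (x : ℂ) : expTwoPi x = 1 ↔ ∃ n : ℤ, x = n := by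
  rw [expTwoPi, Complex.exp_eq_one_iff]
  refine exists_congr fun n => ⟨fun h => ?_, fun h => by rw [h]; ring⟩
  have : (2 * Real.pi * I : ℂ) ≠ 0 := Complex.two_pi_I_ne_zero
  apply mul_left_cancel₀ this
  rw [h]; ring

lemma differentiable_expTwoPi : Differentiable ℂ expTwoPi := by
  unfold expTwoPi
  fun_prop

lemma qPochhammer_succ (z q : ℂ) (n : ℕ) :
    qPochhammer z q (n + 1) = qPochhammer z q n * (1 - z * q ^ n) :=
  Finset.prod_range_succ _ _

lemma qPochhammer_succ' (z q : ℂ) (n : ℕ) :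
    qPochhammer z q (n + 1) = (1 - z) * qPochhammer (z * q) q n := by
  rw [qPochhammer, Finset.prod_range_succ', mul_comm, qPochhammer]
  congr 1
  · simp
  · refine Finset.prod_congr rfl fun j _ => ?_
    ring

lemma qPochhammer_ne_zero {z q : ℂ} (h : ∀ j : ℕ, z * q ^ j ≠ 1) (n : ℕ) :
    qPochhammer z q n ≠ 0 :=
  Finset.prod_ne_zero_iff.mpr fun j _ => sub_ne_zero.mpr (h j).symm

/-- The numerators `(-1; q)_n q^(n(n+1)/2)` of the rank series. -/
noncomputable def rankNumerator (q : ℂ) (n : ℕ) : ℂ :=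
  qPochhammer (-1) q n * q ^ (n * (n + 1) / 2)

/-- The summands of the rank series. -/
noncomputable def rankTerm (z q : ℂ) (n : ℕ) : ℂ :=
  rankNumerator q n / (qPochhammer (z * q) q n * qPochhammer (z⁻¹ * q) q n)

/-- The overpartition rank function in terms of `z` and `q`. -/
noncomputable def rankSeries (z q : ℂ) : ℂ := ∑' n : ℕ, rankTerm z q n

lemma triangle_succ (n : ℕ) : (n + 1) * (n + 1 + 1) / 2 = n * (n + 1) / 2 + (n + 1) := by
  rw [show (n + 1) * (n + 1 + 1) = n * (n + 1) + (n + 1) * 2 by ring,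
    Nat.add_mul_div_right _ _ (by norm_num)]

lemma rankNumerator_succ (q : ℂ) (n : ℕ) :
    rankNumerator q (n + 1) = rankNumerator q n * (1 + q ^ n) * q ^ (n + 1) := by
  rw [rankNumerator, rankNumerator, qPochhammer_succ, triangle_succ, pow_add]
  ring

lemma norm_rankNumerator_le {q : ℂ} (hq : ‖q‖ ≤ 1) (n : ℕ) :
    ‖rankNumerator q n‖ ≤ 2 ^ n * ‖q‖ ^ (n * (n + 1) / 2) := by
  rw [rankNumerator, norm_mul, norm_pow]
  gcongr
  rw [qPochhammer, norm_prod]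
  calc ∏ j ∈ Finset.range n, ‖1 - -1 * q ^ j‖ ≤ ∏ _j ∈ Finset.range n, (2 : ℝ) := by
        refine Finset.prod_le_prod (fun _ _ => norm_nonneg _) fun j _ => ?_
        refine (norm_sub_le _ _).trans ?_
        have : ‖q‖ ^ j ≤ 1 := pow_le_one₀ (norm_nonneg _) hq
        simp only [norm_one, neg_mul, one_mul, norm_neg, norm_pow]
        linarith
    _ = 2 ^ n := by simp

lemma le_norm_qPochhammer {z q : ℂ} {δ : ℝ} (hδ : 0 ≤ δ) (h : ∀ j : ℕ, δ ≤ ‖1 - z * q ^ j‖)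
    (n : ℕ) : δ ^ n ≤ ‖qPochhammer z q n‖ := by
  rw [qPochhammer, norm_prod]
  calc δ ^ n = ∏ _j ∈ Finset.range n, δ := by simp
    _ ≤ _ := Finset.prod_le_prod (fun _ _ => hδ) fun j _ => h j

/-- `δ` bounds the factors in the denominators of the rank series from below. -/
def PoleGap (δ : ℝ) (z q : ℂ) : Prop :=
  ∀ j : ℕ, δ ≤ ‖1 - z * q ^ (j + 1)‖ ∧ δ ≤ ‖1 - z⁻¹ * q ^ (j + 1)‖

lemma PoleGap.left {δ : ℝ} {z q : ℂ} (h : PoleGap δ z q) (j : ℕ) :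
    δ ≤ ‖1 - z * q * q ^ j‖ := by
  rw [mul_assoc, ← pow_succ']
  exact (h j).1

lemma PoleGap.right {δ : ℝ} {z q : ℂ} (h : PoleGap δ z q) (j : ℕ) :
    δ ≤ ‖1 - z⁻¹ * q * q ^ j‖ := by
  rw [mul_assoc, ← pow_succ']
  exact (h j).2

/-- The triangular exponent beats any geometric factor, so one summable majorant serves every pair
with a common gap δ and a common bound r. Locally uniform convergence in u and in τ both rest on it.
-/
lemma norm_rankTerm_le {z q : ℂ} {δ r : ℝ} (hδ : 0 < δ) (hr : r ≤ 1) (hq : ‖q‖ ≤ r)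
    (h : PoleGap δ z q) (n : ℕ) :
    ‖rankTerm z q n‖ ≤ (2 / δ ^ 2) ^ n * r ^ (n * (n + 1) / 2) := by
  rw [rankTerm, norm_div, norm_mul]
  have h1 := le_norm_qPochhammer hδ.le h.left n
  have h2 := le_norm_qPochhammer hδ.le h.right n
  calc _ ≤ (2 ^ n * ‖q‖ ^ (n * (n + 1) / 2)) / (δ ^ n * δ ^ n) := by
        gcongr
        exact norm_rankNumerator_le (hq.trans hr) n
    _ = (2 / δ ^ 2) ^ n * ‖q‖ ^ (n * (n + 1) / 2) := by
        rw [div_pow, ← pow_mul, ← pow_add]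
        ring
    _ ≤ _ := by gcongr

lemma summable_pow_mul_triangle (c : ℝ) {r : ℝ} (hr0 : 0 ≤ r) (hr : r < 1) :
    Summable fun n : ℕ => c ^ n * r ^ (n * (n + 1) / 2) := by
  have hlim : Tendsto (fun n : ℕ => |c| * r ^ (n + 1)) atTop (𝓝 0) := by
    have := ((tendsto_pow_atTop_nhds_zero_of_lt_one hr0 hr).comp (tendsto_add_atTop_nat 1)).const_mul
      |c|
    simpa using this
  refine summable_of_ratio_norm_eventually_le (r := 1 / 2) (by norm_num) ?_
  filter_upwards [hlim.eventually (gt_mem_nhds (show (0 : ℝ) < 1 / 2 by norm_num))] with n hn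
  rw [triangle_succ, pow_succ, pow_add, show c ^ n * c * (r ^ (n * (n + 1) / 2) * r ^ (n + 1)) =
    (c * r ^ (n + 1)) * (c ^ n * r ^ (n * (n + 1) / 2)) by ring, norm_mul]
  gcongr
  rw [norm_mul, Real.norm_eq_abs, Real.norm_of_nonneg (by positivity)]
  exact hn.le

lemma summable_rankTerm {z q : ℂ} {δ : ℝ} (hδ : 0 < δ) (hq : ‖q‖ < 1) (h : PoleGap δ z q) :
    Summable (rankTerm z q) :=
  (summable_pow_mul_triangle (2 / δ ^ 2) (norm_nonneg q) hq).of_norm_bounded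
    (norm_rankTerm_le hδ hq.le le_rfl h)

lemma differentiableOn_qPochhammer {s : Set ℂ} {f g : ℂ → ℂ} (hf : DifferentiableOn ℂ f s)
    (hg : DifferentiableOn ℂ g s) (n : ℕ) :
    DifferentiableOn ℂ (fun w => qPochhammer (f w) (g w) n) s := by
  unfold qPochhammer
  exact DifferentiableOn.fun_finsetProd fun j _ =>
    (differentiableOn_const 1).sub (hf.mul (hg.pow j))

lemma differentiableOn_rankSeries {s : Set ℂ} (hs : IsOpen s) {f g : ℂ → ℂ} {δ r : ℝ}
    (hf : DifferentiableOn ℂ f s) (hg : DifferentiableOn ℂ g s) (hf0 : ∀ w ∈ s, f w ≠ 0)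
    (hδ : 0 < δ) (hr0 : 0 ≤ r) (hr : r < 1) (hgr : ∀ w ∈ s, ‖g w‖ ≤ r)
    (hgap : ∀ w ∈ s, PoleGap δ (f w) (g w)) :
    DifferentiableOn ℂ (fun w => rankSeries (f w) (g w)) s := by
  refine differentiableOn_tsum_of_summable_norm
    (summable_pow_mul_triangle (2 / δ ^ 2) hr0 hr) (fun n => ?_) hs
    fun n w hw => norm_rankTerm_le hδ hr.le (hgr w hw) (hgap w hw) n
  unfold rankTerm rankNumerator
  refine ((differentiableOn_qPochhammer (differentiableOn_const _) hg n).mul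
    (hg.pow _)).div ((differentiableOn_qPochhammer (hf.mul hg) hg n).mul
      (differentiableOn_qPochhammer ((hf.inv hf0).mul hg) hg n)) fun w hw => ?_
  have h1 := le_norm_qPochhammer hδ.le (hgap w hw).left n
  have h2 := le_norm_qPochhammer hδ.le (hgap w hw).right n
  have : 0 < δ ^ n := by positivity
  exact mul_ne_zero (norm_pos_iff.mp (this.trans_le h1)) (norm_pos_iff.mp (this.trans_le h2))

/-- Only finitely many factors can be small: once (‖w₀‖+1)‖q‖^(j+1) < 1/2 the factor is at least 1/2
for all w near w₀, and the earlier ones are controlled by continuity. -/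
lemma exists_le_norm_one_sub {w₀ q : ℂ} (hq : ‖q‖ < 1) (h : ∀ j : ℕ, w₀ * q ^ (j + 1) ≠ 1) :
    ∃ δ > 0, ∀ᶠ w in 𝓝 w₀, ∀ j : ℕ, δ ≤ ‖1 - w * q ^ (j + 1)‖ := by
  have hlim : Tendsto (fun n : ℕ => (‖w₀‖ + 1) * ‖q‖ ^ (n + 1)) atTop (𝓝 0) := by
    have := ((tendsto_pow_atTop_nhds_zero_of_lt_one (norm_nonneg q) hq).comp
      (tendsto_add_atTop_nat 1)).const_mul (‖w₀‖ + 1)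
    simpa using this
  obtain ⟨J, hJ⟩ := eventually_atTop.mp
    (hlim.eventually (gt_mem_nhds (show (0 : ℝ) < 1 / 2 by norm_num)))
  have hfin : ∀ N : ℕ, ∃ δ > 0, ∀ᶠ w in 𝓝 w₀, ∀ j < N, δ ≤ ‖1 - w * q ^ (j + 1)‖ := by
    intro N
    induction N with
    | zero => exact ⟨1, one_pos, by simp⟩
    | succ N ih =>
      obtain ⟨δ, hδ, hev⟩ := ih
      have hpos : 0 < ‖1 - w₀ * q ^ (N + 1)‖ := norm_pos_iff.mpr (sub_ne_zero.mpr (h N).symm)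
      have hc : ContinuousAt (fun w => ‖1 - w * q ^ (N + 1)‖) w₀ := by fun_prop
      refine ⟨min δ (‖1 - w₀ * q ^ (N + 1)‖ / 2), lt_min hδ (by positivity), ?_⟩
      filter_upwards [hev, hc.eventually (lt_mem_nhds (half_lt_self hpos))] with w hw1 hw2 j hj
      rcases Nat.lt_succ_iff_lt_or_eq.mp hj with hj | rfl
      · exact (min_le_left _ _).trans (hw1 j hj)
      · exact (min_le_right _ _).trans hw2.le
  obtain ⟨δ, hδ, hev⟩ := hfin J
  have hn : ∀ᶠ w in 𝓝 w₀, ‖w‖ < ‖w₀‖ + 1 :=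
    continuous_norm.continuousAt.eventually (gt_mem_nhds (by linarith))
  refine ⟨min δ (1 / 2), lt_min hδ (by norm_num), ?_⟩
  filter_upwards [hev, hn] with w hw1 hw2 j
  rcases lt_or_ge j J with hj | hj
  · exact (min_le_left _ _).trans (hw1 j hj)
  · refine (min_le_right _ _).trans ?_
    have h1 : ‖w * q ^ (j + 1)‖ ≤ 1 / 2 := by
      rw [norm_mul, norm_pow]
      exact (mul_le_mul_of_nonneg_right hw2.le (by positivity)).trans (hJ j hj).le
    have h2 := norm_sub_norm_le (1 : ℂ) (w * q ^ (j + 1))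
    rw [norm_one] at h2
    linarith

lemma exists_poleGap {z₀ q : ℂ} (hq : ‖q‖ < 1) (hz₀ : z₀ ≠ 0)
    (h : ∀ j : ℕ, z₀ * q ^ (j + 1) ≠ 1) (h' : ∀ j : ℕ, z₀⁻¹ * q ^ (j + 1) ≠ 1) :
    ∃ δ > 0, ∀ᶠ z in 𝓝 z₀, PoleGap δ z q := by
  obtain ⟨δ₁, hδ₁, h1⟩ := exists_le_norm_one_sub hq h
  obtain ⟨δ₂, hδ₂, h2⟩ := exists_le_norm_one_sub hq h'
  refine ⟨min δ₁ δ₂, lt_min hδ₁ hδ₂, ?_⟩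
  filter_upwards [h1, (continuousAt_inv₀ hz₀).eventually h2] with z hz1 hz2 j
  exact ⟨(min_le_left _ _).trans (hz1 j), (min_le_right _ _).trans (hz2 j)⟩

/-- The first-order `q`-difference equation of the rank series, obtained by telescoping. -/
lemma rankSeries_mul_q {z q : ℂ} (hq0 : q ≠ 0) (hq : ‖q‖ < 1) (hz0 : z ≠ 0)
    (h : ∀ j : ℕ, z * q ^ j ≠ 1) (h' : ∀ j : ℕ, z⁻¹ * q ^ j ≠ 1) :
    (1 + z * q) / (1 - z * q) * rankSeries (z * q) q +
      q * z ^ 2 * ((1 + z) / (1 - z) * rankSeries z q) = 1 - q * z ^ 2 := by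
  have hinv : (z * q)⁻¹ * q = z⁻¹ := by field_simp
  have hA : ∀ n, qPochhammer (z * q) q n ≠ 0 := qPochhammer_ne_zero fun j => by
    rw [mul_assoc, ← pow_succ']
    exact h _
  have hB : ∀ n, qPochhammer z⁻¹ q n ≠ 0 := qPochhammer_ne_zero h'
  have hz1 : 1 - z ≠ 0 := sub_ne_zero.mpr (by simpa using (h 0).symm)
  have hz1' : 1 - z⁻¹ ≠ 0 := sub_ne_zero.mpr (by simpa using (h' 0).symm)
  have hzq : 1 - z * q ≠ 0 := sub_ne_zero.mpr (by simpa using (h 1).symm)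
  obtain ⟨δ, hδ, hg⟩ := exists_poleGap hq hz0 (fun j => h _) (fun j => h' _)
  obtain ⟨δ', hδ', hg'⟩ := exists_poleGap (z₀ := z * q) hq (mul_ne_zero hz0 hq0)
    (fun j => by rw [mul_assoc, ← pow_succ']; exact h _)
    (fun j => by rw [pow_succ', ← mul_assoc, hinv]; exact h' _)
  have hs := (summable_rankTerm hδ hq hg.self_of_nhds).hasSum
  have hs' := (summable_rankTerm hδ' hq hg'.self_of_nhds).hasSum
  -- The antidifference. Both series can be written over the products (zq;q) and (z⁻¹;q), and over
  -- these the combined summand is S (n+1) - S n. The sum is therefore -S 0 = 1 - qz².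
  set S : ℕ → ℂ := fun n => (q * z ^ 2 - 1) * (rankNumerator q n /
    (qPochhammer (z * q) q n * qPochhammer z⁻¹ q n)) with hS
  have hsum := (hs'.mul_left ((1 + z * q) / (1 - z * q))).add
    ((hs.mul_left ((1 + z) / (1 - z))).mul_left (q * z ^ 2))
  have hterm : ∀ n, (1 + z * q) / (1 - z * q) * rankTerm (z * q) q n +
      q * z ^ 2 * ((1 + z) / (1 - z) * rankTerm z q n) = S (n + 1) - S n := by
    intro n
    have e1 : qPochhammer (z * q * q) q n = qPochhammer (z * q) q n * (1 - z * q * q ^ n) /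
        (1 - z * q) := by
      rw [eq_div_iff hzq, ← qPochhammer_succ, qPochhammer_succ', mul_comm]
    have e2 : qPochhammer (z⁻¹ * q) q n = qPochhammer z⁻¹ q n * (1 - z⁻¹ * q ^ n) /
        (1 - z⁻¹) := by
      rw [eq_div_iff hz1', ← qPochhammer_succ, qPochhammer_succ', mul_comm]
    have n1 : 1 - z * q * q ^ n ≠ 0 := sub_ne_zero.mpr (by
      rw [mul_assoc, ← pow_succ']; exact (h _).symm)
    have n2 : 1 - z⁻¹ * q ^ n ≠ 0 := sub_ne_zero.mpr (h' n).symm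
    have n3 : z - q ^ n ≠ 0 := by
      intro h0
      apply n2
      rw [← sub_eq_zero.mp h0, inv_mul_cancel₀ hz0, sub_self]
    have n4 : z - 1 ≠ 0 := by rwa [← neg_ne_zero, neg_sub]
    simp only [hS, rankTerm, hinv, e1, e2, rankNumerator_succ, qPochhammer_succ]
    have hA' := hA n
    have hB' := hB n
    generalize qPochhammer (z * q) q n = A at *
    generalize qPochhammer z⁻¹ q n = B at *
    generalize rankNumerator q n = c at *
    rw [pow_succ q n]
    generalize q ^ n = N at *
    field_simp
    ring
  -- S n is the n-th term of a convergent series times a convergent factor.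
  have hlim : Tendsto S atTop (𝓝 0) := by
    have hS' : ∀ n, S n = (q * z ^ 2 - 1) / (1 - z⁻¹) *
        (rankTerm z q n * (1 - z⁻¹ * q ^ n)) := by
      intro n
      have e2 : qPochhammer (z⁻¹ * q) q n = qPochhammer z⁻¹ q n * (1 - z⁻¹ * q ^ n) /
          (1 - z⁻¹) := by
        rw [eq_div_iff hz1', ← qPochhammer_succ, qPochhammer_succ', mul_comm]
      have n2 : 1 - z⁻¹ * q ^ n ≠ 0 := sub_ne_zero.mpr (h' n).symm
      simp only [hS, rankTerm, e2]
      have hA' := hA n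
      have hB' := hB n
      generalize 1 - z⁻¹ * q ^ n = N at *
      generalize 1 - z⁻¹ = M at *
      field_simp
    have h1 := hs.summable.tendsto_atTop_zero
    have h2 := (((tendsto_pow_atTop_nhds_zero_of_norm_lt_one hq).const_mul z⁻¹).const_sub 1)
    have h3 := (h1.mul h2).const_mul ((q * z ^ 2 - 1) / (1 - z⁻¹))
    simp only [zero_mul, mul_zero] at h3
    exact h3.congr fun n => (hS' n).symm
  have htel := hsum.tendsto_sum_nat
  simp only [hterm, Finset.sum_range_sub] at htel
  have hS0 : S 0 = q * z ^ 2 - 1 := by simp [hS, rankNumerator, qPochhammer]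
  have := tendsto_nhds_unique htel ((hlim.sub_const (S 0)))
  rw [rankSeries, rankSeries, this, hS0]
  ring

/-! ### Jacobi symbols and square roots in the theta multiplier -/

/-- In the lower entry the symbol of m has period 4|m|. Dividing γ by 4 does not change the symbol,
so the period 4|γ/4| is |γ| itself. -/
lemma jacobiSym_add_natAbs {γ : ℤ} {b : ℕ} (hγ : γ % 4 = 0) (hb : b % 2 = 1) :
    jacobiSym γ (b + γ.natAbs) = jacobiSym γ b := by
  have h4 : γ.natAbs = 4 * (γ / 4).natAbs := by omega
  rw [← jacobiSym.div_four_left hγ hb, ← jacobiSym.div_four_left hγ (by omega),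
    jacobiSym.mod_right _ (Nat.odd_iff.mpr hb),
    jacobiSym.mod_right _ (Nat.odd_iff.mpr (show (b + γ.natAbs) % 2 = 1 by omega)), h4,
    Nat.add_mod_right]

/-- a is congruent to b modulo a-b, and to a-b modulo b. This reduces the claim to reciprocity
between b and a-b, which carries no sign: the two add up to a multiple of 4, so one of them is 1 mod
4. -/
lemma jacobiSym_sub_right {a b : ℕ} (ha : a % 4 = 0) (hb : b % 2 = 1) (hab : b < a) :
    jacobiSym a (a - b) = jacobiSym a b := by
  have h1 : jacobiSym a (a - b) = jacobiSym b (a - b) := by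
    apply jacobiSym.mod_left'
    apply Int.ModEq.symm
    rw [Int.modEq_iff_dvd]
    exact ⟨1, by push_cast [Nat.cast_sub hab.le]; ring⟩
  have h2 : jacobiSym (a - b : ℕ) b = jacobiSym a b := by
    apply jacobiSym.mod_left'
    apply Int.ModEq.symm
    rw [Int.modEq_iff_dvd]
    exact ⟨-1, by push_cast [Nat.cast_sub hab.le]; ring⟩
  rw [h1, ← h2]
  rcases (show b % 4 = 1 ∨ b % 4 = 3 by omega) with h | h
  · exact jacobiSym.quadratic_reciprocity_one_mod_four h (Nat.odd_iff.mpr (by omega))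
  · exact (jacobiSym.quadratic_reciprocity_one_mod_four (by omega) (Nat.odd_iff.mpr hb)).symm

lemma jacobiSym_neg_sub_right {a b : ℕ} (ha : a % 4 = 0) (hb : b % 2 = 1) (hab : b < a) :
    jacobiSym (-a) (a - b) = -jacobiSym (-a) b := by
  rw [jacobiSym.neg _ (Nat.odd_iff.mpr hb), jacobiSym.neg _ (Nat.odd_iff.mpr (by omega)),
    jacobiSym_sub_right ha hb hab]
  rcases (show b % 4 = 1 ∨ b % 4 = 3 by omega) with h | h
  · rw [ZMod.χ₄_nat_one_mod_four h, ZMod.χ₄_nat_three_mod_four (by omega)]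
    ring
  · rw [ZMod.χ₄_nat_three_mod_four h, ZMod.χ₄_nat_one_mod_four (by omega)]
    ring

/-- If γ < 0 and the shift crosses zero, the reflection b ↦ |γ| - b produces the sign of
`jacobiSym_neg_sub_right`, and the convention for two negative entries cancels it. -/
lemma extJacobi_add_right {γ δ : ℤ} (hγ : γ % 4 = 0) (hδ : δ % 2 = 1) :
    extJacobi γ (γ + δ) = extJacobi γ δ := by
  have key : ∀ b c : ℕ, b % 2 = 1 → c = b + γ.natAbs → jacobiSym γ c = jacobiSym γ b := by
    rintro b c hb rfl
    exact jacobiSym_add_natAbs hγ hb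
  unfold extJacobi
  rcases lt_or_ge γ 0 with h0 | h0
  · rcases lt_or_ge δ 0 with h1 | h1
    · rw [if_pos ⟨h0, by omega⟩, if_pos ⟨h0, h1⟩, key δ.natAbs (γ + δ).natAbs (by omega) (by omega)]
    · rw [if_neg (show ¬ (γ < 0 ∧ δ < 0) by omega)]
      rcases lt_or_ge (γ + δ) 0 with h2 | h2
      · have := jacobiSym_neg_sub_right (a := γ.natAbs) (b := δ.natAbs) (by omega) (by omega)
          (by omega)
        rw [show (-(γ.natAbs : ℤ)) = γ by omega] at this
        rw [if_pos ⟨h0, h2⟩, show (γ + δ).natAbs = γ.natAbs - δ.natAbs by omega, this, neg_neg]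
      · rw [if_neg (by omega), key (γ + δ).natAbs δ.natAbs (by omega) (by omega)]
  · rw [if_neg (by omega), if_neg (by omega)]
    rcases lt_or_ge δ 0 with h1 | h1
    · rcases lt_or_ge (γ + δ) 0 with h2 | h2
      · rw [key (γ + δ).natAbs δ.natAbs (by omega) (by omega)]
      · have := jacobiSym_sub_right (a := γ.natAbs) (b := δ.natAbs) (by omega) (by omega)
          (by omega)
        rw [show ((γ.natAbs : ℕ) : ℤ) = γ by omega] at this
        rw [show (γ + δ).natAbs = γ.natAbs - δ.natAbs by omega, this]
    · rw [key δ.natAbs (γ + δ).natAbs (by omega) (by omega)]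

lemma jacobiSym_add_four_mul_left (γ δ : ℤ) :
    jacobiSym (γ + 4 * δ) δ.natAbs = jacobiSym γ δ.natAbs := by
  apply jacobiSym.mod_left'
  apply Int.ModEq.symm
  rw [Int.modEq_iff_dvd]
  exact Int.natAbs_dvd.mpr ⟨4, by ring⟩

/-- The symbol is periodic, so only the sign convention can break the invariance. The exceptional
sign is matched by a branch jump in `csqrt_autFactor_mul_lowerFour`. -/
lemma extJacobi_add_left {γ δ : ℤ} :
    extJacobi (γ + 4 * δ) δ =
      if 0 ≤ γ ∧ γ + 4 * δ < 0 then -extJacobi γ δ else extJacobi γ δ := by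
  unfold extJacobi
  rw [jacobiSym_add_four_mul_left]
  split_ifs <;> first | rfl | omega

lemma epsilonFactor_add {γ δ : ℤ} (hγ : γ % 4 = 0) :
    epsilonFactor (γ + δ) = epsilonFactor δ := by
  unfold epsilonFactor
  rw [show (γ + δ) % 4 = δ % 4 by omega]

/-! ### Branches of the principal square root -/

lemma csqrt_sq (w : ℂ) : csqrt w ^ 2 = w := by
  rw [csqrt, ← Complex.cpow_nat_mul]
  norm_num

lemma csqrt_one : csqrt 1 = 1 := by simp [csqrt]

lemma csqrt_ne_zero {w : ℂ} (hw : w ≠ 0) : csqrt w ≠ 0 := by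
  intro h
  apply hw
  rw [← csqrt_sq w, h]
  simp

lemma norm_csqrt (w : ℂ) : ‖csqrt w‖ = √‖w‖ := by
  rw [eq_comm, Real.sqrt_eq_iff_eq_sq (norm_nonneg _) (norm_nonneg _), ← norm_pow, csqrt_sq]

/-- Half of the principal argument lies in (-π/2, π/2]. Together with `eq_csqrt` this pins down the
branch. -/
lemma csqrt_re_pos_or {w : ℂ} (hw : w ≠ 0) :
    0 < (csqrt w).re ∨ ((csqrt w).re = 0 ∧ 0 < (csqrt w).im) := by
  have h : csqrt w = cexp (Real.log ‖w‖ / 2 : ℝ) * (Real.cos (w.arg / 2) +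
      Real.sin (w.arg / 2) * I) := by
    rw [csqrt, Complex.cpow_def_of_ne_zero hw, Complex.log, Complex.ofReal_cos,
      Complex.ofReal_sin, ← Complex.exp_mul_I, ← Complex.exp_add]
    congr 1
    push_cast
    ring
  rw [← Complex.ofReal_exp] at h
  have hre : (csqrt w).re = Real.exp (Real.log ‖w‖ / 2) * Real.cos (w.arg / 2) := by
    rw [h, re_ofReal_mul]; simp [-ofReal_cos, -ofReal_sin]
  have him : (csqrt w).im = Real.exp (Real.log ‖w‖ / 2) * Real.sin (w.arg / 2) := by
    rw [h, im_ofReal_mul]; simp [-ofReal_cos, -ofReal_sin]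
  have h1 := Complex.neg_pi_lt_arg w
  rcases (Complex.arg_le_pi w).lt_or_eq with h2 | h2
  · left
    rw [hre]
    exact mul_pos (Real.exp_pos _) (Real.cos_pos_of_mem_Ioo ⟨by linarith, by linarith⟩)
  · right
    rw [hre, him, h2, Real.cos_pi_div_two, Real.sin_pi_div_two]
    simp [Real.exp_pos]

lemma eq_csqrt {s w : ℂ} (hs : s ^ 2 = w) (h : 0 < s.re ∨ (s.re = 0 ∧ 0 < s.im)) :
    csqrt w = s := by
  have hw : w ≠ 0 := by
    rintro rfl
    have : s = 0 := by simpa using hs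
    simp [this] at h
  have h' := csqrt_re_pos_or hw
  have h2 : csqrt w ^ 2 = s ^ 2 := by rw [csqrt_sq, hs]
  rcases sq_eq_sq_iff_eq_or_eq_neg.mp h2 with h2 | h2
  · exact h2
  · rw [h2] at h'
    simp only [neg_re, neg_im] at h'
    exfalso
    rcases h with h | ⟨h, h0⟩ <;> rcases h' with h' | ⟨h', h0'⟩ <;> linarith

lemma csqrt_im (w : ℂ) : 2 * (csqrt w).re * (csqrt w).im = w.im := by
  conv_rhs => rw [← csqrt_sq w]
  rw [sq, mul_im]
  ring

lemma csqrt_re (w : ℂ) : (csqrt w).re ^ 2 - (csqrt w).im ^ 2 = w.re := by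
  conv_rhs => rw [← csqrt_sq w, sq, mul_re]
  ring

lemma csqrt_pos_of_im_pos {w : ℂ} (hw : 0 < w.im) : 0 < (csqrt w).re ∧ 0 < (csqrt w).im := by
  have hne : w ≠ 0 := by rintro rfl; simp at hw
  have h := csqrt_im w
  rcases csqrt_re_pos_or hne with h1 | h1
  · exact ⟨h1, by nlinarith⟩
  · rw [h1.1] at h; linarith

lemma csqrt_of_im_neg {w : ℂ} (hw : w.im < 0) : 0 < (csqrt w).re ∧ (csqrt w).im < 0 := by
  have hne : w ≠ 0 := by rintro rfl; simp at hw
  have h := csqrt_im w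
  rcases csqrt_re_pos_or hne with h1 | h1
  · exact ⟨h1, by nlinarith⟩
  · rw [h1.1] at h; linarith

lemma csqrt_neg_one : csqrt (-1) = I := eq_csqrt (by simp) (by simp)

/-- Products of square roots, the second factor in the upper half plane, the first not. -/
lemma csqrt_mul_of_im_neg {w₁ w₂ : ℂ} (h1 : w₁.im < 0) (h2 : 0 < w₂.im) :
    csqrt (w₁ * w₂) = csqrt w₁ * csqrt w₂ := by
  obtain ⟨a1, b1⟩ := csqrt_of_im_neg h1
  obtain ⟨a2, b2⟩ := csqrt_pos_of_im_pos h2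
  refine eq_csqrt (by rw [mul_pow, csqrt_sq, csqrt_sq]) (Or.inl ?_)
  rw [mul_re]
  nlinarith [mul_pos a1 a2, mul_pos (neg_pos.mpr b1) b2]

/-- The roots have arguments in [0, π/2] and (0, π/2), so their product lies in the upper half
plane. It is the wrong root exactly when its real part is negative, which the imaginary part of w₁w₂
detects. -/
lemma csqrt_mul_of_im_nonneg {w₁ w₂ : ℂ} (hw : w₁ ≠ 0) (h1 : 0 ≤ w₁.im) (h2 : 0 < w₂.im) :
    csqrt (w₁ * w₂) = (if (w₁ * w₂).im < 0 then -1 else 1) * (csqrt w₁ * csqrt w₂) := by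
  obtain ⟨a2, b2⟩ := csqrt_pos_of_im_pos h2
  have hs : (csqrt w₁ * csqrt w₂) ^ 2 = w₁ * w₂ := by rw [mul_pow, csqrt_sq, csqrt_sq]
  have h3 := csqrt_im w₁
  have him : 0 < (csqrt w₁ * csqrt w₂).im := by
    rw [mul_im]
    rcases csqrt_re_pos_or hw with h | h
    · have : 0 ≤ (csqrt w₁).im := by
        by_contra hc
        nlinarith
      positivity
    · rw [h.1]
      nlinarith [mul_pos h.2 a2]
  have h4 : 2 * (csqrt w₁ * csqrt w₂).re * (csqrt w₁ * csqrt w₂).im = (w₁ * w₂).im := by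
    rw [← hs, sq, mul_im (csqrt w₁ * csqrt w₂)]
    ring
  split_ifs with h
  · refine eq_csqrt (by rw [mul_pow, hs]; ring) (Or.inl ?_)
    rw [neg_one_mul, neg_re]
    nlinarith
  · rw [one_mul]
    refine eq_csqrt hs ?_
    rcases lt_trichotomy (csqrt w₁ * csqrt w₂).re 0 with h5 | h5 | h5
    · nlinarith
    · exact Or.inr ⟨h5, him⟩
    · exact Or.inl h5

/-- The product of the roots has argument in (-π/4, 3π/4), so re + im > 0. A number whose square has
positive real part satisfies |re| > |im|, hence re > 0. -/
lemma csqrt_mul_of_re_pos {w₁ w₂ : ℂ} (h1 : 0 < w₁.re) (h2 : 0 < w₂.im)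
    (h12 : 0 < (w₁ * w₂).re) : csqrt (w₁ * w₂) = csqrt w₁ * csqrt w₂ := by
  obtain ⟨a2, b2⟩ := csqrt_pos_of_im_pos h2
  have hs : (csqrt w₁ * csqrt w₂) ^ 2 = w₁ * w₂ := by rw [mul_pow, csqrt_sq, csqrt_sq]
  have h3 := csqrt_re w₁
  have h4 : (csqrt w₁ * csqrt w₂).re ^ 2 - (csqrt w₁ * csqrt w₂).im ^ 2 = (w₁ * w₂).re := by
    rw [← hs, sq (csqrt w₁ * csqrt w₂), mul_re (csqrt w₁ * csqrt w₂)]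
    ring
  have hne : w₁ ≠ 0 := by rintro rfl; simp at h1
  have a1 : 0 < (csqrt w₁).re := by
    rcases csqrt_re_pos_or hne with h | h
    · exact h
    · rw [h.1] at h3
      nlinarith
  have hlt : |(csqrt w₁).im| < (csqrt w₁).re := abs_lt_of_sq_lt_sq (by linarith) a1.le
  obtain ⟨hl, hr⟩ := abs_lt.mp hlt
  have h5 : 0 < (csqrt w₁ * csqrt w₂).re + (csqrt w₁ * csqrt w₂).im := by
    rw [mul_re, mul_im]
    nlinarith [mul_pos a2 (show 0 < (csqrt w₁).re + (csqrt w₁).im by linarith),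
      mul_pos b2 (show 0 < (csqrt w₁).re - (csqrt w₁).im by linarith)]
  refine eq_csqrt hs (Or.inl ?_)
  by_contra hc
  nlinarith

/-! ### The transformation of the theta function under `Γ₀(4)` -/

lemma det_eq (A : SL(2, ℤ)) : A 0 0 * A 1 1 - A 0 1 * A 1 0 = 1 := by
  have := A.det_coe
  rwa [Matrix.det_fin_two] at this

lemma mul_one_zero_entry (A B : SL(2, ℤ)) :
    (A * B) 1 0 = A 1 0 * B 0 0 + A 1 1 * B 1 0 := by
  simp [Matrix.mul_apply, Fin.sum_univ_two]

lemma mul_one_one_entry (A B : SL(2, ℤ)) :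
    (A * B) 1 1 = A 1 0 * B 0 1 + A 1 1 * B 1 1 := by
  simp [Matrix.mul_apply, Fin.sum_univ_two]

lemma autFactor_im (A : SL(2, ℤ)) (τ : ℍ) : (autFactor A τ).im = A 1 0 * τ.im := by
  simp [autFactor]

lemma autFactor_re (A : SL(2, ℤ)) (τ : ℍ) : (autFactor A τ).re = A 1 0 * τ.re + A 1 1 := by
  simp [autFactor]

lemma autFactor_ne_zero (A : SL(2, ℤ)) (τ : ℍ) : autFactor A τ ≠ 0 := by
  intro h
  have h1 := congrArg Complex.im h
  have h2 := congrArg Complex.re h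
  rw [autFactor_im] at h1
  rw [autFactor_re] at h2
  have hγ : A 1 0 = 0 := by
    have : (A 1 0 : ℝ) = 0 := by
      rcases mul_eq_zero.mp h1 with h | h
      · exact h
      · exact absurd h τ.im_pos.ne'
    exact_mod_cast this
  have hδ : A 1 1 = 0 := by
    rw [hγ] at h2
    have : (A 1 1 : ℝ) = 0 := by simpa using h2
    exact_mod_cast this
  have := det_eq A
  rw [hγ, hδ] at this
  simp at this

lemma coe_smul_eq (A : SL(2, ℤ)) (τ : ℍ) :
    ((A • τ : ℍ) : ℂ) = ((A 0 0 : ℤ) * τ + (A 0 1 : ℤ)) / autFactor A τ := by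
  rw [UpperHalfPlane.coe_specialLinearGroup_apply]
  simp [autFactor]

lemma autFactor_mul (A B : SL(2, ℤ)) (τ : ℍ) :
    autFactor (A * B) τ = autFactor A (B • τ) * autFactor B τ := by
  have h := autFactor_ne_zero B τ
  rw [autFactor, autFactor.eq_1 A, coe_smul_eq]
  rw [mul_one_zero_entry, mul_one_one_entry]
  field_simp
  rw [autFactor]
  push_cast
  ring

lemma im_smul_eq (A : SL(2, ℤ)) (τ : ℍ) : (A • τ).im = τ.im / ‖autFactor A τ‖ ^ 2 := by
  rw [← UpperHalfPlane.coe_im, coe_smul_eq, Complex.div_im, ← Complex.normSq_eq_norm_sq,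
    autFactor_im, autFactor_re, div_sub_div_same]
  congr 1
  simp only [add_im, mul_im, intCast_re, intCast_im, UpperHalfPlane.coe_im, UpperHalfPlane.coe_re,
    add_re, mul_re]
  have : (A 0 0 * A 1 1 - A 0 1 * A 1 0 : ℝ) = 1 := by exact_mod_cast det_eq A
  linear_combination τ.im * this

/-- The multiplier of the theta function on `Γ₀(4)`. -/
noncomputable def thetaMultiplier (γ δ : ℤ) : ℂ := (extJacobi γ δ : ℂ) * (epsilonFactor δ)⁻¹

/-- The transformation formula of `jacobiTheta₂ v (2 τ)` under `A`, at the point `τ`. -/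
def ThetaTransforms (A : SL(2, ℤ)) (τ : ℍ) : Prop :=
  ∀ v : ℂ, jacobiTheta₂ (v / autFactor A τ) (2 * (A • τ : ℍ)) =
    thetaMultiplier (A 1 0) (A 1 1) * csqrt (autFactor A τ) *
      expTwoPi ((A 1 0 : ℤ) * v ^ 2 / (4 * autFactor A τ)) * jacobiTheta₂ v (2 * τ)

/-- The quadratic exponential is a cocycle by itself, so composing two formulas only requires the
scalar cocycle `hj`. An equivalence is needed because the descent multiplies by generators and by
their inverses. -/
lemma thetaTransforms_mul_iff {A B : SL(2, ℤ)} {τ : ℍ}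
    (hj : thetaMultiplier ((A * B) 1 0) ((A * B) 1 1) * csqrt (autFactor (A * B) τ) =
      thetaMultiplier (A 1 0) (A 1 1) * csqrt (autFactor A (B • τ)) *
        (thetaMultiplier (B 1 0) (B 1 1) * csqrt (autFactor B τ)))
    (hB : ThetaTransforms B τ) : ThetaTransforms (A * B) τ ↔ ThetaTransforms A (B • τ) := by
  have hωB := autFactor_ne_zero B τ
  have hωA := autFactor_ne_zero A (B • τ)
  have key : ∀ v : ℂ, thetaMultiplier (A 1 0) (A 1 1) * csqrt (autFactor A (B • τ)) *
      expTwoPi ((A 1 0 : ℤ) * (v / autFactor B τ) ^ 2 / (4 * autFactor A (B • τ))) *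
        jacobiTheta₂ (v / autFactor B τ) (2 * (B • τ : ℍ)) =
      thetaMultiplier ((A * B) 1 0) ((A * B) 1 1) * csqrt (autFactor (A * B) τ) *
        expTwoPi (((A * B) 1 0 : ℤ) * v ^ 2 / (4 * autFactor (A * B) τ)) *
          jacobiTheta₂ v (2 * τ) := by
    intro v
    rw [hB v, hj, autFactor_mul]
    have e : (((A * B) 1 0 : ℤ) : ℂ) * v ^ 2 / (4 * (autFactor A (B • τ) * autFactor B τ)) =
        (A 1 0 : ℤ) * (v / autFactor B τ) ^ 2 / (4 * autFactor A (B • τ)) +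
          (B 1 0 : ℤ) * v ^ 2 / (4 * autFactor B τ) := by
      have hd : ((B 0 0 : ℤ) : ℂ) * (B 1 1 : ℤ) - (B 0 1 : ℤ) * (B 1 0 : ℤ) = 1 := by
        exact_mod_cast det_eq B
      have hA' : autFactor A (B • τ) * autFactor B τ = (A 1 0 : ℤ) * ((B 0 0 : ℤ) * τ +
          (B 0 1 : ℤ)) + (A 1 1 : ℤ) * autFactor B τ := by
        rw [autFactor.eq_1 A, coe_smul_eq]
        field_simp
      have hB' : autFactor B τ = (B 1 0 : ℤ) * τ + (B 1 1 : ℤ) := rfl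
      rw [mul_one_zero_entry]
      push_cast
      field_simp
      generalize autFactor A (B • τ) = a at *
      generalize autFactor B τ = b at *
      have : (A 1 0 : ℂ) + b * ((B 1 0 : ℂ) * a) - b * (A 1 0 * B 0 0 + A 1 1 * B 1 0) = 0 := by
        linear_combination (B 1 0 : ℂ) * hA' - (A 1 0 : ℂ) * hd - (A 1 0 * B 0 0 : ℂ) * hB'
      linear_combination (-v ^ 2) * this
    rw [e, expTwoPi_add]
    ring
  constructor
  · intro h w
    have h1 := h (w * autFactor B τ)
    have h2 := key (w * autFactor B τ)
    rw [mul_div_cancel_right₀ _ hωB] at h2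
    rw [h2, ← h1, autFactor_mul, mul_smul, mul_div_mul_right _ _ hωB]
  · intro h v
    rw [← key v, ← h, autFactor_mul, mul_smul, div_div, mul_comm (autFactor A (B • τ))]

/-! ### Generators and descent on the bottom row -/

/-- The generator `(1, 0; 4, 1)` of `Γ₀(4)`. -/
def lowerFour : SL(2, ℤ) := ⟨!![1, 0; 4, 1], by simp⟩

lemma mul_lowerFour_entries (A : SL(2, ℤ)) :
    (A * lowerFour) 1 0 = A 1 0 + 4 * A 1 1 ∧ (A * lowerFour) 1 1 = A 1 1 := by
  rw [mul_one_zero_entry, mul_one_one_entry]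
  simp [lowerFour, mul_comm]

lemma mul_T_entries (A : SL(2, ℤ)) :
    (A * ModularGroup.T) 1 0 = A 1 0 ∧ (A * ModularGroup.T) 1 1 = A 1 0 + A 1 1 := by
  rw [mul_one_zero_entry, mul_one_one_entry]
  simp [ModularGroup.T]

lemma thetaTransforms_of_zero_one {A : SL(2, ℤ)} (h0 : A 1 0 = 0) (h1 : A 1 1 = 1) (τ : ℍ) :
    ThetaTransforms A τ := by
  intro v
  have hω : autFactor A τ = 1 := by simp [autFactor, h0, h1]
  have ha : A 0 0 = 1 := by
    have := det_eq A
    rw [h0, h1] at this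
    linarith
  have hc : (2 * ((A • τ : ℍ) : ℂ)) = 2 * τ + 2 * (A 0 1 : ℤ) := by
    rw [coe_smul_eq, hω, ha]
    push_cast
    ring
  have hm : thetaMultiplier 0 1 = 1 := by
    simp [thetaMultiplier, extJacobi, epsilonFactor]
  rw [hω, h0, h1, hm, hc, csqrt_one]
  simp only [Int.cast_zero, zero_mul, zero_div, expTwoPi_zero, div_one, one_mul]
  refine tsum_congr fun n => ?_
  rw [jacobiTheta₂_term, jacobiTheta₂_term]
  have : (2 * Real.pi * I * n * v + Real.pi * I * n ^ 2 * (2 * τ + 2 * (A 0 1 : ℤ)) : ℂ) =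
      2 * Real.pi * I * n * v + Real.pi * I * n ^ 2 * (2 * τ) +
        ((n ^ 2 * A 0 1 : ℤ) : ℂ) * (2 * Real.pi * I) := by
    push_cast
    ring
  rw [this, Complex.exp_add, Complex.exp_int_mul_two_pi_mul_I, mul_one]

/-- Theta is even in v, -A acts as A does, and the multiplier -i cancels the principal root of -1.
-/
lemma thetaTransforms_of_zero_neg_one {A : SL(2, ℤ)} (h0 : A 1 0 = 0) (h1 : A 1 1 = -1) (τ : ℍ) :
    ThetaTransforms A τ := by
  intro v
  have hA := thetaTransforms_of_zero_one (A := -A) (by simp [h0]) (by simp [h1]) τ v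
  have hω : autFactor A τ = -1 := by simp [autFactor, h0, h1]
  have hω' : autFactor (-A) τ = 1 := by simp [autFactor, h0, h1]
  have hm : thetaMultiplier 0 1 = 1 := by
    simp [thetaMultiplier, extJacobi, epsilonFactor]
  have hm' : thetaMultiplier 0 (-1) = -I := by
    simp [thetaMultiplier, extJacobi, epsilonFactor]
  have e0 : (-A) 1 0 = 0 := by simp [h0]
  have e1 : (-A) 1 1 = 1 := by simp [h1]
  rw [hω', e0, e1, hm, csqrt_one, ModularGroup.SL_neg_smul] at hA
  rw [hω, h0, h1, hm', csqrt_neg_one, div_neg, jacobiTheta₂_neg_left, hA]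
  simp [expTwoPi_zero]

lemma autFactor_lowerFour (τ : ℍ) : autFactor lowerFour τ = 4 * τ + 1 := by
  simp [autFactor, lowerFour]

/-- Inversion conjugates this matrix to a translation: with τ' = τ/(4τ+1), the numbers -1/(2τ') and
-1/(2τ) differ by 2, a period of theta in its second argument. -/
lemma thetaTransforms_lowerFour (τ : ℍ) : ThetaTransforms lowerFour τ := by
  intro v
  have hω : (4 * τ + 1 : ℂ) ≠ 0 := by
    rw [← autFactor_lowerFour]
    exact autFactor_ne_zero _ _
  have hτ : (τ : ℂ) ≠ 0 := τ.ne_zero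
  have hc : ((lowerFour • τ : ℍ) : ℂ) = τ / (4 * τ + 1) := by
    rw [coe_smul_eq, autFactor_lowerFour]
    simp [lowerFour]
  have hm : thetaMultiplier 4 1 = 1 := by simp [thetaMultiplier, extJacobi, epsilonFactor]
  have e0 : lowerFour 1 0 = 4 := by simp [lowerFour]
  have e1 : lowerFour 1 1 = 1 := by simp [lowerFour]
  have him : 0 < (τ / (4 * τ + 1) : ℂ).im := by
    rw [← hc]
    exact (lowerFour • τ).im_pos
  have hwim : 0 < (4 * τ + 1 : ℂ).im := by simpa using τ.im_pos
  have hre : 0 < (-I * (2 * τ) : ℂ).re := by simpa using τ.im_pos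
  rw [autFactor_lowerFour, hc, e0, e1, hm]
  generalize hw : (4 * τ + 1 : ℂ) = w at *
  have hprod : -I * (2 * τ) = -I * (2 * (τ / w)) * w := by
    field_simp
  have hsq : csqrt (-I * (2 * τ)) = csqrt (-I * (2 * (τ / w))) * csqrt w := by
    rw [hprod]
    refine csqrt_mul_of_re_pos ?_ hwim (by rwa [← hprod])
    have : (-I * (2 * (τ / w) : ℂ)).re = 2 * (τ / w : ℂ).im := by
      simp [mul_re, mul_im]
    rw [this]
    linarith
  have hs1 : csqrt (-I * (2 * τ)) ≠ 0 := csqrt_ne_zero (by simp [hτ])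
  rw [hsq] at hs1
  obtain ⟨hs3, hs2⟩ := mul_ne_zero_iff.mp hs1
  have a1 : v / w / (2 * (τ / w)) = v / (2 * τ) := by
    field_simp
  have a2 : -1 / (2 * (τ / w)) + 2 = -1 / (2 * τ) := by
    field_simp
    linear_combination hw
  have a3 : cexp (-Real.pi * I * (v / w) ^ 2 / (2 * (τ / w))) =
      expTwoPi ((4 : ℤ) * v ^ 2 / (4 * w)) * cexp (-Real.pi * I * v ^ 2 / (2 * τ)) := by
    rw [expTwoPi, ← Complex.exp_add]
    congr 1
    push_cast
    field_simp
    linear_combination -v ^ 2 * hw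
  rw [jacobiTheta₂_functional_equation, jacobiTheta₂_functional_equation v (2 * τ), a1, ← a2,
    jacobiTheta₂_add_right]
  change 1 / csqrt _ * _ * _ = 1 * _ * _ * (1 / csqrt _ * _ * _)
  rw [hsq, a3]
  field_simp

lemma csqrt_autFactor_mul_lowerFour (A : SL(2, ℤ)) (τ : ℍ) :
    csqrt (autFactor (A * lowerFour) τ) =
      (if 0 ≤ A 1 0 ∧ A 1 0 + 4 * A 1 1 < 0 then -1 else 1) *
        (csqrt (autFactor A (lowerFour • τ)) * csqrt (autFactor lowerFour τ)) := by
  have h2 : 0 < (autFactor lowerFour τ).im := by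
    have := τ.im_pos
    rw [autFactor_im]
    simp [lowerFour, this]
  have h1 : (autFactor A (lowerFour • τ)).im = A 1 0 * (lowerFour • τ).im := autFactor_im _ _
  have h12 : (autFactor (A * lowerFour) τ).im = ((A 1 0 + 4 * A 1 1 : ℤ) : ℝ) * τ.im := by
    rw [autFactor_im, (mul_lowerFour_entries A).1]
  rcases lt_or_ge (A 1 0) 0 with h | h
  · rw [if_neg (by omega), autFactor_mul, one_mul]
    refine csqrt_mul_of_im_neg ?_ h2
    rw [h1]
    exact mul_neg_of_neg_of_pos (by exact_mod_cast h) (lowerFour • τ).im_pos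
  · have h1' : 0 ≤ (autFactor A (lowerFour • τ)).im := by
      rw [h1]
      exact mul_nonneg (by exact_mod_cast h) (lowerFour • τ).im_pos.le
    have := csqrt_mul_of_im_nonneg (autFactor_ne_zero A (lowerFour • τ)) h1' h2
    rw [← autFactor_mul, h12] at this
    rw [this]
    congr 1
    have hiff : ((A 1 0 + 4 * A 1 1 : ℤ) : ℝ) * τ.im < 0 ↔ A 1 0 + 4 * A 1 1 < 0 := by
      rw [← not_le, ← not_le, mul_nonneg_iff_of_pos_right τ.im_pos]
      exact_mod_cast Iff.rfl
    simp only [hiff, h, true_and]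

/-- Euclidean descent on |γ| + |δ|, with moves δ ↦ δ ± γ and γ ↦ γ ± 4δ. It ends at γ = 0, where
coprimality forces δ = ±1. -/
lemma euclid_induction {Q : ℤ → ℤ → Prop} (h1 : Q 0 1) (h1' : Q 0 (-1))
    (hT : ∀ γ δ : ℤ, γ % 4 = 0 → δ % 2 = 1 → (Q γ (γ + δ) ↔ Q γ δ))
    (hV : ∀ γ δ : ℤ, γ % 4 = 0 → δ % 2 = 1 → (Q (γ + 4 * δ) δ ↔ Q γ δ)) (γ δ : ℤ)
    (hγ : γ % 4 = 0) (hδ : δ % 2 = 1) (hc : IsCoprime γ δ) : Q γ δ := by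
  induction hn : γ.natAbs + δ.natAbs using Nat.strong_induction_on generalizing γ δ with
  | _ n ih =>
    have addT : IsCoprime γ (γ + δ) := by simpa [add_comm] using hc.add_mul_left_right 1
    have subT : IsCoprime γ (δ - γ) := by simpa [sub_eq_add_neg] using hc.add_mul_left_right (-1)
    have addV : IsCoprime (γ + 4 * δ) δ := by simpa using hc.add_mul_right_left 4
    have subV : IsCoprime (γ - 4 * δ) δ := by
      simpa [sub_eq_add_neg] using hc.add_mul_right_left (-4)
    have hT' := hT γ (δ - γ) hγ (by omega)
    rw [add_sub_cancel] at hT'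
    have hV' := hV (γ - 4 * δ) δ (by omega) hδ
    rw [sub_add_cancel] at hV'
    by_cases h0 : γ = 0
    · subst h0
      rcases Int.isUnit_iff.mp (isCoprime_zero_left.mp hc) with rfl | rfl
      · exact h1
      · exact h1'
    -- The first move shrinks δ when 0 < |γ| < 2|δ|, the second shrinks γ when |γ| > 2|δ|. Equality
    -- cannot occur, because 4 ∣ γ and δ is odd.
    · by_cases hlt : γ.natAbs < 2 * δ.natAbs
      · by_cases hs : (0 < γ ↔ 0 < δ)
        · exact hT'.mpr (ih _ (by omega) γ (δ - γ) hγ (by omega) subT rfl)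
        · exact (hT γ δ hγ hδ).mp (ih _ (by omega) γ (γ + δ) hγ (by omega) addT rfl)
      · by_cases hs : (0 < γ ↔ 0 < δ)
        · exact hV'.mpr (ih _ (by omega) (γ - 4 * δ) δ (by omega) hδ subV rfl)
        · exact (hV γ δ hγ hδ).mp (ih _ (by omega) (γ + 4 * δ) δ (by omega) hδ addV rfl)

/-- Quantifying over all matrices with a given bottom row and over all τ lets the induction see only
the bottom row; right multiplication by B is a bijection between the two families. -/
lemma forall_matrix_mul_iff {P : SL(2, ℤ) → ℍ → Prop} {γ δ γ' δ' : ℤ} (B : SL(2, ℤ))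
    (h : ∀ A : SL(2, ℤ), (A 1 0 = γ ∧ A 1 1 = δ) ↔ ((A * B) 1 0 = γ' ∧ (A * B) 1 1 = δ'))
    (hP : ∀ A : SL(2, ℤ), A 1 0 = γ → A 1 1 = δ → ∀ τ, (P (A * B) τ ↔ P A (B • τ))) :
    (∀ A : SL(2, ℤ), A 1 0 = γ' → A 1 1 = δ' → ∀ τ, P A τ) ↔
      ∀ A : SL(2, ℤ), A 1 0 = γ → A 1 1 = δ → ∀ τ, P A τ := by
  constructor
  · intro hQ A h0 h1 τ
    have h2 := (h A).mp ⟨h0, h1⟩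
    have := (hP A h0 h1 (B⁻¹ • τ)).mp (hQ (A * B) h2.1 h2.2 (B⁻¹ • τ))
    rwa [smul_inv_smul] at this
  · intro hQ A h0 h1 τ
    have h2 := (h (A * B⁻¹)).mpr (by rw [inv_mul_cancel_right]; exact ⟨h0, h1⟩)
    have := (hP (A * B⁻¹) h2.1 h2.2 τ).mpr (hQ _ h2.1 h2.2 _)
    rwa [inv_mul_cancel_right] at this

/-- The theta transformation formula on `Γ₀(4)`. -/
theorem thetaTransforms {A : SL(2, ℤ)} (hA : A 1 0 % 4 = 0) (τ : ℍ) : ThetaTransforms A τ := by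
  have hdet := det_eq A
  have hodd : A 1 1 % 2 = 1 := by
    rcases Int.emod_two_eq_zero_or_one (A 1 1) with h | h
    · exfalso
      obtain ⟨k, hk⟩ := Int.dvd_of_emod_eq_zero h
      obtain ⟨l, hl⟩ := Int.dvd_of_emod_eq_zero hA
      rw [hk, hl] at hdet
      have : 2 * (A 0 0 * k - 2 * (A 0 1 * l)) = 1 := by linarith
      omega
    · exact h
  have hcop : IsCoprime (A 1 0) (A 1 1) := ⟨-A 0 1, A 0 0, by linarith⟩
  refine euclid_induction
    (Q := fun γ δ => ∀ A : SL(2, ℤ), A 1 0 = γ → A 1 1 = δ → ∀ τ, ThetaTransforms A τ)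
    (fun A h0 h1 => thetaTransforms_of_zero_one h0 h1)
    (fun A h0 h1 => thetaTransforms_of_zero_neg_one h0 h1)
    (fun γ δ hγ hδ => forall_matrix_mul_iff ModularGroup.T (fun A => ?_) fun A h0 h1 τ => ?_)
    (fun γ δ hγ hδ => forall_matrix_mul_iff lowerFour (fun A => ?_) fun A h0 h1 τ => ?_)
    (A 1 0) (A 1 1) hA hodd hcop A rfl rfl τ
  · rw [(mul_T_entries A).1, (mul_T_entries A).2]
    constructor <;> rintro ⟨rfl, h⟩ <;> exact ⟨rfl, by linarith⟩
  · refine thetaTransforms_mul_iff ?_ (thetaTransforms_of_zero_one (by simp [ModularGroup.T])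
      (by simp [ModularGroup.T]) τ)
    have hω : autFactor ModularGroup.T τ = 1 := by simp [autFactor, ModularGroup.T]
    have hm : thetaMultiplier (ModularGroup.T 1 0) (ModularGroup.T 1 1) = 1 := by
      simp [thetaMultiplier, extJacobi, epsilonFactor, ModularGroup.T]
    rw [autFactor_mul, hω, hm, csqrt_one, (mul_T_entries A).1, (mul_T_entries A).2, h0, h1, thetaMultiplier, thetaMultiplier,
      extJacobi_add_right hγ hδ, epsilonFactor_add hγ]
    ring_nf
  · rw [(mul_lowerFour_entries A).1, (mul_lowerFour_entries A).2]
    constructor <;> rintro ⟨h, rfl⟩ <;> exact ⟨by linarith, rfl⟩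
  · refine thetaTransforms_mul_iff ?_ (thetaTransforms_lowerFour τ)
    have hm : thetaMultiplier (lowerFour 1 0) (lowerFour 1 1) = 1 := by
      simp [thetaMultiplier, extJacobi, epsilonFactor, lowerFour]
    -- The sign of the square root and the sign of the extended Jacobi symbol occur under the same
    -- condition and cancel.
    rw [hm, csqrt_autFactor_mul_lowerFour, (mul_lowerFour_entries A).1,
      (mul_lowerFour_entries A).2, h0, h1, thetaMultiplier, thetaMultiplier,
      extJacobi_add_left]
    split_ifs <;> push_cast <;> ring

/-! ### The Gaussian error function -/

/-- The error function `2 ∫₀ˣ exp(-π t²) dt`. -/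
noncomputable def gaussE (x : ℝ) : ℝ := 2 * ∫ t in (0 : ℝ)..x, Real.exp (-Real.pi * t ^ 2)

lemma continuous_gaussian : Continuous fun t : ℝ => Real.exp (-Real.pi * t ^ 2) := by fun_prop

lemma hasDerivAt_gaussE (x : ℝ) : HasDerivAt gaussE (2 * Real.exp (-Real.pi * x ^ 2)) x :=
  (continuous_gaussian.integral_hasStrictDerivAt 0 x).hasDerivAt.const_mul 2

lemma gaussE_zero : gaussE 0 = 0 := by simp [gaussE]

lemma gaussE_neg (x : ℝ) : gaussE (-x) = -gaussE x := by
  have := intervalIntegral.integral_comp_neg (a := 0) (b := x)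
    (fun t : ℝ => Real.exp (-Real.pi * t ^ 2))
  simp only [neg_sq, neg_zero] at this
  rw [gaussE, gaussE, this, intervalIntegral.integral_symm]
  ring

lemma tendsto_gaussE : Tendsto gaussE atTop (𝓝 1) := by
  have h := intervalIntegral_tendsto_integral_Ioi 0
    (integrable_exp_neg_mul_sq Real.pi_pos).integrableOn tendsto_id
  rw [integral_gaussian_Ioi, div_self Real.pi_pos.ne', Real.sqrt_one] at h
  have := h.const_mul 2
  rwa [show (2 : ℝ) * (1 / 2) = 1 by norm_num] at this

lemma gaussE_mono : Monotone gaussE :=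
  monotone_of_hasDerivAt_nonneg hasDerivAt_gaussE fun x => by positivity

lemma gaussE_le_one (x : ℝ) : gaussE x ≤ 1 := gaussE_mono.ge_of_tendsto tendsto_gaussE x

/-- Shift the tail to start at 0 and use (t+x)² ≥ t² + x²: what remains is exp(-πx²) times a value
of `gaussE`. -/
lemma one_sub_gaussE_le {x : ℝ} (hx : 0 ≤ x) : 1 - gaussE x ≤ Real.exp (-Real.pi * x ^ 2) := by
  have hii : ∀ a b : ℝ, IntervalIntegrable (fun t : ℝ => Real.exp (-Real.pi * t ^ 2)) volume a b :=
    fun a b => continuous_gaussian.intervalIntegrable a b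
  have key : ∀ T, x ≤ T → gaussE T - gaussE x ≤ Real.exp (-Real.pi * x ^ 2) := by
    intro T hT
    have h1 : gaussE T - gaussE x = 2 * ∫ t in x..T, Real.exp (-Real.pi * t ^ 2) := by
      rw [gaussE, gaussE, ← intervalIntegral.integral_add_adjacent_intervals (hii 0 x) (hii x T)]
      ring
    have h2 : ∫ t in x..T, Real.exp (-Real.pi * t ^ 2) =
        ∫ t in (0 : ℝ)..(T - x), Real.exp (-Real.pi * (t + x) ^ 2) := by
      rw [intervalIntegral.integral_comp_add_right (fun t : ℝ => Real.exp (-Real.pi * t ^ 2))]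
      simp
    have h3 : ∫ t in (0 : ℝ)..(T - x), Real.exp (-Real.pi * (t + x) ^ 2) ≤
        ∫ t in (0 : ℝ)..(T - x), Real.exp (-Real.pi * x ^ 2) * Real.exp (-Real.pi * t ^ 2) := by
      refine intervalIntegral.integral_mono_on (by linarith)
        (Continuous.intervalIntegrable (by fun_prop) _ _)
        (Continuous.intervalIntegrable (by fun_prop) _ _) fun t ht => ?_
      rw [← Real.exp_add, Real.exp_le_exp]
      nlinarith [mul_nonneg Real.pi_pos.le (mul_nonneg ht.1 hx)]
    rw [intervalIntegral.integral_const_mul] at h3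
    have h4 := gaussE_le_one (T - x)
    rw [gaussE] at h4
    have h5 := Real.exp_pos (-Real.pi * x ^ 2)
    rw [h1, h2]
    nlinarith
  refine le_of_tendsto (tendsto_gaussE.sub_const _) ?_
  filter_upwards [eventually_ge_atTop x] with T hT using key T hT

lemma abs_gaussE_le_one (x : ℝ) : |gaussE x| ≤ 1 := by
  rw [abs_le]
  refine ⟨?_, gaussE_le_one x⟩
  have := gaussE_le_one (-x)
  rw [gaussE_neg] at this
  linarith

/-- The deviation of the error function from the sign of an integer, shifted by `a`. -/
lemma abs_sign_sub_gaussE_le {y : ℝ} (hy : 0 < y) (a : ℝ) (n : ℤ) :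
    |(n.sign : ℝ) - gaussE (2 * √y * (n + a))| ≤
      2 * Real.exp (4 * Real.pi * y * a ^ 2) * Real.exp (-4 * Real.pi * y * (n + a) ^ 2) := by
  have hpos : ∀ (n : ℤ) (a : ℝ), 0 < n → |1 - gaussE (2 * √y * (n + a))| ≤
      2 * Real.exp (4 * Real.pi * y * a ^ 2) * Real.exp (-4 * Real.pi * y * (n + a) ^ 2) := by
    intro n a hn
    have hn' : (0 : ℝ) < n := by exact_mod_cast hn
    rcases le_or_gt 0 ((n : ℝ) + a) with h | h
    · have h1 := one_sub_gaussE_le (x := 2 * √y * (n + a)) (by positivity)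
      rw [mul_pow, mul_pow, Real.sq_sqrt hy.le] at h1
      rw [abs_of_nonneg (by linarith [gaussE_le_one (2 * √y * (n + a))])]
      have h2 : 1 ≤ Real.exp (4 * Real.pi * y * a ^ 2) := Real.one_le_exp (by positivity)
      rw [show -Real.pi * (2 ^ 2 * y * (n + a) ^ 2) = -4 * Real.pi * y * (n + a) ^ 2 by ring] at h1
      nlinarith [Real.exp_pos (-4 * Real.pi * y * (n + a) ^ 2)]
    -- Here the shift has moved n across zero and the left side is not small. But then (n+a)² ≤ a²,
    -- so the factor exp(4πya²) makes the trivial bound 2 sufficient.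
    · have h1 : |1 - gaussE (2 * √y * (n + a))| ≤ 2 := by
        have := abs_le.mp (abs_gaussE_le_one (2 * √y * (n + a)))
        rw [abs_le]
        constructor <;> linarith
      rw [mul_assoc 2 (Real.exp _), ← Real.exp_add]
      have h2 : 1 ≤ Real.exp (4 * Real.pi * y * a ^ 2 + -4 * Real.pi * y * (n + a) ^ 2) := by
        apply Real.one_le_exp
        have h3 : (n + a) ^ 2 ≤ a ^ 2 := by nlinarith
        have : 0 ≤ 4 * Real.pi * y := by positivity
        nlinarith
      linarith
  rcases lt_trichotomy n 0 with hn | rfl | hn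
  · have := hpos (-n) (-a) (by omega)
    rw [Int.sign_eq_neg_one_of_neg hn]
    push_cast at this ⊢
    rw [show 2 * √y * (-(n : ℝ) + -a) = -(2 * √y * (n + a)) by ring, gaussE_neg, neg_sq,
      show (-(n : ℝ) + -a) ^ 2 = (n + a) ^ 2 by ring, sub_neg_eq_add] at this
    rwa [show -1 - gaussE (2 * √y * (n + a)) = -(1 + gaussE (2 * √y * (n + a))) by ring, abs_neg]
  · simp only [Int.sign_zero, Int.cast_zero, zero_add, zero_sub, abs_neg]
    rw [mul_assoc 2 (Real.exp _), ← Real.exp_add]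
    have := abs_gaussE_le_one (2 * √y * a)
    have h0 : 4 * Real.pi * y * a ^ 2 + -4 * Real.pi * y * a ^ 2 = 0 := by ring
    rw [h0, Real.exp_zero]
    linarith
  · rw [Int.sign_eq_one_of_pos hn, Int.cast_one]
    exact hpos n a hn

/-! ### The non-holomorphic completion -/

/-- The phases `(-1)^n q^(-n²) z^(-2n)`. -/
noncomputable def phase (n : ℤ) (u τ : ℂ) : ℂ := expTwoPi (n / 2 - n ^ 2 * τ - 2 * n * u)

/-- The real coefficients of the completion. -/
noncomputable def signGap (n : ℤ) (u τ : ℂ) : ℝ :=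
  n.sign - gaussE (2 * √τ.im * (n + u.im / τ.im))

/-- The non-holomorphic completion, as a function of the elliptic variable. -/
noncomputable def completion (u τ : ℂ) : ℂ := ∑' n : ℤ, (signGap n u τ : ℂ) * phase n u τ

lemma norm_phase (n : ℤ) (u τ : ℂ) :
    ‖phase n u τ‖ = Real.exp (2 * Real.pi * (n ^ 2 * τ.im + 2 * n * u.im)) := by
  rw [phase, norm_expTwoPi]
  congr 1
  have h1 : ((n : ℂ) / 2).im = 0 := by
    rw [show (n : ℂ) / 2 = ((n / 2 : ℝ) : ℂ) by push_cast; rfl, ofReal_im]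
  have h2 : ((n : ℂ) ^ 2 * τ).im = n ^ 2 * τ.im := by
    rw [show (n : ℂ) ^ 2 = ((n ^ 2 : ℝ) : ℂ) by push_cast; rfl, im_ofReal_mul]
  have h3 : (2 * (n : ℂ) * u).im = 2 * n * u.im := by
    rw [show 2 * (n : ℂ) = ((2 * n : ℝ) : ℂ) by push_cast; rfl, im_ofReal_mul]
  rw [sub_im, sub_im, h1, h2, h3]
  ring

/-- The phases grow like exp(2πn²y), but the Gaussian tail decays like exp(-4πn²y), so the series
converges. The factor exp(4πya²) of the tail bound, a = Im u / y, cancels exactly. -/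
lemma norm_signGap_mul_phase_le {τ : ℂ} (hτ : 0 < τ.im) (n : ℤ) (u : ℂ) :
    ‖(signGap n u τ : ℂ) * phase n u τ‖ ≤
      2 * Real.exp (-2 * Real.pi * (n ^ 2 * τ.im + 2 * n * u.im)) := by
  rw [norm_mul, norm_phase, Complex.norm_real, Real.norm_eq_abs]
  refine (mul_le_mul_of_nonneg_right (abs_sign_sub_gaussE_le hτ _ n) (Real.exp_pos _).le).trans
    (le_of_eq ?_)
  rw [mul_assoc 2, mul_assoc 2, ← Real.exp_add, ← Real.exp_add]
  congr 2
  field_simp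
  ring

/-- This brings the majorant into the shape of the standard term bound for `jacobiTheta₂`, which is
summable with any polynomial weight. -/
lemma neg_two_pi_le {τ u : ℂ} {S : ℝ} (hu : |u.im| ≤ S) (n : ℤ) :
    Real.exp (-2 * Real.pi * (n ^ 2 * τ.im + 2 * n * u.im)) ≤
      Real.exp (-Real.pi * (2 * τ.im * n ^ 2 - 2 * (2 * S) * |n|)) := by
  rw [Real.exp_le_exp]
  have h1 : -((n : ℝ) * u.im) ≤ |(n : ℝ)| * S := by
    refine (neg_le_abs _).trans ?_
    rw [abs_mul]
    gcongr
  rw [Int.cast_abs]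
  nlinarith [mul_le_mul_of_nonneg_left h1 Real.pi_pos.le]

lemma summable_signGap_mul_phase {τ : ℂ} (hτ : 0 < τ.im) (u : ℂ) :
    Summable fun n : ℤ => (signGap n u τ : ℂ) * phase n u τ := by
  have h := (summable_pow_mul_jacobiTheta₂_term_bound (2 * |u.im|)
    (show 0 < 2 * τ.im by positivity) 0).mul_left 2
  refine h.of_norm_bounded fun n => (norm_signGap_mul_phase_le hτ n u).trans ?_
  rw [pow_zero, one_mul]
  exact mul_le_mul_of_nonneg_left (neg_two_pi_le le_rfl n) zero_le_two

/-- `f` is real differentiable at `u` with `(∂/∂x + i ∂/∂y) f = d`. -/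
def HasDbarAt (f : ℂ → ℂ) (d u : ℂ) : Prop :=
  ∃ L : ℂ →L[ℝ] ℂ, HasFDerivAt f L u ∧ L 1 + I * L I = d

/-- The theta function attached to the completion. -/
noncomputable def rankTheta (u τ : ℂ) : ℂ := jacobiTheta₂ (1 / 2 + 2 * u) (2 * τ)

/-- Completing the square: the Gaussian produced by differentiating `gaussE` turns a holomorphic
phase into an antiholomorphic theta term. -/
lemma exp_mul_phase {τ : ℂ} (hτ : 0 < τ.im) (n : ℤ) (u : ℂ) :
    (Real.exp (-Real.pi * (2 * √τ.im * (n + u.im / τ.im)) ^ 2) : ℂ) * phase n u τ =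
      Real.exp (-4 * Real.pi * u.im ^ 2 / τ.im) *
        conj (jacobiTheta₂_term n (1 / 2 + 2 * u) (2 * τ)) := by
  rw [mul_pow, mul_pow, Real.sq_sqrt hτ.le, jacobiTheta₂_term, ← Complex.exp_conj, phase, expTwoPi,
    Complex.ofReal_exp, Complex.ofReal_exp, ← Complex.exp_add, ← Complex.exp_add,
    Complex.exp_eq_exp_iff_exists_int]
  -- The sign (-1)^n appears as exp(πin) on one side and exp(-πin) on the other.
  refine ⟨n, ?_⟩
  have hy : (τ.im : ℂ) ≠ 0 := by exact_mod_cast hτ.ne'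
  have hτ' : conj τ = τ - 2 * I * τ.im := by
    apply Complex.ext <;> simp
    ring
  have hu' : conj u = u - 2 * I * u.im := by
    apply Complex.ext <;> simp
    ring
  simp only [map_add, map_mul, map_pow, map_div₀, map_one, map_ofNat, conj_ofReal, conj_I,
    map_intCast, hτ', hu']
  push_cast
  field_simp
  linear_combination -(4 * (n : ℂ) ^ 2 * τ.im ^ 2 + 8 * n * u.im * τ.im) * I_sq

/-- The real derivative of a summand of the completion. -/
noncomputable def completionDeriv (n : ℤ) (u τ : ℂ) : ℂ →L[ℝ] ℂ :=
  (-4 * Real.pi * I * n * ((signGap n u τ : ℂ) * phase n u τ)) • (ContinuousLinearMap.id ℝ ℂ) +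
    imCLM.smulRight (-(4 * √τ.im / τ.im : ℝ) *
      ((Real.exp (-Real.pi * (2 * √τ.im * (n + u.im / τ.im)) ^ 2) : ℂ) * phase n u τ))

lemma completionDeriv_apply (n : ℤ) (u τ v : ℂ) : completionDeriv n u τ v =
    -4 * Real.pi * I * n * ((signGap n u τ : ℂ) * phase n u τ) * v +
      v.im * (-(4 * √τ.im / τ.im : ℝ) *
        ((Real.exp (-Real.pi * (2 * √τ.im * (n + u.im / τ.im)) ^ 2) : ℂ) * phase n u τ)) := rfl

lemma hasFDerivAt_signGap_mul_phase {τ : ℂ} (n : ℤ) (u : ℂ) :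
    HasFDerivAt (fun u => (signGap n u τ : ℂ) * phase n u τ) (completionDeriv n u τ) u := by
  have h1 : HasFDerivAt (fun u : ℂ => 2 * √τ.im * (n + u.im / τ.im))
      ((2 * √τ.im / τ.im) • imCLM) u := by
    have := ((imCLM.hasFDerivAt (x := u)).const_mul (2 * √τ.im / τ.im)).add_const (2 * √τ.im * n)
    refine this.congr_of_eventuallyEq (Eventually.of_forall fun v => ?_)
    simp only [imCLM_apply]
    ring
  have h2 : HasFDerivAt (fun u : ℂ => signGap n u τ)
      (-((2 * Real.exp (-Real.pi * (2 * √τ.im * (n + u.im / τ.im)) ^ 2)) •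
        ((2 * √τ.im / τ.im) • imCLM))) u :=
    ((hasDerivAt_gaussE _).comp_hasFDerivAt u h1).const_sub _
  have h3 := (ofRealCLM.hasFDerivAt (x := signGap n u τ)).comp u h2
  have h4 : HasDerivAt (fun u => phase n u τ) (-4 * Real.pi * I * n * phase n u τ) u := by
    have : HasDerivAt (fun u : ℂ => 2 * Real.pi * I * (n / 2 - n ^ 2 * τ - 2 * n * u))
        (2 * Real.pi * I * (-(2 * n))) u := by
      simpa using (((hasDerivAt_id u).const_mul (2 * n : ℂ)).const_sub
        (n / 2 - n ^ 2 * τ)).const_mul (2 * Real.pi * I)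
    have h := this.cexp
    rw [show cexp (2 * Real.pi * I * (n / 2 - n ^ 2 * τ - 2 * n * u)) = phase n u τ from rfl] at h
    exact h.congr_deriv (by ring)
  have h5 := h3.mul (h4.hasFDerivAt.restrictScalars ℝ)
  refine h5.congr_fderiv (ContinuousLinearMap.ext fun v => ?_)
  rw [completionDeriv_apply]
  simp
  ring

lemma norm_exp_mul_phase_le {τ : ℂ} (hτ : 0 < τ.im) {S : ℝ} (n : ℤ) {v : ℂ} (hv : |v.im| ≤ S) :
    ‖(Real.exp (-Real.pi * (2 * √τ.im * (n + v.im / τ.im)) ^ 2) : ℂ) * phase n v τ‖ ≤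
      Real.exp (-Real.pi * (2 * τ.im * n ^ 2 - 2 * (2 * S) * |n|)) := by
  refine le_trans ?_ (neg_two_pi_le hv n)
  rw [norm_mul, norm_phase, Complex.norm_real, Real.norm_of_nonneg (Real.exp_pos _).le,
    ← Real.exp_add, Real.exp_le_exp, mul_pow, mul_pow, Real.sq_sqrt hτ.le]
  have h0 : 0 ≤ 4 * Real.pi * v.im ^ 2 / τ.im := by positivity
  have h1 : -Real.pi * (2 ^ 2 * τ.im * (n + v.im / τ.im) ^ 2) +
      2 * Real.pi * (n ^ 2 * τ.im + 2 * n * v.im) =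
      -2 * Real.pi * (n ^ 2 * τ.im + 2 * n * v.im) - 4 * Real.pi * v.im ^ 2 / τ.im := by
    field_simp
    ring
  linarith

lemma norm_completionDeriv_le {τ : ℂ} (hτ : 0 < τ.im) {S : ℝ} (n : ℤ) {v : ℂ} (hv : |v.im| ≤ S) :
    ‖completionDeriv n v τ‖ ≤
      8 * Real.pi * (((|n| : ℤ) : ℝ) ^ 1 * Real.exp (-Real.pi * (2 * τ.im * n ^ 2 - 2 * (2 * S) * |n|))) +
        4 * √τ.im / τ.im *
          (((|n| : ℤ) : ℝ) ^ 0 * Real.exp (-Real.pi * (2 * τ.im * n ^ 2 - 2 * (2 * S) * |n|))) := by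
  have h1 := (norm_signGap_mul_phase_le hτ n v).trans
    (mul_le_mul_of_nonneg_left (neg_two_pi_le hv n) zero_le_two)
  have h2 := norm_exp_mul_phase_le hτ n hv
  generalize Real.exp (-Real.pi * (2 * τ.im * n ^ 2 - 2 * (2 * S) * |n|)) = B at *
  unfold completionDeriv
  refine (norm_add_le _ _).trans (add_le_add ?_ ?_)
  · have h3 : ‖(-4 * Real.pi * I * n : ℂ)‖ = 4 * Real.pi * |(n : ℝ)| := by
      simp [abs_of_pos Real.pi_pos]
    rw [norm_smul, norm_mul, h3, pow_one, Int.cast_abs]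
    calc _ ≤ 4 * Real.pi * |(n : ℝ)| * (2 * B) * 1 :=
          mul_le_mul (mul_le_mul_of_nonneg_left h1 (by positivity))
            ContinuousLinearMap.norm_id_le (norm_nonneg _)
            (mul_nonneg (by positivity) ((norm_nonneg _).trans h1))
      _ = _ := by ring
  · have h3 : ‖(-(4 * √τ.im / τ.im : ℝ) : ℂ)‖ = 4 * √τ.im / τ.im := by
      rw [norm_neg, Complex.norm_real, Real.norm_of_nonneg (by positivity)]
    rw [ContinuousLinearMap.norm_smulRight_apply, norm_mul, pow_zero, one_mul, h3, imCLM_norm,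
      one_mul]
    exact mul_le_mul_of_nonneg_left h2 (by positivity)

/-- The phases are holomorphic in u, so only the dependence of `signGap` on Im u contributes, and
`exp_mul_phase` sums these contributions to a conjugated theta function. -/
lemma hasDbarAt_completion {τ : ℂ} (hτ : 0 < τ.im) (u : ℂ) :
    HasDbarAt (fun u => completion u τ)
      (-(4 * I / √τ.im) * Real.exp (-4 * Real.pi * u.im ^ 2 / τ.im) * conj (rankTheta u τ)) u := by
  set S : ℝ := |u.im| + 1 with hS
  have hsum0 := summable_pow_mul_jacobiTheta₂_term_bound (2 * S) (show 0 < 2 * τ.im by positivity) 0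
  have hsum1 := summable_pow_mul_jacobiTheta₂_term_bound (2 * S) (show 0 < 2 * τ.im by positivity) 1
  have hbound := (hsum1.mul_left (8 * Real.pi)).add (hsum0.mul_left (4 * √τ.im / τ.im))
  set s : Set ℂ := {v | |v.im| < S} with hs
  have hs_open : IsOpen s := isOpen_lt (by fun_prop) continuous_const
  have hs_conn : IsPreconnected s := by
    have : s = imCLM.toLinearMap ⁻¹' (Ioo (-S) S) := by
      ext v
      simp [hs, abs_lt]
    rw [this]
    exact ((convex_Ioo _ _).linear_preimage imCLM.toLinearMap).isPreconnected
  have hus : u ∈ s := by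
    simp only [hs, mem_ofPred_eq, hS]
    linarith
  have hder := hasFDerivAt_tsum_of_isPreconnected hbound hs_open hs_conn
    (fun n v _ => hasFDerivAt_signGap_mul_phase n v)
    (fun n v hv => norm_completionDeriv_le hτ n (le_of_lt hv)) hus
    (summable_signGap_mul_phase hτ u) hus
  refine ⟨_, hder, ?_⟩
  have hsum' : Summable fun n => completionDeriv n u τ :=
    hbound.of_norm_bounded fun n => norm_completionDeriv_le hτ n (le_of_lt hus)
  have happ : ∀ w : ℂ, (∑' n, completionDeriv n u τ) w = ∑' n, completionDeriv n u τ w := fun w =>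
    (ContinuousLinearMap.apply ℝ ℂ w).map_tsum hsum'
  have happs : ∀ w : ℂ, Summable fun n => completionDeriv n u τ w := fun w =>
    hsum'.mapL (ContinuousLinearMap.apply ℝ ℂ w)
  rw [happ, happ, ← tsum_mul_left, ← (happs 1).tsum_add ((happs I).mul_left I), rankTheta,
    jacobiTheta₂, Complex.conj_tsum, ← tsum_mul_left]
  refine tsum_congr fun n => ?_
  rw [mul_assoc, ← exp_mul_phase hτ, completionDeriv_apply, completionDeriv_apply]
  have hsq : (√τ.im : ℂ) ^ 2 = τ.im := by exact_mod_cast Real.sq_sqrt hτ.le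
  have hne : (√τ.im : ℂ) ≠ 0 := by exact_mod_cast (Real.sqrt_pos.mpr hτ).ne'
  rw [I_im, one_im, ofReal_div, ofReal_mul, ofReal_zero, ofReal_one, ← hsq]
  generalize (Real.exp (-Real.pi * (2 * √τ.im * (n + u.im / τ.im)) ^ 2) : ℂ) * phase n u τ = G
  field_simp
  push_cast
  linear_combination (-4 * Real.pi * I * n * ((signGap n u τ : ℂ) * phase n u τ) * √τ.im) * I_sq

lemma phase_add_one (n : ℤ) (u τ : ℂ) : phase n (u + 1) τ = phase n u τ := by
  have : (n / 2 - n ^ 2 * τ - 2 * n * (u + 1) : ℂ) =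
      n / 2 - n ^ 2 * τ - 2 * n * u + ((-2 * n : ℤ) : ℂ) := by
    push_cast
    ring
  rw [phase, this, expTwoPi_add, expTwoPi_intCast, mul_one, phase]

lemma completion_add_one (u τ : ℂ) : completion (u + 1) τ = completion u τ := by
  refine tsum_congr fun n => ?_
  rw [phase_add_one]
  simp [signGap]

lemma phase_add_tau (n : ℤ) (u τ : ℂ) :
    phase n (u + τ) τ = -expTwoPi (τ + 2 * u) * phase (n + 1) u τ := by
  have : (n / 2 - n ^ 2 * τ - 2 * n * (u + τ) : ℂ) = (τ + 2 * u) +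
      (((n + 1 : ℤ) : ℂ) / 2 - ((n + 1 : ℤ) : ℂ) ^ 2 * τ - 2 * ((n + 1 : ℤ) : ℂ) * u) - 1 / 2 := by
    push_cast
    ring
  rw [phase, this, expTwoPi_sub, expTwoPi_add, expTwoPi_half, phase]
  ring

lemma signGap_add_tau {τ : ℂ} (hτ : 0 < τ.im) (n : ℤ) (u : ℂ) :
    signGap n (u + τ) τ = signGap (n + 1) u τ + (n.sign - (n + 1).sign : ℝ) := by
  have : (n + (u + τ).im / τ.im : ℝ) = (n + 1 : ℤ) + u.im / τ.im := by
    rw [add_im, add_div, div_self hτ.ne']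
    push_cast
    ring
  rw [signGap, signGap, this]
  ring

/-- Adding τ to u shifts the index by 1, except in the sign function. Since the sign of 0 is 0, the
jump splits into two unit steps, at n = 0 and n = 1, and these two phases are the inhomogeneous
term. -/
lemma completion_add_tau {τ : ℂ} (hτ : 0 < τ.im) (u : ℂ) :
    completion (u + τ) τ = -expTwoPi (τ + 2 * u) * completion u τ -
      (1 - expTwoPi (τ + 2 * u)) := by
  have hfin : HasSum (fun n : ℤ => ((n - 1).sign - n.sign : ℂ) * phase n u τ)
      (-1 + (expTwoPi (τ + 2 * u))⁻¹) := by
    have h1 : ∀ n ∉ ({0, 1} : Finset ℤ), ((n - 1).sign - n.sign : ℂ) * phase n u τ = 0 := by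
      intro n hn
      simp only [Finset.mem_insert, Finset.mem_singleton, not_or] at hn
      rcases lt_or_ge n 0 with h | h
      · rw [Int.sign_eq_neg_one_of_neg h, Int.sign_eq_neg_one_of_neg (by omega)]
        simp
      · rw [Int.sign_eq_one_of_pos (show 0 < n by omega),
          Int.sign_eq_one_of_pos (show 0 < n - 1 by omega)]
        simp
    have h2 := hasSum_sum_of_ne_finset_zero (L := SummationFilter.unconditional ℤ) h1
    rw [Finset.sum_pair (by norm_num)] at h2
    have h3 : phase 1 u τ = -(expTwoPi (τ + 2 * u))⁻¹ := by
      rw [phase, ← expTwoPi_neg, show (((1 : ℤ) : ℂ) / 2 - ((1 : ℤ) : ℂ) ^ 2 * τ -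
        2 * ((1 : ℤ) : ℂ) * u) = 1 / 2 + -(τ + 2 * u) by push_cast; ring, expTwoPi_add,
        expTwoPi_half]
      ring
    have h4 : phase 0 u τ = 1 := by simp [phase, expTwoPi_zero]
    convert h2 using 1
    rw [h3, h4]
    norm_num
  have hs := (summable_signGap_mul_phase hτ u).hasSum
  have h := (hs.add hfin).mul_left (-expTwoPi (τ + 2 * u))
  have h' := (Equiv.addRight (1 : ℤ)).hasSum_iff.mpr h
  rw [completion, completion]
  have hterm : ∀ n : ℤ, (signGap n (u + τ) τ : ℂ) * phase n (u + τ) τ =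
      ((fun n : ℤ => -expTwoPi (τ + 2 * u) * ((signGap n u τ : ℂ) * phase n u τ +
        ((n - 1).sign - n.sign : ℂ) * phase n u τ)) ∘ Equiv.addRight (1 : ℤ)) n := by
    intro n
    simp only [Function.comp, Equiv.coe_addRight, add_sub_cancel_right]
    rw [signGap_add_tau hτ, phase_add_tau]
    push_cast
    ring
  rw [tsum_congr hterm, h'.tsum_eq]
  have := expTwoPi_ne_zero (τ + 2 * u)
  field_simp
  ring

/-! ### Uniqueness of quasi-periodic functions -/

/-- `u` does not lie in the lattice `ℤ τ + ℤ`. -/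
def OffLattice (u τ : ℂ) : Prop := ∀ m n : ℤ, u ≠ m * τ + n

lemma OffLattice.add {u τ : ℂ} (h : OffLattice u τ) (k l : ℤ) : OffLattice (u + k * τ + l) τ := by
  intro m n hmn
  apply h (m - k) (n - l)
  push_cast
  linear_combination hmn

lemma eventually_offLattice {τ : ℂ} (hτ : 0 < τ.im) : ∀ᶠ u in 𝓝[≠] (0 : ℂ), OffLattice u τ := by
  have h1 : ∀ᶠ u : ℂ in 𝓝 0, |u.im| < τ.im := by
    refine ContinuousAt.eventually_lt (by fun_prop) continuousAt_const ?_
    simpa using hτ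
  have h2 : ∀ᶠ u : ℂ in 𝓝 0, |u.re| < 1 := by
    refine ContinuousAt.eventually_lt (by fun_prop) continuousAt_const ?_
    simp
  filter_upwards [nhdsWithin_le_nhds h1, nhdsWithin_le_nhds h2, self_mem_nhdsWithin]
    with u hu1 hu2 hu0 m n hmn
  have him : u.im = m * τ.im := by
    rw [hmn, add_im, show (m : ℂ) = ((m : ℝ) : ℂ) by push_cast; rfl, im_ofReal_mul]
    simp
  have hm : m = 0 := by
    rw [him, abs_mul, abs_of_pos hτ, mul_lt_iff_lt_one_left hτ] at hu1
    have : |m| < 1 := by exact_mod_cast hu1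
    exact Int.abs_lt_one_iff.mp this
  have hn : n = 0 := by
    rw [hmn, hm] at hu2
    simp only [Int.cast_zero, zero_mul, zero_add, intCast_re] at hu2
    have : |n| < 1 := by exact_mod_cast hu2
    exact Int.abs_lt_one_iff.mp this
  apply hu0
  rw [hmn, hm, hn]
  simp

/-! ### An odd theta function and its quasi-periods -/

/-- An odd theta function vanishing on the lattice. -/
noncomputable def oddTheta (u τ : ℂ) : ℂ := jacobiTheta₂ (u + (1 / 2 + τ / 2)) τ

/-- The terms at n and -1-n are opposite. -/
lemma oddTheta_zero (τ : ℂ) : oddTheta 0 τ = 0 := by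
  have h : oddTheta 0 τ = -oddTheta 0 τ := by
    conv_lhs => rw [oddTheta, jacobiTheta₂]
    rw [← (Equiv.subLeft (-1 : ℤ)).tsum_eq, oddTheta, jacobiTheta₂, ← tsum_neg]
    refine tsum_congr fun n => ?_
    rw [Equiv.subLeft_apply, jacobiTheta₂_term, jacobiTheta₂_term]
    conv_rhs => rw [← neg_one_mul, ← Complex.exp_pi_mul_I, ← Complex.exp_add]
    rw [Complex.exp_eq_exp_iff_exists_int]
    refine ⟨-n - 1, ?_⟩
    push_cast
    ring
  exact self_eq_neg.mp h

lemma oddTheta_add_one (u τ : ℂ) : oddTheta (u + 1) τ = oddTheta u τ := by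
  rw [oddTheta, add_right_comm, jacobiTheta₂_add_left, oddTheta]

lemma oddTheta_add_tau (u τ : ℂ) :
    oddTheta (u + τ) τ = -(expTwoPi (u + τ))⁻¹ * oddTheta u τ := by
  rw [oddTheta, add_right_comm, jacobiTheta₂_add_left', oddTheta, ← expTwoPi_neg, expTwoPi,
    ← neg_one_mul (cexp _), ← Complex.exp_pi_mul_I, ← Complex.exp_add]
  congr 1
  rw [Complex.exp_eq_exp_iff_exists_int]
  exact ⟨-1, by push_cast; ring⟩

lemma differentiable_oddTheta {τ : ℂ} (hτ : 0 < τ.im) : Differentiable ℂ (oddTheta · τ) := by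
  intro u
  exact (differentiableAt_jacobiTheta₂_fst _ hτ).comp u
    (differentiableAt_id.add_const (1 / 2 + τ / 2))

/-- The zeroth Fourier coefficient; it shows that theta does not vanish identically. -/
lemma integral_jacobiTheta₂ {τ : ℂ} (hτ : 0 < τ.im) :
    ∫ x in (0 : ℝ)..1, jacobiTheta₂ x τ = 1 := by
  have hterm : ∀ n : ℤ, Continuous fun x : ℝ => jacobiTheta₂_term n x τ := by
    intro n
    unfold jacobiTheta₂_term
    fun_prop
  have hb : ∀ n : ℤ, ∀ x : ℝ, ‖jacobiTheta₂_term n x τ‖ = ‖jacobiTheta₂_term n 0 τ‖ := by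
    intro n x
    simp [norm_jacobiTheta₂_term]
  have hs : Summable fun n : ℤ => ‖jacobiTheta₂_term n 0 τ‖ :=
    ((summable_jacobiTheta₂_term_iff 0 τ).mpr hτ).norm
  have h := intervalIntegral.hasSum_integral_of_dominated_convergence (μ := volume) (a := 0) (b := 1)
    (F := fun (n : ℤ) (x : ℝ) => jacobiTheta₂_term n x τ) (f := fun x : ℝ => jacobiTheta₂ x τ)
    (fun n _ => ‖jacobiTheta₂_term n 0 τ‖) (fun n => (hterm n).aestronglyMeasurable)
    (fun n => Eventually.of_forall fun x _ => (hb n x).le)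
    (Eventually.of_forall fun x _ => hs) (by simp)
    (Eventually.of_forall fun x _ => hasSum_jacobiTheta₂_term x hτ)
  have hint : ∀ n : ℤ, n ≠ 0 → ∫ x in (0 : ℝ)..1, jacobiTheta₂_term n x τ = 0 := by
    intro n hn
    have hc : (2 * Real.pi * I * n : ℂ) ≠ 0 :=
      mul_ne_zero Complex.two_pi_I_ne_zero (by exact_mod_cast hn)
    have : ∀ x : ℝ, jacobiTheta₂_term n x τ = cexp (2 * Real.pi * I * n * x) *
        cexp (Real.pi * I * n ^ 2 * τ) := fun x => by rw [jacobiTheta₂_term, Complex.exp_add]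
    simp_rw [this]
    rw [intervalIntegral.integral_mul_const, integral_exp_mul_complex hc]
    have h1 : cexp (2 * Real.pi * I * n * (1 : ℝ)) = 1 := by
      rw [← Complex.exp_int_mul_two_pi_mul_I n]
      congr 1
      push_cast
      ring
    rw [h1]
    simp
  have h0 : ∫ x in (0 : ℝ)..1, jacobiTheta₂_term 0 x τ = 1 := by simp [jacobiTheta₂_term]
  rw [← h0]
  exact h.unique (hasSum_single 0 hint)

lemma exists_oddTheta_ne_zero {τ : ℂ} (hτ : 0 < τ.im) : ∃ u, oddTheta u τ ≠ 0 := by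
  by_contra! hc
  have h := integral_jacobiTheta₂ hτ
  have : ∀ x : ℂ, jacobiTheta₂ x τ = 0 := by
    intro x
    rw [← hc (x - (1 / 2 + τ / 2)), oddTheta, sub_add_cancel]
  simp [this] at h

/-- Two theta factors cancel the exponential multiplier of D up to a constant, and their double zero
absorbs the singularity at 0. The product is entire with bounded absolute value, hence constant by
Liouville, and its value at 0 is 0. -/
lemma eq_zero_of_quasiPeriodic {τ : ℂ} (hτ : 0 < τ.im) {D : ℂ → ℂ}
    (hD : ∀ u, OffLattice u τ → DifferentiableAt ℂ D u)
    (h1 : ∀ u, OffLattice u τ → D (u + 1) = D u)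
    (h2 : ∀ u, OffLattice u τ → D (u + τ) = -expTwoPi (τ + 2 * u) * D u)
    (h0 : Tendsto (fun u => oddTheta u τ ^ 2 * D u) (𝓝[≠] 0) (𝓝 0)) {u : ℂ}
    (hu : OffLattice u τ) : D u = 0 := by
  -- Under u ↦ u+τ the three factors give exp(-2πi(2u+2τ)), -exp(2πi(τ+2u)) and exp(2πiτ), with
  -- product -1.
  set F : ℂ → ℂ := fun u => oddTheta u τ ^ 2 * D u * expTwoPi u with hF
  have hP1 : ∀ u, oddTheta u τ = 0 ↔ oddTheta (u + 1) τ = 0 := fun u => by rw [oddTheta_add_one]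
  have hPint : ∀ (l : ℤ) u, oddTheta u τ = 0 → oddTheta (u + l) τ = 0 := by
    intro l
    induction l using Int.induction_on with
    | zero => simp
    | succ k ih =>
      intro u hu
      rw [Int.cast_add, Int.cast_one, ← add_assoc, ← hP1]
      exact ih u hu
    | pred k ih =>
      intro u hu
      rw [hP1, Int.cast_sub, Int.cast_one]
      convert ih u hu using 2
      ring
  have hP2 : ∀ u, oddTheta u τ = 0 ↔ oddTheta (u + τ) τ = 0 := fun u => by
    rw [oddTheta_add_tau]
    simp [expTwoPi_ne_zero]
  have hPtau : ∀ (k : ℤ) u, oddTheta u τ = 0 → oddTheta (u + k * τ) τ = 0 := by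
    intro l
    induction l using Int.induction_on with
    | zero => simp
    | succ k ih =>
      intro u hu
      have := (hP2 _).mp (ih u hu)
      convert this using 2
      push_cast
      ring
    | pred k ih =>
      intro u hu
      rw [hP2]
      convert ih u hu using 2
      push_cast
      ring
  have hlat : ∀ u, ¬ OffLattice u τ → oddTheta u τ = 0 := by
    intro u hu
    unfold OffLattice at hu
    push Not at hu
    obtain ⟨m, n, rfl⟩ := hu
    have := hPint n _ (hPtau m 0 (oddTheta_zero τ))
    rwa [zero_add] at this
  have hF1 : ∀ u, F (u + 1) = F u := by
    intro u
    by_cases hu : OffLattice u τ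
    · simp only [hF]
      rw [oddTheta_add_one, h1 u hu, expTwoPi_add, expTwoPi_one, mul_one]
    · simp only [hF]
      rw [oddTheta_add_one, hlat u hu]
      simp
  have hF2 : ∀ u, F (u + τ) = -F u := by
    intro u
    by_cases hu : OffLattice u τ
    · simp only [hF]
      rw [oddTheta_add_tau, h2 u hu, expTwoPi_add, expTwoPi_add τ, two_mul, expTwoPi_add u u]
      have := expTwoPi_ne_zero u
      have := expTwoPi_ne_zero τ
      field_simp
    · simp only [hF]
      rw [oddTheta_add_tau, hlat u hu]
      simp
  have hFn : ∀ (l : ℤ) u, F (u + l) = F u := fun l u => by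
    have hper : Function.Periodic F 1 := hF1
    simpa using hper.int_mul l u
  have hFm : ∀ (k : ℤ) u, F (u + k * τ) = (-1) ^ k * F u := fun k u => by
    induction k using Int.induction_on with
    | zero => simp
    | succ k ih =>
      have := hF2 (u + (k : ℤ) * τ)
      rw [ih, show u + (k : ℤ) * τ + τ = u + ((k : ℤ) + 1 : ℤ) * τ by push_cast; ring] at this
      rw [this, zpow_add_one₀ (by norm_num)]
      ring
    | pred k ih =>
      have := hF2 (u + (-(k : ℤ) - 1 : ℤ) * τ)
      rw [show u + (-(k : ℤ) - 1 : ℤ) * τ + τ = u + (-(k : ℤ) : ℤ) * τ by push_cast; ring, ih]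
        at this
      rw [zpow_sub_one₀ (by norm_num)]
      linear_combination this
  have hFt : ∀ (k l : ℤ) u, ‖F (u + k * τ + l)‖ = ‖F u‖ := fun k l u => by
    rw [hFn, hFm]
    simp
  have hF0 : F 0 = 0 := by simp [hF, oddTheta_zero]
  have hd_off : ∀ u, OffLattice u τ → DifferentiableAt ℂ F u := fun u hu =>
    (((differentiable_oddTheta hτ u).pow 2).mul (hD u hu)).mul (differentiable_expTwoPi u)
  have hd0 : DifferentiableAt ℂ F 0 := by
    -- Removable singularity: `h0` says that F is continuous at 0. The other lattice points follow
    -- by translation.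
    refine (Complex.analyticAt_of_differentiable_on_punctured_nhds_of_continuousAt ?_ ?_
      ).differentiableAt
    · filter_upwards [eventually_offLattice hτ] with u hu using hd_off u hu
    · rw [continuousAt_iff_punctured_nhds, hF0]
      have := h0.mul ((differentiable_expTwoPi 0).continuousAt.tendsto.mono_left nhdsWithin_le_nhds)
      simpa using this
  have hd : Differentiable ℂ F := by
    intro u
    by_cases hu : OffLattice u τ
    · exact hd_off u hu
    · unfold OffLattice at hu
      push Not at hu
      obtain ⟨m, n, rfl⟩ := hu
      have heq : F = fun v => (-1) ^ m * F (v - (m * τ + n)) := by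
        funext v
        have := hFn n (v - (m * τ + n) + m * τ)
        rw [hFm, show v - (m * τ + n) + m * τ + n = v by ring] at this
        exact this
      rw [heq]
      refine DifferentiableAt.const_mul ?_ _
      refine DifferentiableAt.comp (m * τ + n : ℂ) (g := F) ?_ (by fun_prop)
      rwa [sub_self]
  have hbdd : Bornology.IsBounded (range F) := by
    set K : Set ℂ := Metric.closedBall 0 (τ.im + 1) with hK
    have hcomp : IsCompact (F '' K) := (isCompact_closedBall _ _).image hd.continuous
    obtain ⟨C, hC⟩ := hcomp.isBounded.exists_norm_le
    refine isBounded_iff_forall_norm_le.mpr ⟨C, ?_⟩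
    rintro _ ⟨v, rfl⟩
    set k : ℤ := -⌊v.im / τ.im⌋ with hk
    set l : ℤ := -⌊(v + k * τ).re⌋ with hl
    rw [← hFt k l v]
    refine hC _ ⟨_, ?_, rfl⟩
    rw [hK, mem_closedBall_zero_iff]
    refine (Complex.norm_le_abs_re_add_abs_im _).trans ?_
    have hre : (v + k * τ + l).re = Int.fract (v + k * τ).re := by
      rw [add_re, ← Int.self_sub_floor, hl, intCast_re]
      push_cast
      ring
    have him : (v + k * τ + l).im = Int.fract (v.im / τ.im) * τ.im := by
      rw [add_im, add_im, show (k : ℂ) = ((k : ℝ) : ℂ) by push_cast; rfl, im_ofReal_mul,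
        ← Int.self_sub_floor, hk, sub_mul, div_mul_cancel₀ _ hτ.ne', intCast_im]
      push_cast
      ring
    rw [hre, him, abs_of_nonneg (Int.fract_nonneg _),
      abs_of_nonneg (mul_nonneg (Int.fract_nonneg _) hτ.le)]
    have := (Int.fract_lt_one (v + k * τ).re).le
    have := mul_le_mul_of_nonneg_right (Int.fract_lt_one (v.im / τ.im)).le hτ.le
    linarith
  have hzero : ∀ v, oddTheta v τ ^ 2 * D v = 0 := by
    intro v
    have := hd.apply_eq_apply_of_bounded hbdd v 0
    rw [hF0] at this
    exact (mul_eq_zero.mp this).resolve_right (expTwoPi_ne_zero v)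
  -- If D were nonzero at u, it would be nonzero nearby, so theta would vanish on an open set and
  -- hence identically.
  by_contra hne
  have hev : ∀ᶠ v in 𝓝 u, oddTheta v τ = 0 := by
    filter_upwards [(hD u hu).continuousAt.eventually_ne hne] with v hv
    exact pow_eq_zero_iff two_ne_zero |>.mp ((mul_eq_zero.mp (hzero v)).resolve_right hv)
  have han : AnalyticOnNhd ℂ (oddTheta · τ) univ :=
    fun v _ => (differentiable_oddTheta hτ).analyticAt v
  obtain ⟨w, hw⟩ := exists_oddTheta_ne_zero hτ
  exact hw (han.eqOn_zero_of_preconnected_of_eventuallyEq_zero isPreconnected_univ (mem_univ u) hev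
    (mem_univ w))

/-! ### The holomorphic part as a function of the elliptic variable -/

/-- The normalised rank function `(1 + z) / (1 - z) 𝒪(z; τ)` with `z = exp(2 π i u)`. -/
noncomputable def normRank (u τ : ℂ) : ℂ :=
  (1 + expTwoPi u) / (1 - expTwoPi u) * rankSeries (expTwoPi u) (expTwoPi τ)

lemma OffLattice.mul_pow_ne_one {u τ : ℂ} (h : OffLattice u τ) (j : ℕ) :
    expTwoPi u * expTwoPi τ ^ j ≠ 1 ∧ (expTwoPi u)⁻¹ * expTwoPi τ ^ j ≠ 1 := by
  rw [← expTwoPi_nat_mul, ← expTwoPi_neg, ← expTwoPi_add, ← expTwoPi_add]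
  constructor
  · rw [Ne, expTwoPi_eq_one_iff]
    rintro ⟨n, hn⟩
    apply h (-j) n
    push_cast
    linear_combination hn
  · rw [Ne, expTwoPi_eq_one_iff]
    rintro ⟨n, hn⟩
    apply h j (-n)
    push_cast
    linear_combination -hn

lemma normRank_add_one (u τ : ℂ) : normRank (u + 1) τ = normRank u τ := by
  rw [normRank, expTwoPi_add, expTwoPi_one, mul_one, normRank]

lemma normRank_add_tau {u τ : ℂ} (hτ : 0 < τ.im) (h : OffLattice u τ) :
    normRank (u + τ) τ = -expTwoPi (τ + 2 * u) * normRank u τ + (1 - expTwoPi (τ + 2 * u)) := by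
  have := rankSeries_mul_q (expTwoPi_ne_zero τ) (norm_expTwoPi_lt_one hτ) (expTwoPi_ne_zero u)
    (fun j => (h.mul_pow_ne_one j).1) (fun j => (h.mul_pow_ne_one j).2)
  have e : expTwoPi (τ + 2 * u) = expTwoPi τ * expTwoPi u ^ 2 := by
    rw [expTwoPi_add, two_mul, expTwoPi_add, sq]
  rw [e, normRank, normRank, expTwoPi_add]
  linear_combination this

lemma differentiableAt_rankSeries {u τ : ℂ} (hτ : 0 < τ.im)
    (h : ∀ j : ℕ, expTwoPi u * expTwoPi τ ^ (j + 1) ≠ 1)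
    (h' : ∀ j : ℕ, (expTwoPi u)⁻¹ * expTwoPi τ ^ (j + 1) ≠ 1) :
    DifferentiableAt ℂ (fun u => rankSeries (expTwoPi u) (expTwoPi τ)) u := by
  have hq := norm_expTwoPi_lt_one hτ
  obtain ⟨δ, hδ, hev⟩ := exists_poleGap hq (expTwoPi_ne_zero u) h h'
  have hev' := (differentiable_expTwoPi u).continuousAt.eventually hev
  obtain ⟨s, hs, hso, hus⟩ := eventually_nhds_iff.mp hev'
  exact (differentiableOn_rankSeries (f := expTwoPi) (g := fun _ => expTwoPi τ) hso
    differentiable_expTwoPi.differentiableOn (differentiableOn_const _)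
    (fun w _ => expTwoPi_ne_zero w) hδ (norm_nonneg _) hq (fun w _ => le_rfl) hs).differentiableAt
    (hso.mem_nhds hus)

lemma differentiableAt_normRank {u τ : ℂ} (hτ : 0 < τ.im) (h : OffLattice u τ) :
    DifferentiableAt ℂ (fun u => normRank u τ) u := by
  have h1 : 1 - expTwoPi u ≠ 0 := by
    have := (h.mul_pow_ne_one 0).1
    rw [pow_zero, mul_one] at this
    exact sub_ne_zero.mpr this.symm
  have he := differentiable_expTwoPi u
  exact ((he.const_add 1).div (he.const_sub 1) h1).mul
    (differentiableAt_rankSeries hτ (fun j => (h.mul_pow_ne_one _).1)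
      (fun j => (h.mul_pow_ne_one _).2))

lemma hasDerivAt_expTwoPi_zero : HasDerivAt expTwoPi (2 * Real.pi * I) 0 := by
  have := ((hasDerivAt_id (0 : ℂ)).const_mul (2 * Real.pi * I)).cexp
  exact this.congr_deriv (by simp)

/-- The rank series is regular at z = 1, so the only singularity is the simple pole of 1/(1-z), and
P² vanishes to second order. The scaling c accommodates the argument u/(γτ+δ). -/
lemma tendsto_sq_mul_normRank {τ c : ℂ} (hτ : 0 < τ.im) (hc : c ≠ 0) {P : ℂ → ℂ}
    (hP : DifferentiableAt ℂ P 0) (hP0 : P 0 = 0) :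
    Tendsto (fun u => P u ^ 2 * normRank (c * u) τ) (𝓝[≠] 0) (𝓝 0) := by
  have hq := norm_expTwoPi_lt_one hτ
  have hpow : ∀ j : ℕ, expTwoPi τ ^ (j + 1) ≠ 1 := fun j hj => by
    have h1 : ‖expTwoPi τ‖ ^ (j + 1) < 1 := pow_lt_one₀ (norm_nonneg _) hq (by omega)
    rw [← norm_pow, hj, norm_one] at h1
    exact lt_irrefl _ h1
  have hser : DifferentiableAt ℂ (fun u => rankSeries (expTwoPi u) (expTwoPi τ)) (c * 0) := by
    rw [mul_zero]
    refine differentiableAt_rankSeries hτ ?_ ?_ <;> intro j <;> simpa [expTwoPi_zero] using hpow j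
  have hcont : Tendsto (fun u : ℂ => (1 + expTwoPi (c * u)) *
      rankSeries (expTwoPi (c * u)) (expTwoPi τ)) (𝓝[≠] 0) (𝓝 (2 * rankSeries 1 (expTwoPi τ))) := by
    have h1 : ContinuousAt (fun u : ℂ => (1 + expTwoPi (c * u)) *
        rankSeries (expTwoPi (c * u)) (expTwoPi τ)) 0 := by
      refine ContinuousAt.mul ?_ ?_
      · exact ((differentiable_expTwoPi.continuous.comp (continuous_const_mul c)).const_add
          1).continuousAt
      · exact ContinuousAt.comp (g := fun u => rankSeries (expTwoPi u) (expTwoPi τ))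
          hser.continuousAt (by fun_prop)
    have := h1.tendsto.mono_left (nhdsWithin_le_nhds (s := {0}ᶜ))
    simpa [expTwoPi_zero, show (1 : ℂ) + 1 = 2 by norm_num] using this
  have hslopeP := hasDerivAt_iff_tendsto_slope_zero.mp hP.hasDerivAt
  have he : HasDerivAt (fun u => expTwoPi (c * u)) (2 * Real.pi * I * c) 0 := by
    have h := hasDerivAt_expTwoPi_zero
    rw [← mul_zero c] at h
    exact (h.comp 0 ((hasDerivAt_id (0 : ℂ)).const_mul c)).congr_deriv (by simp)
  have hslopeE := hasDerivAt_iff_tendsto_slope_zero.mp he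
  have hne : (2 * Real.pi * I * c : ℂ) ≠ 0 := mul_ne_zero Complex.two_pi_I_ne_zero hc
  have hPc : Tendsto P (𝓝[≠] 0) (𝓝 0) := by
    have := hP.continuousAt.tendsto.mono_left (nhdsWithin_le_nhds (s := {0}ᶜ))
    rwa [hP0] at this
  have := ((hPc.mul hslopeP).mul (hslopeE.inv₀ hne)).mul hcont
  rw [zero_mul, zero_mul, zero_mul] at this
  have h2 := this.neg
  rw [neg_zero] at h2
  refine h2.congr' ?_
  filter_upwards [self_mem_nhdsWithin] with u hu
  have hu' : u ≠ 0 := hu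
  simp only [zero_add, hP0, sub_zero, mul_zero, expTwoPi_zero, smul_eq_mul, normRank]
  rw [← neg_sub (expTwoPi (c * u)) 1, mul_inv, inv_inv]
  by_cases h0 : expTwoPi (c * u) - 1 = 0
  · rw [h0]
    simp
  · field_simp

/-! ### The completed rank function and its modular transformation -/

/-- The completion of `normRank`. -/
noncomputable def rankHat (u τ : ℂ) : ℂ := normRank u τ + completion u τ

lemma rankHat_add_one (u τ : ℂ) : rankHat (u + 1) τ = rankHat u τ := by
  rw [rankHat, normRank_add_one, completion_add_one, rankHat]

lemma rankHat_add_int (n : ℤ) (u τ : ℂ) : rankHat (u + n) τ = rankHat u τ := by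
  have : Function.Periodic (fun u => rankHat u τ) 1 := fun u => rankHat_add_one u τ
  simpa using this.int_mul n u

/-- The inhomogeneous terms of the two summands are opposite. -/
lemma rankHat_add_tau {u τ : ℂ} (hτ : 0 < τ.im) (h : OffLattice u τ) :
    rankHat (u + τ) τ = -expTwoPi (τ + 2 * u) * rankHat u τ := by
  rw [rankHat, normRank_add_tau hτ h, completion_add_tau hτ, rankHat]
  ring

lemma rankHat_add_int_mul {τ : ℂ} (hτ : 0 < τ.im) (m : ℤ) {u : ℂ} (h : OffLattice u τ) :
    rankHat (u + m * τ) τ = (-1) ^ m * expTwoPi (m ^ 2 * τ + 2 * m * u) * rankHat u τ := by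
  have hoff : ∀ k : ℤ, OffLattice (u + k * τ) τ := fun k => by simpa using h.add k 0
  induction m using Int.induction_on with
  | zero => simp [expTwoPi_zero]
  | succ k ih =>
    have := rankHat_add_tau hτ (hoff k)
    rw [ih, show u + (k : ℤ) * τ + τ = u + ((k : ℤ) + 1 : ℤ) * τ by push_cast; ring] at this
    rw [this, zpow_add_one₀ (by norm_num), show ((((k : ℤ) + 1 : ℤ) : ℂ) ^ 2 * τ +
      2 * (((k : ℤ) + 1 : ℤ) : ℂ) * u) = (τ + 2 * (u + (k : ℤ) * τ)) +
        (((k : ℤ) : ℂ) ^ 2 * τ + 2 * ((k : ℤ) : ℂ) * u) by push_cast; ring,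
      expTwoPi_add (τ + 2 * (u + (k : ℤ) * τ))]
    ring
  | pred k ih =>
    have := rankHat_add_tau hτ (hoff (-(k : ℤ) - 1))
    rw [show u + (-(k : ℤ) - 1 : ℤ) * τ + τ = u + (-(k : ℤ) : ℤ) * τ by push_cast; ring, ih,
      show (((-(k : ℤ) : ℤ) : ℂ) ^ 2 * τ + 2 * ((-(k : ℤ) : ℤ) : ℂ) * u) =
        (τ + 2 * (u + (-(k : ℤ) - 1 : ℤ) * τ)) + (((-(k : ℤ) - 1 : ℤ) : ℂ) ^ 2 * τ +
          2 * ((-(k : ℤ) - 1 : ℤ) : ℂ) * u) by push_cast; ring, expTwoPi_add] at this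
    rw [zpow_sub_one₀ (by norm_num)]
    have h2 := expTwoPi_ne_zero (τ + 2 * (u + (-(k : ℤ) - 1 : ℤ) * τ))
    apply mul_left_cancel₀ h2
    linear_combination this

/-! ### Calculus of the operator ∂/∂x + i∂/∂y -/

lemma HasDbarAt.sub {f g : ℂ → ℂ} {d e u : ℂ} (hf : HasDbarAt f d u) (hg : HasDbarAt g e u) :
    HasDbarAt (fun u => f u - g u) (d - e) u := by
  obtain ⟨L, hL, hd⟩ := hf
  obtain ⟨M, hM, he⟩ := hg
  refine ⟨L - M, hL.sub hM, ?_⟩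
  rw [← hd, ← he]
  simp only [sub_apply]
  ring

lemma HasDbarAt.holomorphic_mul {f g : ℂ → ℂ} {d u : ℂ} (hg : DifferentiableAt ℂ g u)
    (hf : HasDbarAt f d u) : HasDbarAt (fun u => g u * f u) (g u * d) u := by
  obtain ⟨L, hL, hd⟩ := hf
  refine ⟨_, (hg.hasDerivAt.hasFDerivAt.restrictScalars ℝ).mul hL, ?_⟩
  rw [← hd]
  simp
  linear_combination (f u * deriv g u) * I_sq

lemma HasDbarAt.comp_mul {f : ℂ → ℂ} {c d u : ℂ} (hf : HasDbarAt f d (c * u)) :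
    HasDbarAt (fun u => f (c * u)) (conj c * d) u := by
  obtain ⟨L, hL, hd⟩ := hf
  have hc : HasFDerivAt (fun u : ℂ => c * u) (c • ContinuousLinearMap.id ℝ ℂ) u :=
    (ContinuousLinearMap.id ℝ ℂ).hasFDerivAt.const_mul c
  refine ⟨_, hL.comp u hc, ?_⟩
  have key : ∀ w : ℂ, L w = w.re * L 1 + w.im * L I := by
    intro w
    conv_lhs => rw [← Complex.re_add_im w]
    rw [map_add, show (w.re : ℂ) = w.re • (1 : ℂ) by simp, show (w.im : ℂ) * I = w.im • I by simp,
      map_smul, map_smul]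
    simp
  rw [← hd]
  simp only [ContinuousLinearMap.comp_apply, smul_apply,
    ContinuousLinearMap.id_apply, smul_eq_mul, mul_one]
  rw [key c, key (c * I)]
  have hcc : conj c = c.re - c.im * I := by
    apply Complex.ext <;> simp
  rw [hcc]
  simp
  linear_combination (c.im * L I) * I_sq

lemma HasDbarAt.differentiableAt {f : ℂ → ℂ} {u : ℂ} (hf : HasDbarAt f 0 u) :
    DifferentiableAt ℂ f u := by
  obtain ⟨L, hL, hd⟩ := hf
  rw [differentiableAt_complex_iff_differentiableAt_real]
  refine ⟨hL.differentiableAt, ?_⟩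
  rw [hL.fderiv, smul_eq_mul]
  linear_combination (-I) * hd + L I * I_sq

lemma HasDbarAt.continuousAt {f : ℂ → ℂ} {d u : ℂ} (hf : HasDbarAt f d u) : ContinuousAt f u := by
  obtain ⟨L, hL, -⟩ := hf
  exact hL.continuousAt

lemma jacobiTheta₂_add_int_mul (z τ : ℂ) (k l : ℤ) :
    jacobiTheta₂ (z + k * τ + l) τ = expTwoPi (-(k ^ 2 * τ) / 2 - k * z) * jacobiTheta₂ z τ := by
  rw [jacobiTheta₂, jacobiTheta₂, ← tsum_mul_left, ← (Equiv.addRight k).tsum_eq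
    (fun n => expTwoPi (-(k ^ 2 * τ) / 2 - k * z) * jacobiTheta₂_term n z τ)]
  refine tsum_congr fun n => ?_
  rw [Equiv.coe_addRight, jacobiTheta₂_term, jacobiTheta₂_term, expTwoPi, ← Complex.exp_add,
    Complex.exp_eq_exp_iff_exists_int]
  refine ⟨n * l, ?_⟩
  push_cast
  ring

/-- The characteristic 1/2 must be preserved: with w = γτ+δ, the congruences make w/2 differ from
1/2 by an element of the lattice of 2τ, and the resulting phase is trivial. The condition δ ≡ 1 mod
4 removes ε(δ). -/
lemma rankTheta_smul {A : SL(2, ℤ)} (hγ : A 1 0 % 16 = 0) (hδ : A 1 1 % 4 = 1) (τ : ℍ) (u : ℂ) :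
    rankTheta (u / autFactor A τ) (A • τ : ℍ) = extJacobi (A 1 0) (A 1 1) *
      csqrt (autFactor A τ) * expTwoPi ((A 1 0 : ℤ) * u ^ 2 / autFactor A τ) * rankTheta u τ := by
  have hω := autFactor_ne_zero A τ
  obtain ⟨g, hg⟩ := Int.dvd_of_emod_eq_zero hγ
  obtain ⟨l, hl⟩ : ∃ l : ℤ, A 1 1 = 2 * l + 1 := ⟨A 1 1 / 2, by omega⟩
  have hω' : autFactor A τ = 16 * g * τ + (2 * l + 1) := by
    rw [autFactor, hg, hl]
    push_cast
    ring
  have h := thetaTransforms (show A 1 0 % 4 = 0 by omega) τ (autFactor A τ / 2 + 2 * u)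
  have e1 : (autFactor A τ / 2 + 2 * u) / autFactor A τ = 1 / 2 + 2 * (u / autFactor A τ) := by
    field_simp
  have e2 : autFactor A τ / 2 + 2 * u = (1 / 2 + 2 * u) + ((4 * g : ℤ) : ℂ) * (2 * τ) + l := by
    rw [hω']
    push_cast
    ring
  have hm : thetaMultiplier (A 1 0) (A 1 1) = extJacobi (A 1 0) (A 1 1) := by
    rw [thetaMultiplier, epsilonFactor, if_pos hδ, inv_one, mul_one]
  rw [e1, hm] at h
  rw [rankTheta, h]
  conv_lhs => enter [2]; rw [e2, jacobiTheta₂_add_int_mul]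
  rw [← rankTheta, ← mul_assoc, mul_assoc _ (expTwoPi _) (expTwoPi _), ← expTwoPi_add]
  congr 2
  have e3 : (A 1 0 : ℂ) * (autFactor A τ / 2 + 2 * u) ^ 2 / (4 * autFactor A τ) +
      (-(((4 * g : ℤ) : ℂ) ^ 2 * (2 * τ)) / 2 - ((4 * g : ℤ) : ℂ) * (1 / 2 + 2 * u)) =
      (A 1 0 : ℂ) * u ^ 2 / autFactor A τ + ((g * (2 * l - 1) : ℤ) : ℂ) := by
    rw [hg]
    push_cast
    field_simp
    rw [hω']
    ring
  rw [e3, expTwoPi_add, expTwoPi_intCast, mul_one]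

/-- Division by the automorphy factor maps the complement of the lattice of `τ` to that of the
lattice of `A τ`. -/
lemma OffLattice.div_autFactor {u : ℂ} {τ : ℍ} (h : OffLattice u τ) (A : SL(2, ℤ)) :
    OffLattice (u / autFactor A τ) (A • τ : ℍ) := by
  have hω := autFactor_ne_zero A τ
  intro m n hmn
  rw [coe_smul_eq, div_eq_iff hω, add_mul, mul_assoc, div_mul_cancel₀ _ hω] at hmn
  apply h (m * A 0 0 + n * A 1 0) (m * A 0 1 + n * A 1 1)
  rw [hmn, autFactor]
  push_cast
  ring

/-- Hence the real factor exp(-4π(Im u)²/y) changes under A by the squared absolute value of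
exp(2πiγu²/(γτ+δ)). -/
lemma sq_im_autFactor (A : SL(2, ℤ)) (τ : ℍ) (u : ℂ) :
    (u / autFactor A τ).im ^ 2 / (A • τ : ℍ).im + ((A 1 0 : ℤ) * u ^ 2 / autFactor A τ).im =
      u.im ^ 2 / τ.im := by
  have hω := autFactor_ne_zero A τ
  obtain ⟨s, hs⟩ : ∃ s, s = u / autFactor A τ := ⟨_, rfl⟩
  have hu : u = s * autFactor A τ := by rw [hs]; field_simp
  have e : (A 1 0 : ℂ) * u ^ 2 / autFactor A τ = ((A 1 0 : ℝ) : ℂ) * (s ^ 2 * autFactor A τ) := by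
    rw [hu]
    push_cast
    field_simp
  have hy := τ.im_pos.ne'
  have hn : ‖autFactor A τ‖ ^ 2 = (autFactor A τ).re ^ 2 + (A 1 0 * τ.im) ^ 2 := by
    rw [← Complex.normSq_eq_norm_sq, Complex.normSq_apply, autFactor_im]
    ring
  rw [e, im_ofReal_mul, im_smul_eq, ← hs, hn, hu, mul_im s, sq s, mul_im (s * s), mul_im s s,
    mul_re s s, autFactor_im]
  field_simp
  ring

/-- The difference of the two sides of the transformation formula is holomorphic. -/
lemma hasDbarAt_completion_smul {A : SL(2, ℤ)} (hγ : A 1 0 % 16 = 0) (hδ : A 1 1 % 4 = 1) (τ : ℍ)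
    (u : ℂ) :
    HasDbarAt (fun u => expTwoPi ((A 1 0 : ℤ) * u ^ 2 / autFactor A τ) *
        completion ((autFactor A τ)⁻¹ * u) (A • τ : ℍ) -
      extJacobi (A 1 0) (A 1 1) * csqrt (autFactor A τ) * completion u τ) 0 u := by
  have hω := autFactor_ne_zero A τ
  have hg : DifferentiableAt ℂ (fun u => expTwoPi ((A 1 0 : ℤ) * u ^ 2 / autFactor A τ)) u := by
    unfold expTwoPi
    fun_prop
  have h1 := (HasDbarAt.comp_mul (c := (autFactor A τ)⁻¹) (u := u)
    (hasDbarAt_completion (A • τ).im_pos _)).holomorphic_mul hg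
  have h2 := (hasDbarAt_completion τ.im_pos u).holomorphic_mul
    (differentiableAt_const ((extJacobi (A 1 0) (A 1 1) : ℂ) * csqrt (autFactor A τ)))
  convert h1.sub h2 using 1
  have hth := rankTheta_smul hγ hδ τ u
  have him := sq_im_autFactor A τ u
  rw [inv_mul_eq_div, hth]
  set s := csqrt (autFactor A τ) with hs
  have hs2 : s ^ 2 = autFactor A τ := csqrt_sq _
  have hs0 : s ≠ 0 := csqrt_ne_zero hω
  have hcs0 : conj s ≠ 0 := by simpa using hs0
  -- The chain rule contributes conj(s)⁻², the factor 1/√Im contributes s·conj(s), and the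
  -- conjugated theta function contributes conj(s). What remains is s, the holomorphic factor of
  -- weight 1/2.
  have hnorm : (‖autFactor A τ‖ : ℂ) = s * conj s := by
    rw [← hs2, norm_pow, Complex.mul_conj, Complex.normSq_eq_norm_sq]
  have hy : (√(A • τ : ℍ).im : ℂ) = √τ.im / (s * conj s) := by
    rw [← hnorm, im_smul_eq, Real.sqrt_div τ.im_pos.le, Real.sqrt_sq (norm_nonneg _)]
    push_cast
    rfl
  have hy0 : (√τ.im : ℂ) ≠ 0 := by exact_mod_cast (Real.sqrt_pos.mpr τ.im_pos).ne'
  set e := expTwoPi ((A 1 0 : ℤ) * u ^ 2 / autFactor A τ) with he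
  have hee : e * conj e = Real.exp (-4 * Real.pi * ((A 1 0 : ℤ) * u ^ 2 / autFactor A τ).im) := by
    rw [Complex.mul_conj, Complex.normSq_eq_norm_sq, he, norm_expTwoPi, ← Real.exp_nat_mul]
    congr 2
    push_cast
    ring
  have hexp : (Real.exp (-4 * Real.pi * u.im ^ 2 / τ.im) : ℂ) = Real.exp (-4 * Real.pi *
      (u / autFactor A τ).im ^ 2 / (A • τ : ℍ).im) * (e * conj e) := by
    rw [hee, ← Complex.ofReal_mul, ← Real.exp_add, mul_div_assoc, ← him]
    congr 2
    ring
  simp only [map_mul, map_inv₀, map_intCast, UpperHalfPlane.coe_im]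
  rw [hexp, hy, ← hs2, map_pow]
  field_simp
  ring

/-- The modular transformation of the completed rank function. -/
theorem rankHat_smul {A : SL(2, ℤ)} (hγ : A 1 0 % 16 = 0) (hδ : A 1 1 % 4 = 1) (τ : ℍ) {u : ℂ}
    (hu : OffLattice u τ) :
    expTwoPi ((A 1 0 : ℤ) * u ^ 2 / autFactor A τ) * rankHat (u / autFactor A τ) (A • τ : ℍ) =
      extJacobi (A 1 0) (A 1 1) * csqrt (autFactor A τ) * rankHat u τ := by
  have hω := autFactor_ne_zero A τ
  have hτ := τ.im_pos
  have hτ' := (A • τ).im_pos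
  set w := autFactor A τ with hω_def
  set κ : ℂ := extJacobi (A 1 0) (A 1 1) * csqrt w with hκ
  have hωeq : w = (A 1 0 : ℤ) * τ + (A 1 1 : ℤ) := rfl
  have hτeq : ((A • τ : ℍ) : ℂ) * w = (A 0 0 : ℤ) * τ + (A 0 1 : ℤ) := by
    rw [coe_smul_eq, div_mul_cancel₀ _ hω]
  have hdet : ((A 0 0 : ℤ) : ℂ) * (A 1 1 : ℤ) - (A 0 1 : ℤ) * (A 1 0 : ℤ) = 1 := by
    exact_mod_cast det_eq A
  -- Division by w sends the periods 1 and τ to lattice vectors of Aτ, so the left side is also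
  -- quasi-periodic for the lattice of τ.
  have hone : 1 / w = -(A 1 0 : ℤ) * (A • τ : ℍ) + (A 0 0 : ℤ) := by
    field_simp
    linear_combination (A 1 0 : ℂ) * hτeq - (A 0 0 : ℂ) * hωeq - hdet
  have htau : τ / w = (A 1 1 : ℤ) * (A • τ : ℍ) - (A 0 1 : ℤ) := by
    field_simp
    linear_combination (-(A 1 1 : ℂ)) * hτeq + (A 0 1 : ℂ) * hωeq - τ * hdet
  set E : ℂ → ℂ := fun u => expTwoPi ((A 1 0 : ℤ) * u ^ 2 / w) with hE
  have hEd : ∀ u, DifferentiableAt ℂ E u := by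
    intro u
    simp only [hE]
    unfold expTwoPi
    fun_prop
  -- γ even and δ odd give the signs +1 and -1, those of `rankHat` itself under 1 and τ.
  have heven : (-1 : ℂ) ^ (-(A 1 0)) = 1 := Even.neg_one_zpow (by
    rw [even_neg, Int.even_iff]; omega)
  have hodd : (-1 : ℂ) ^ (A 1 1) = -1 := Odd.neg_one_zpow (Int.odd_iff.mpr (by omega))
  have key : ∀ u, OffLattice u τ → E u * rankHat (u / w) (A • τ : ℍ) - κ * rankHat u τ = 0 := by
    intro u hu
    refine eq_zero_of_quasiPeriodic
      (D := fun u => E u * rankHat (u / w) (A • τ : ℍ) - κ * rankHat u τ) hτ ?_ ?_ ?_ ?_ hu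
    · intro u hu
      -- The rank parts are holomorphic off the lattice; the completions are so only in this
      -- combination.
      have h1 : DifferentiableAt ℂ (fun u => normRank (u / w) (A • τ : ℍ)) u :=
        DifferentiableAt.comp (g := fun u => normRank u (A • τ : ℍ)) u
          (differentiableAt_normRank hτ' (hu.div_autFactor A)) (by fun_prop)
      have h2 := (hasDbarAt_completion_smul hγ hδ τ u).differentiableAt
      have h3 := (((hEd u).mul h1).sub ((differentiableAt_normRank hτ hu).const_mul κ)).add h2
      refine h3.congr_of_eventuallyEq (Eventually.of_forall fun v => ?_)
      simp only [rankHat, hE, hκ, Pi.add_apply, Pi.sub_apply, Pi.mul_apply, inv_mul_eq_div]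
      ring
    · intro u hu
      have h := rankHat_add_int_mul hτ' (-(A 1 0)) (hu.div_autFactor A)
      rw [heven, one_mul] at h
      have e1 : (u + 1) / w = u / w + (-(A 1 0) : ℤ) * (A • τ : ℍ) + (A 0 0 : ℤ) := by
        rw [add_div, hone]
        push_cast
        ring
      have e2 : E (u + 1) * expTwoPi ((-(A 1 0) : ℤ) ^ 2 * (A • τ : ℍ) +
          2 * (-(A 1 0) : ℤ) * (u / w)) = E u := by
        simp only [hE]
        rw [← expTwoPi_add]
        have : (A 1 0 : ℂ) * (u + 1) ^ 2 / w + ((-(A 1 0) : ℤ) ^ 2 * (A • τ : ℍ) +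
            2 * (-(A 1 0) : ℤ) * (u / w)) = (A 1 0 : ℂ) * u ^ 2 / w +
              ((A 1 0 * A 0 0 : ℤ) : ℂ) := by
          push_cast
          linear_combination (A 1 0 : ℂ) * hone
        rw [this, expTwoPi_add, expTwoPi_intCast, mul_one]
      rw [e1, rankHat_add_int, h, rankHat_add_one, ← mul_assoc, e2]
    · intro u hu
      have h := rankHat_add_int_mul hτ' (A 1 1) (hu.div_autFactor A)
      rw [hodd] at h
      have e1 : (u + τ) / w = u / w + (A 1 1 : ℤ) * (A • τ : ℍ) + (-(A 0 1) : ℤ) := by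
        rw [add_div, htau]
        push_cast
        ring
      have e2 : E (u + τ) * expTwoPi ((A 1 1 : ℤ) ^ 2 * (A • τ : ℍ) +
          2 * (A 1 1 : ℤ) * (u / w)) = expTwoPi (τ + 2 * u) * E u := by
        simp only [hE]
        rw [← expTwoPi_add, ← expTwoPi_add]
        have : (A 1 0 : ℂ) * (u + τ) ^ 2 / w + ((A 1 1 : ℤ) ^ 2 * (A • τ : ℍ) +
            2 * (A 1 1 : ℤ) * (u / w)) = (τ + 2 * u + (A 1 0 : ℂ) * u ^ 2 / w) +
              ((A 0 1 * A 1 1 : ℤ) : ℂ) := by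
          have hw : (2 * u + τ) * ((A 1 0 : ℤ) * τ + (A 1 1 : ℤ)) / w = 2 * u + τ := by
            rw [← hωeq]
            field_simp
          push_cast
          linear_combination hw - (A 1 1 : ℂ) * htau
        rw [this, expTwoPi_add, expTwoPi_intCast, mul_one]
      rw [e1, rankHat_add_int, h, rankHat_add_tau hτ hu]
      linear_combination (-rankHat (u / w) (A • τ : ℍ)) * e2
    · have hP := differentiable_oddTheta hτ 0
      have t1 := tendsto_sq_mul_normRank hτ' (inv_ne_zero hω) hP (oddTheta_zero τ)
      have t2 := tendsto_sq_mul_normRank hτ one_ne_zero hP (oddTheta_zero τ)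
      have tE : Tendsto E (𝓝[≠] 0) (𝓝 (E 0)) :=
        (hEd 0).continuousAt.tendsto.mono_left nhdsWithin_le_nhds
      have tR := (hasDbarAt_completion_smul hγ hδ τ 0).continuousAt.tendsto.mono_left
        (nhdsWithin_le_nhds (s := {0}ᶜ))
      have tP : Tendsto (oddTheta · (τ : ℂ)) (𝓝[≠] 0) (𝓝 0) := by
        have := hP.continuousAt.tendsto.mono_left (nhdsWithin_le_nhds (s := {0}ᶜ))
        rwa [oddTheta_zero] at this
      have := ((tE.mul t1).sub (t2.const_mul κ)).add ((tP.pow 2).mul tR)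
      simp only [mul_zero, sub_zero, zero_pow two_ne_zero, zero_mul, add_zero] at this
      refine this.congr fun v => ?_
      simp only [rankHat, hE, hκ, inv_mul_eq_div, one_mul]
      ring
  exact sub_eq_zero.mp (key u hu)

/-! ### The integral representation of the completion -/

/-- For m > 0 the integrand is the derivative of t ↦ gaussE(√2 k m √(s+t))/(√2 k); negative m
follows by oddness. -/
lemma gaussian_tail_integral (m : ℤ) {k s : ℝ} (hk : 0 < k) (hs : 0 < s) :
    IntegrableOn (fun t : ℝ => (m : ℝ) * Real.exp (-2 * Real.pi * m ^ 2 * k ^ 2 * (s + t)) /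
      √(s + t)) (Ioi 0) ∧
    ∫ t in Ioi (0 : ℝ), (m : ℝ) * Real.exp (-2 * Real.pi * m ^ 2 * k ^ 2 * (s + t)) / √(s + t) =
      (m.sign - gaussE (√2 * k * √s * m)) / (√2 * k) := by
  have hpos : ∀ m : ℤ, 0 < m →
      IntegrableOn (fun t : ℝ => (m : ℝ) * Real.exp (-2 * Real.pi * m ^ 2 * k ^ 2 * (s + t)) /
        √(s + t)) (Ioi 0) ∧
      ∫ t in Ioi (0 : ℝ), (m : ℝ) * Real.exp (-2 * Real.pi * m ^ 2 * k ^ 2 * (s + t)) / √(s + t) =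
        (m.sign - gaussE (√2 * k * √s * m)) / (√2 * k) := by
    intro m hm
    have hm' : (0 : ℝ) < m := by exact_mod_cast hm
    have hder : ∀ t ∈ Ici (0 : ℝ), HasDerivAt
        (fun t : ℝ => gaussE (√2 * k * m * √(s + t)) / (√2 * k))
        ((m : ℝ) * Real.exp (-2 * Real.pi * m ^ 2 * k ^ 2 * (s + t)) / √(s + t)) t := by
      intro t ht
      have hst : 0 < s + t := add_pos_of_pos_of_nonneg hs ht
      have h1 : HasDerivAt (fun t : ℝ => √(s + t)) (1 / (2 * √(s + t))) t := by
        simpa using ((hasDerivAt_id t).const_add s).sqrt hst.ne'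
      have h2 := ((hasDerivAt_gaussE _).comp t (h1.const_mul (√2 * k * m))).div_const (√2 * k)
      refine h2.congr_deriv ?_
      have h3 : -Real.pi * (√2 * k * m * √(s + t)) ^ 2 =
          -2 * Real.pi * m ^ 2 * k ^ 2 * (s + t) := by
        rw [mul_pow, mul_pow, mul_pow, Real.sq_sqrt zero_le_two, Real.sq_sqrt hst.le]
        ring
      rw [h3]
      have : √2 ≠ 0 := by positivity
      have : √(s + t) ≠ 0 := (Real.sqrt_pos.mpr hst).ne'
      field_simp
    have hlim : Tendsto (fun t : ℝ => gaussE (√2 * k * m * √(s + t)) / (√2 * k)) atTop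
        (𝓝 (1 / (√2 * k))) := by
      refine (tendsto_gaussE.comp ?_).div_const _
      refine Tendsto.const_mul_atTop (by positivity) ?_
      exact Real.tendsto_sqrt_atTop.comp (tendsto_atTop_add_const_left _ s tendsto_id)
    have hnn : ∀ t ∈ Ioi (0 : ℝ),
        0 ≤ (m : ℝ) * Real.exp (-2 * Real.pi * m ^ 2 * k ^ 2 * (s + t)) / √(s + t) :=
      fun t _ => by positivity
    refine ⟨integrableOn_Ioi_deriv_of_nonneg' hder hnn hlim, ?_⟩
    rw [integral_Ioi_of_hasDerivAt_of_nonneg' hder hnn hlim, Int.sign_eq_one_of_pos hm, add_zero,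
      Int.cast_one, sub_div, mul_right_comm _ (m : ℝ)]
  rcases lt_trichotomy m 0 with hm | rfl | hm
  · obtain ⟨h1, h2⟩ := hpos (-m) (by omega)
    have e : ∀ t : ℝ, ((-m : ℤ) : ℝ) *
        Real.exp (-2 * Real.pi * ((-m : ℤ) : ℝ) ^ 2 * k ^ 2 * (s + t)) / √(s + t) =
        -((m : ℝ) * Real.exp (-2 * Real.pi * m ^ 2 * k ^ 2 * (s + t)) / √(s + t)) := by
      intro t
      push_cast
      rw [neg_sq]
      ring
    simp only [e] at h1 h2
    refine ⟨by simpa using h1.neg, ?_⟩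
    rw [integral_neg, neg_eq_iff_eq_neg] at h2
    rw [h2, Int.sign_neg]
    push_cast
    rw [mul_neg, gaussE_neg]
    ring
  · simp [gaussE_zero]
  · exact hpos m hm

lemma signGap_of_im_eq_zero {u : ℂ} (hu : u.im = 0) (n : ℤ) (τ : ℂ) :
    signGap n u τ = n.sign - gaussE (2 * √τ.im * n) := by
  rw [signGap, hu, zero_div, add_zero]

lemma csqrt_ofReal {x : ℝ} (hx : 0 ≤ x) : csqrt x = √x := by
  rw [csqrt, Real.sqrt_eq_rpow, Complex.ofReal_cpow hx]
  norm_num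

/-- On the vertical ray from -conj τ the quantity -i(z+τ) is the positive real number 2y+t, so each
theta term integrates to a Gaussian tail. With s = 2y one has √2·√s = 2√y, the scale in `signGap`.
-/
lemma completion_eq_integral {τ : ℂ} (hτ : 0 < τ.im) (x : ℝ) :
    completion x τ = -I * (√2 : ℝ) * integralToIInfty (-conj τ) fun z =>
      unaryTheta 0 (1 / 2 - 2 * x) (2 * z) / csqrt (-I * (z + τ)) := by
  set F : ℤ → ℝ → ℂ := fun m t =>
    I * phase m x τ * (((m : ℝ) * Real.exp (-2 * Real.pi * m ^ 2 * 1 ^ 2 * (2 * τ.im + t)) /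
      √(2 * τ.im + t) : ℝ) : ℂ) with hF
  have hs : 0 < 2 * τ.im := by positivity
  have hval : ∀ m : ℤ, ∫ t in Ioi (0 : ℝ), (m : ℝ) *
      Real.exp (-2 * Real.pi * m ^ 2 * 1 ^ 2 * (2 * τ.im + t)) / √(2 * τ.im + t) =
        signGap m x τ / √2 := by
    intro m
    rw [(gaussian_tail_integral m one_pos hs).2, signGap_of_im_eq_zero (ofReal_im x), mul_one,
      Real.sqrt_mul zero_le_two, ← mul_assoc, Real.mul_self_sqrt zero_le_two]
  have hint : ∀ m, Integrable (F m) (volume.restrict (Ioi 0)) := fun m =>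
    ((gaussian_tail_integral m one_pos hs).1.ofReal).const_mul _
  -- Apart from a constant phase the integrand has constant sign, so its L¹ norm is the absolute
  -- value of its integral. Summability of the completion then justifies termwise integration.
  have hnorm : ∀ m : ℤ, ∫ t in Ioi (0 : ℝ), ‖F m t‖ = ‖(signGap m x τ : ℂ) * phase m x τ‖ / √2 := by
    intro m
    have h1 : ∀ t : ℝ, ‖F m t‖ = ‖phase m x τ‖ * ((m.sign : ℝ) * ((m : ℝ) *
        Real.exp (-2 * Real.pi * m ^ 2 * 1 ^ 2 * (2 * τ.im + t)) / √(2 * τ.im + t))) := by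
      intro t
      simp only [hF]
      rw [norm_mul, norm_mul, Complex.norm_I, one_mul, Complex.norm_real, norm_div, norm_mul,
        Real.norm_of_nonneg (Real.exp_pos _).le, Real.norm_of_nonneg (Real.sqrt_nonneg _),
        Real.norm_eq_abs, ← Int.cast_abs, ← Int.sign_mul_self_eq_abs]
      push_cast
      ring
    simp_rw [h1]
    rw [integral_const_mul, integral_const_mul, hval, norm_mul, Complex.norm_real, Real.norm_eq_abs]
    have h2 : |signGap m x τ| = m.sign * signGap m x τ := by
      rw [signGap_of_im_eq_zero (ofReal_im x)]
      rcases lt_trichotomy m 0 with hm | rfl | hm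
      · have : 0 ≤ gaussE (2 * √τ.im * m) + 1 := by
          have := (abs_le.mp (abs_gaussE_le_one (2 * √τ.im * m))).1
          linarith
        rw [Int.sign_eq_neg_one_of_neg hm, abs_of_nonpos (by push_cast; linarith)]
        push_cast
        ring
      · simp [gaussE_zero]
      · have := gaussE_le_one (2 * √τ.im * m)
        rw [Int.sign_eq_one_of_pos hm, abs_of_nonneg (by push_cast; linarith)]
        push_cast
        ring
    rw [h2]
    ring
  have hsum : Summable fun m : ℤ => ∫ t in Ioi (0 : ℝ), ‖F m t‖ := by
    simp_rw [hnorm]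
    exact (summable_signGap_mul_phase hτ x).norm.div_const _
  have h := (hasSum_integral_of_summable_integral_norm hint hsum).tsum_eq
  have hpt : ∀ t ∈ Ioi (0 : ℝ), I * (unaryTheta 0 (1 / 2 - 2 * x) (2 * (-conj τ + I * t)) /
      csqrt (-I * (-conj τ + I * t + τ))) = ∑' m, F m t := by
    intro t ht
    have hconj : conj τ = τ - 2 * I * τ.im := by
      apply Complex.ext <;> simp
      ring
    have h1 : -I * (-conj τ + I * t + τ) = ((2 * τ.im + t : ℝ) : ℂ) := by
      rw [hconj]
      push_cast
      linear_combination (-2 * τ.im - t : ℂ) * I_sq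
    have ht' : (0 : ℝ) < t := ht
    rw [h1, csqrt_ofReal (by positivity), unaryTheta, ← tsum_div_const, ← tsum_mul_left]
    refine tsum_congr fun m => ?_
    simp only [hF]
    have h2 : cexp (Real.pi * I * ((m : ℂ) + (0 : ℝ)) ^ 2 * (2 * (-conj τ + I * t)) +
        2 * Real.pi * I * ((m : ℂ) + (0 : ℝ)) * ((1 / 2 - 2 * x : ℝ) : ℂ)) =
        phase m x τ * Real.exp (-2 * Real.pi * m ^ 2 * 1 ^ 2 * (2 * τ.im + t)) := by
      rw [phase, expTwoPi, Complex.ofReal_exp, ← Complex.exp_add, hconj]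
      congr 1
      push_cast
      linear_combination (2 * Real.pi * m ^ 2 * (2 * τ.im + t) : ℂ) * I_sq
    rw [h2]
    push_cast
    ring
  rw [integralToIInfty, setIntegral_congr_fun measurableSet_Ioi hpt, ← h, completion,
    ← tsum_mul_left]
  refine tsum_congr fun m => ?_
  simp only [hF]
  rw [integral_const_mul, integral_complex_ofReal, hval]
  have h2 : (√2 : ℂ) ≠ 0 := by
    have : √2 ≠ 0 := by positivity
    exact_mod_cast this
  push_cast
  field_simp
  linear_combination ((signGap m x τ : ℂ) * phase m x τ) * I_sq

lemma completedRank_eq {a : ℤ} {c : ℕ} (hc : 0 < c) (hac : ¬ (c : ℤ) ∣ 2 * a) (τ : ℍ) :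
    completedRank a c τ = (1 - zetaPow a c) / (1 + zetaPow a c) *
      rankHat ((a / c : ℝ) : ℂ) τ := by
  have hz : zetaPow a c = expTwoPi ((a / c : ℝ) : ℂ) := by
    rw [zetaPow, expTwoPi]
    congr 1
    push_cast
    ring
  have hc' : (c : ℂ) ≠ 0 := by exact_mod_cast hc.ne'
  -- The hypothesis c ∤ 2a says that ζ is neither 1 nor -1, so the prefactor is finite and
  -- invertible.
  have hsq : zetaPow a c ^ 2 ≠ 1 := by
    rw [hz, sq, ← expTwoPi_add, Ne, expTwoPi_eq_one_iff]
    rintro ⟨n, hn⟩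
    apply hac
    refine ⟨n, ?_⟩
    push_cast at hn
    field_simp at hn
    have : ((2 * a : ℤ) : ℂ) = ((c * n : ℤ) : ℂ) := by
      push_cast
      linear_combination hn
    exact_mod_cast this
  have h1 : 1 - zetaPow a c ≠ 0 := fun h => hsq (by rw [← sub_eq_zero.mp h]; ring)
  have h2 : 1 + zetaPow a c ≠ 0 := fun h => hsq (by
    rw [show zetaPow a c = -1 by linear_combination h]; ring)
  have hr : rankFunction (zetaPow a c) τ =
      (1 - zetaPow a c) / (1 + zetaPow a c) * normRank ((a / c : ℝ) : ℂ) τ := by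
    rw [normRank, ← hz]
    change rankSeries (zetaPow a c) (expTwoPi τ) = _
    field_simp
  rw [completedRank, hr, rankHat, completion_eq_integral τ.im_pos]
  rw [show (1 / 2 - 2 * (a : ℝ) / (c : ℝ)) = 1 / 2 - 2 * (a / c : ℝ) by ring]
  ring

/-! ### The transformation law -/

lemma intCast_eq_one_iff (n : ℤ) (N : ℕ) : (n : ZMod N) = 1 ↔ (N : ℤ) ∣ n - 1 := by
  rw [← ZMod.intCast_zmod_eq_zero_iff_dvd, Int.cast_sub, Int.cast_one, sub_eq_zero]

lemma Gamma_le_levelGroup (c : ℕ) : CongruenceSubgroup.Gamma (16 * c ^ 2) ≤ levelGroup c := by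
  intro A hA
  simp only [levelGroup, Subgroup.mem_inf, CongruenceSubgroup.Gamma1_mem,
    CongruenceSubgroup.Gamma0_mem, CongruenceSubgroup.Gamma_mem, intCast_eq_one_iff,
    ZMod.intCast_zmod_eq_zero_iff_dvd] at hA ⊢
  obtain ⟨h00, -, h10, h11⟩ := hA
  push_cast at h00 h10 h11 ⊢
  have h4 : (4 : ℤ) ∣ 16 * (c : ℤ) ^ 2 := ⟨4 * c ^ 2, by ring⟩
  have hc : (c : ℤ) ∣ 16 * (c : ℤ) ^ 2 := ⟨16 * c, by ring⟩
  exact ⟨⟨⟨⟨h4.trans h00, h4.trans h11, h4.trans h10⟩, hc.trans h00, hc.trans h11, hc.trans h10⟩,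
    (dvd_mul_right _ _).trans h10⟩, (dvd_mul_left _ _).trans h10⟩

lemma levelGroup_le_Gamma0_four (c : ℕ) : levelGroup c ≤ CongruenceSubgroup.Gamma0 4 :=
  fun _ hA => CongruenceSubgroup.Gamma1_in_Gamma0 4 hA.1.1.1

lemma entries_of_mem_levelGroup {c : ℕ} {A : SL(2, ℤ)} (hA : A ∈ levelGroup c) :
    A 1 0 % 16 = 0 ∧ A 1 1 % 4 = 1 ∧ (c : ℤ) ∣ A 1 1 - 1 ∧ (c : ℤ) ^ 2 ∣ A 1 0 := by
  simp only [levelGroup, Subgroup.mem_inf, CongruenceSubgroup.Gamma1_mem,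
    CongruenceSubgroup.Gamma0_mem, intCast_eq_one_iff, ZMod.intCast_zmod_eq_zero_iff_dvd] at hA
  obtain ⟨⟨⟨⟨-, h4, -⟩, ⟨-, hc, -⟩⟩, h16⟩, hc2⟩ := hA
  push_cast at h4 hc2 h16
  exact ⟨by omega, by omega, hc, hc2⟩

lemma offLattice_of_not_dvd {a : ℤ} {c : ℕ} (hc : 0 < c) (hac : ¬ (c : ℤ) ∣ 2 * a) {τ : ℂ}
    (hτ : 0 < τ.im) : OffLattice ((a / c : ℝ) : ℂ) τ := by
  intro m n h
  have him := congrArg Complex.im h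
  have hre := congrArg Complex.re h
  simp only [ofReal_im, ofReal_re, add_im, mul_im, intCast_im, intCast_re, zero_mul, add_zero,
    add_re, mul_re, sub_zero] at him hre
  have hm : (m : ℝ) = 0 := by
    rcases mul_eq_zero.mp him.symm with h | h
    · exact h
    · exact absurd h hτ.ne'
  rw [hm, zero_mul, zero_add, div_eq_iff (by exact_mod_cast hc.ne')] at hre
  have : a = n * c := by exact_mod_cast hre
  exact hac ⟨2 * n, by rw [this]; ring⟩

/-- Apply `rankHat_smul` at u = wx with w = γτ+δ and x = a/c. Then u/w = x, while u = x + (acg)τ +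
ad when δ = 1+cd and γ = c²g. The elliptic factor of this translation cancels the exponential in the
modular law. -/
theorem completedRank_smul {a : ℤ} {c : ℕ} (hc : 0 < c) (hac : ¬ (c : ℤ) ∣ 2 * a) {A : SL(2, ℤ)}
    (hA : A ∈ levelGroup c) (τ : ℍ) :
    completedRank a c (A • τ) = ((extJacobi (A 1 0) (A 1 1) : ℤ) : ℂ) * csqrt (autFactor A τ) *
      completedRank a c τ := by
  obtain ⟨h16, h4, ⟨d, hd⟩, ⟨g, hg⟩⟩ := entries_of_mem_levelGroup hA
  rw [completedRank_eq hc hac, completedRank_eq hc hac]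
  have hoff := offLattice_of_not_dvd hc hac τ.im_pos
  set x : ℂ := ((a / c : ℝ) : ℂ) with hx
  have hc' : (c : ℂ) ≠ 0 := by exact_mod_cast hc.ne'
  have hcx : (c : ℂ) * x = a := by
    rw [hx]
    push_cast
    field_simp
  have hw : autFactor A τ ≠ 0 := autFactor_ne_zero A τ
  have hδ : ((A 1 1 : ℤ) : ℂ) = 1 + c * d := by
    rw [show A 1 1 = 1 + c * d by omega]
    push_cast
    rfl
  have hγ : ((A 1 0 : ℤ) : ℂ) = c ^ 2 * g := by
    rw [hg]
    push_cast
    rfl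
  have hu : autFactor A τ * x = x + ((a * c * g : ℤ) : ℂ) * τ + ((a * d : ℤ) : ℂ) := by
    rw [autFactor, hδ, hγ]
    push_cast
    linear_combination (d + c * g * (τ : ℂ)) * hcx
  -- Since c²g is even, c or g is even, so the translation by acg periods τ carries no sign.
  have heven : Even (a * c * g) := by
    have h2 : Even ((c : ℤ) ^ 2 * g) := by
      rw [← hg, Int.even_iff]
      omega
    rw [Int.even_mul, Int.even_pow] at h2
    rw [Int.even_mul, Int.even_mul]
    tauto
  have h := rankHat_smul h16 h4 τ (u := autFactor A τ * x) (by rw [hu]; exact hoff.add _ _)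
  have hexp : expTwoPi ((A 1 0 : ℤ) * (autFactor A τ * x) ^ 2 / autFactor A τ) =
      expTwoPi (((a * c * g : ℤ) : ℂ) ^ 2 * τ + 2 * ((a * c * g : ℤ) : ℂ) * x) := by
    have : (A 1 0 : ℤ) * (autFactor A τ * x) ^ 2 / autFactor A τ =
        (((a * c * g : ℤ) : ℂ) ^ 2 * τ + 2 * ((a * c * g : ℤ) : ℂ) * x) +
          ((g * a ^ 2 * (A 1 1 - 2) : ℤ) : ℂ) := by
      field_simp
      rw [autFactor, hγ]
      push_cast
      linear_combination (g * (c ^ 2 * g * τ + (A 1 1 : ℤ)) * (c * x + a) - 2 * a * g : ℂ) * hcx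
    rw [this, expTwoPi_add, expTwoPi_intCast, mul_one]
  rw [mul_div_cancel_left₀ _ hw, hexp, hu, rankHat_add_int,
    rankHat_add_int_mul τ.im_pos _ hoff, heven.neg_one_zpow, one_mul] at h
  have hne := expTwoPi_ne_zero (((a * c * g : ℤ) : ℂ) ^ 2 * τ + 2 * ((a * c * g : ℤ) : ℂ) * x)
  have h' : rankHat x (A • τ : ℍ) =
      ((extJacobi (A 1 0) (A 1 1) : ℤ) : ℂ) * csqrt (autFactor A τ) * rankHat x τ := by
    refine mul_left_cancel₀ hne ?_
    rw [h]
    ring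
  rw [h']
  ring

/-! ### Smoothness of the completion in the modular variable -/

lemma summable_abs_pow_mul_exp {y : ℝ} (hy : 0 < y) (k : ℕ) :
    Summable fun n : ℤ => |(n : ℝ)| ^ k * Real.exp (-2 * Real.pi * n ^ 2 * y) := by
  refine (summable_pow_mul_jacobiTheta₂_term_bound 0 (show 0 < 2 * y by positivity) k).congr
    fun n => ?_
  rw [Int.cast_abs]
  congr 2
  ring

lemma isOpen_lt_im (y : ℝ) : IsOpen {z : ℂ | y < z.im} :=
  isOpen_lt continuous_const Complex.continuous_im

lemma isPreconnected_lt_im (y : ℝ) : IsPreconnected {z : ℂ | y < z.im} :=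
  ((convex_Ioi y).linear_preimage imCLM.toLinearMap).isPreconnected

/-- The moments of the series for the completion at a real point. -/
noncomputable def completionMoment (k : ℕ) (x : ℝ) (τ : ℂ) : ℂ :=
  ∑' n : ℤ, (n : ℂ) ^ k * ((signGap n x τ : ℂ) * phase n x τ)

/-- The theta series of the shadow, as a function on the lower half plane. -/
noncomputable def shadowTheta (k : ℕ) (x : ℝ) (w : ℂ) : ℂ := ∑' n : ℤ, (n : ℂ) ^ k * phase n x w

lemma completionMoment_zero (x : ℝ) (τ : ℂ) : completionMoment 0 x τ = completion x τ := by
  simp [completionMoment, completion]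

lemma norm_pow_mul_phase_le {w : ℂ} {y : ℝ} (hw : w.im ≤ -y) (k : ℕ) (n : ℤ) (x : ℝ) :
    ‖(n : ℂ) ^ k * phase n x w‖ ≤ |(n : ℝ)| ^ k * Real.exp (-2 * Real.pi * n ^ 2 * y) := by
  rw [norm_mul, norm_pow, norm_phase, Complex.norm_intCast, ofReal_im, mul_zero, add_zero]
  gcongr ?_ * ?_
  rw [Real.exp_le_exp]
  nlinarith [mul_le_mul_of_nonneg_left hw (show 0 ≤ 2 * Real.pi * (n : ℝ) ^ 2 by positivity)]

lemma norm_pow_mul_signGap_mul_phase_le {τ : ℂ} {y : ℝ} (hy : 0 < y) (hτ : y < τ.im) (k : ℕ)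
    (n : ℤ) (x : ℝ) : ‖(n : ℂ) ^ k * ((signGap n x τ : ℂ) * phase n x τ)‖ ≤
      2 * (|(n : ℝ)| ^ k * Real.exp (-2 * Real.pi * n ^ 2 * y)) := by
  have h := norm_signGap_mul_phase_le (hy.trans hτ) n x
  rw [ofReal_im, mul_zero, add_zero] at h
  rw [norm_mul, norm_pow, Complex.norm_intCast, mul_left_comm]
  refine mul_le_mul_of_nonneg_left (h.trans ?_) (by positivity)
  gcongr 2 * ?_
  rw [Real.exp_le_exp]
  nlinarith [mul_le_mul_of_nonneg_left hτ.le (show 0 ≤ 2 * Real.pi * (n : ℝ) ^ 2 by positivity)]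

lemma hasDerivAt_phase_modular (n : ℤ) (u τ : ℂ) :
    HasDerivAt (fun τ => phase n u τ) (-2 * Real.pi * I * n ^ 2 * phase n u τ) τ := by
  have : HasDerivAt (fun τ : ℂ => 2 * Real.pi * I * (n / 2 - n ^ 2 * τ - 2 * n * u))
      (2 * Real.pi * I * (-n ^ 2)) τ := by
    simpa using ((((hasDerivAt_id τ).const_mul ((n : ℂ) ^ 2)).const_sub (n / 2 : ℂ)).sub_const
      (2 * n * u)).const_mul (2 * Real.pi * I)
  have h := this.cexp
  rw [show cexp (2 * Real.pi * I * (n / 2 - n ^ 2 * τ - 2 * n * u)) = phase n u τ from rfl] at h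
  exact h.congr_deriv (by ring)

lemma differentiableOn_shadowTheta (k : ℕ) (x : ℝ) :
    DifferentiableOn ℂ (shadowTheta k x) {w | w.im < 0} := by
  intro w hw
  have hw' : w.im < 0 := hw
  have hopen : IsOpen {v : ℂ | v.im < w.im / 2} := isOpen_lt Complex.continuous_im continuous_const
  refine ((differentiableOn_tsum_of_summable_norm
    (summable_abs_pow_mul_exp (show 0 < -(w.im / 2) by linarith) k)
    (fun n v _ => ((hasDerivAt_phase_modular n x v).const_mul
      ((n : ℂ) ^ k)).differentiableAt.differentiableWithinAt) hopen
    fun n v hv => norm_pow_mul_phase_le (by simpa using (le_of_lt hv)) k n x).differentiableAt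
      (hopen.mem_nhds ?_)).differentiableWithinAt
  change w.im < w.im / 2
  linarith

lemma contDiffOn_shadowTheta (k : ℕ) (x : ℝ) :
    ContDiffOn ℝ ∞ (fun τ => shadowTheta k x (conj τ)) {τ | 0 < τ.im} := by
  have hopen : IsOpen {w : ℂ | w.im < 0} := isOpen_lt Complex.continuous_im continuous_const
  have h : ContDiffOn ℝ ∞ (shadowTheta k x) {w | w.im < 0} :=
    ((differentiableOn_shadowTheta k x).contDiffOn hopen).restrict_scalars ℝ
  exact h.comp conjCLE.contDiff.contDiffOn fun τ hτ => by simpa using hτ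

/-- The Gaussian from the derivative of `gaussE` replaces τ by its conjugate, so the non-holomorphic
part of the derivative is an antiholomorphic theta series. -/
lemma exp_mul_phase_conj {τ : ℂ} (hτ : 0 < τ.im) (n : ℤ) (u : ℂ) :
    (Real.exp (-Real.pi * (2 * √τ.im * n) ^ 2) : ℂ) * phase n u τ = phase n u (conj τ) := by
  have hτ' : conj τ = τ - 2 * I * τ.im := by
    apply Complex.ext <;> simp
    ring
  rw [mul_pow, mul_pow, Real.sq_sqrt hτ.le, hτ', phase, phase, expTwoPi, expTwoPi,
    Complex.ofReal_exp, ← Complex.exp_add]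
  congr 1
  push_cast
  linear_combination -(4 * Real.pi * τ.im * n ^ 2 : ℂ) * I_sq

/-- The real derivative of a summand of the completion in the modular variable. -/
noncomputable def momentDeriv (k : ℕ) (x : ℝ) (n : ℤ) (τ : ℂ) : ℂ →L[ℝ] ℂ :=
  (-2 * Real.pi * I * ((n : ℂ) ^ (k + 2) * ((signGap n x τ : ℂ) * phase n x τ))) •
      (ContinuousLinearMap.id ℝ ℂ) +
    imCLM.smulRight (-(2 / √τ.im : ℝ) * ((n : ℂ) ^ (k + 1) * phase n x (conj τ)))

lemma hasFDerivAt_moment {τ : ℂ} (hτ : 0 < τ.im) (k : ℕ) (x : ℝ) (n : ℤ) :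
    HasFDerivAt (fun τ => (n : ℂ) ^ k * ((signGap n x τ : ℂ) * phase n x τ))
      (momentDeriv k x n τ) τ := by
  have h1 : HasFDerivAt (fun τ : ℂ => 2 * √τ.im * n) ((n / √τ.im) • imCLM) τ := by
    have h := ((imCLM.hasFDerivAt (x := τ)).sqrt hτ.ne').mul_const (2 * n : ℝ)
    have h' : HasFDerivAt (fun τ : ℂ => √τ.im * (2 * n))
        ((2 * n : ℝ) • (1 / (2 * √τ.im)) • imCLM) τ := h
    refine (h'.congr_fderiv ?_).congr_of_eventuallyEq (Eventually.of_forall fun v => by ring)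
    rw [smul_smul]
    congr 1
    field_simp
  have h2 : HasFDerivAt (fun τ : ℂ => signGap n x τ)
      (-((2 * Real.exp (-Real.pi * (2 * √τ.im * n) ^ 2)) • ((n / √τ.im) • imCLM))) τ := by
    have h := ((hasDerivAt_gaussE _).comp_hasFDerivAt τ h1).const_sub (n.sign : ℝ)
    refine h.congr_of_eventuallyEq (Eventually.of_forall fun v => ?_)
    simp [signGap_of_im_eq_zero (ofReal_im x)]
  have h3 := (ofRealCLM.hasFDerivAt (x := signGap n x τ)).comp τ h2
  have h5 := (h3.mul ((hasDerivAt_phase_modular n x τ).hasFDerivAt.restrictScalars ℝ)).const_mul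
    ((n : ℂ) ^ k)
  refine h5.congr_fderiv (ContinuousLinearMap.ext fun v => ?_)
  rw [momentDeriv, ← exp_mul_phase_conj hτ]
  simp
  ring

lemma norm_momentDeriv_le {τ : ℂ} {y : ℝ} (hy : 0 < y) (hτ : y < τ.im) (k : ℕ) (x : ℝ) (n : ℤ) :
    ‖momentDeriv k x n τ‖ ≤
      4 * Real.pi * (|(n : ℝ)| ^ (k + 2) * Real.exp (-2 * Real.pi * n ^ 2 * y)) +
        2 / √y * (|(n : ℝ)| ^ (k + 1) * Real.exp (-2 * Real.pi * n ^ 2 * y)) := by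
  refine (norm_add_le _ _).trans (add_le_add ?_ ?_)
  · have h1 := norm_pow_mul_signGap_mul_phase_le hy hτ (k + 2) n x
    have h3 : ‖(-2 * Real.pi * I : ℂ)‖ = 2 * Real.pi := by simp [abs_of_pos Real.pi_pos]
    rw [norm_smul, norm_mul, h3]
    calc _ ≤ 2 * Real.pi * (2 * (|(n : ℝ)| ^ (k + 2) * Real.exp (-2 * Real.pi * n ^ 2 * y))) * 1 :=
          mul_le_mul (mul_le_mul_of_nonneg_left h1 (by positivity))
            ContinuousLinearMap.norm_id_le (norm_nonneg _) (by positivity)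
      _ = _ := by ring
  · have h2 := norm_pow_mul_phase_le (w := conj τ) (y := y) (by simpa using hτ.le) (k + 1) n x
    rw [ContinuousLinearMap.norm_smulRight_apply, norm_mul, imCLM_norm, one_mul, norm_neg,
      Complex.norm_real, Real.norm_of_nonneg (by positivity)]
    refine mul_le_mul ?_ h2 (norm_nonneg _) (by positivity)
    gcongr

/-- The real derivative of a moment of the completion. -/
noncomputable def completionMomentDeriv (k : ℕ) (x : ℝ) (τ : ℂ) : ℂ →L[ℝ] ℂ :=
  (-2 * Real.pi * I * completionMoment (k + 2) x τ) • (ContinuousLinearMap.id ℝ ℂ) +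
    imCLM.smulRight (-(2 / √τ.im : ℝ) * shadowTheta (k + 1) x (conj τ))

/-- The moments are closed under differentiation: the derivative involves only the moment of order
k+2 and a smooth theta term. This is why the completion is embedded in a family. -/
lemma hasFDerivAt_completionMoment (k : ℕ) (x : ℝ) {τ : ℂ} (hτ : 0 < τ.im) :
    HasFDerivAt (completionMoment k x) (completionMomentDeriv k x τ) τ := by
  have hy : 0 < τ.im / 2 := by positivity
  have hτs : τ ∈ {z : ℂ | τ.im / 2 < z.im} := by
    change τ.im / 2 < τ.im
    linarith
  have hsum : ∀ j, Summable fun n : ℤ => (n : ℂ) ^ j * ((signGap n x τ : ℂ) * phase n x τ) :=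
    fun j => ((summable_abs_pow_mul_exp hy j).mul_left 2).of_norm_bounded
      fun n => norm_pow_mul_signGap_mul_phase_le hy hτs j n x
  have hsum' : ∀ j, Summable fun n : ℤ => (n : ℂ) ^ j * phase n x (conj τ) :=
    fun j => (summable_abs_pow_mul_exp hτ j).of_norm_bounded
      fun n => norm_pow_mul_phase_le (by simp) j n x
  have hbound := ((summable_abs_pow_mul_exp hy (k + 2)).mul_left (4 * Real.pi)).add
    ((summable_abs_pow_mul_exp hy (k + 1)).mul_left (2 / √(τ.im / 2)))
  have hder := hasFDerivAt_tsum_of_isPreconnected hbound (isOpen_lt_im _) (isPreconnected_lt_im _)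
    (fun n v hv => hasFDerivAt_moment (hy.trans hv) k x n)
    (fun n v hv => norm_momentDeriv_le hy hv k x n) hτs (hsum k) hτs
  refine hder.congr_fderiv (ContinuousLinearMap.ext fun v => ?_)
  have hs : Summable fun n => momentDeriv k x n τ :=
    hbound.of_norm_bounded fun n => norm_momentDeriv_le hy hτs k x n
  have happ : (∑' n, momentDeriv k x n τ) v = ∑' n, momentDeriv k x n τ v :=
    (ContinuousLinearMap.apply ℝ ℂ v).map_tsum hs
  have h := (((hsum (k + 2)).hasSum.mul_left (-2 * Real.pi * I)).mul_right v).add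
    ((((hsum' (k + 1)).hasSum.mul_left (-(2 / √τ.im : ℝ) : ℂ))).mul_left (v.im : ℂ))
  rw [happ]
  exact h.tsum_eq

lemma contDiffOn_inv_sqrt_im : ContDiffOn ℝ ∞ (fun τ : ℂ => (-(2 / √τ.im : ℝ) : ℂ))
    {τ | 0 < τ.im} := by
  have h : ContDiffOn ℝ ∞ (fun τ : ℂ => 2 / √τ.im) {τ | 0 < τ.im} :=
    contDiffOn_const.div (imCLM.contDiff.contDiffOn.sqrt fun τ hτ => ne_of_gt hτ)
      fun τ hτ => (Real.sqrt_pos.mpr hτ).ne'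
  exact (ofRealCLM.contDiff.comp_contDiffOn h).neg

/-- Induction on m with k free, since each derivative raises the order of the moment. -/
lemma contDiffOn_completionMoment (m : ℕ) (k : ℕ) (x : ℝ) :
    ContDiffOn ℝ m (completionMoment k x) {τ | 0 < τ.im} := by
  induction m generalizing k with
  | zero =>
    refine contDiffOn_zero.mpr fun τ hτ => ?_
    exact (hasFDerivAt_completionMoment k x hτ).continuousAt.continuousWithinAt
  | succ m ih =>
    rw [Nat.cast_succ, contDiffOn_succ_iff_hasFDerivWithinAt_of_uniqueDiffOn
      (isOpen_lt_im 0).uniqueDiffOn]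
    refine ⟨fun h => absurd h (by simp), completionMomentDeriv k x, ?_, fun τ hτ =>
      (hasFDerivAt_completionMoment k x hτ).hasFDerivWithinAt⟩
    refine ContDiffOn.add (((contDiffOn_const.mul (ih (k + 2)))).smul contDiffOn_const) ?_
    have h : ContDiffOn ℝ m (fun τ : ℂ => (-(2 / √τ.im : ℝ) : ℂ) * shadowTheta (k + 1) x (conj τ))
        {τ | 0 < τ.im} :=
      (contDiffOn_inv_sqrt_im.mul (contDiffOn_shadowTheta (k + 1) x)).of_le
        (by exact_mod_cast le_top)
    exact (ContinuousLinearMap.smulRightL ℝ ℂ ℂ imCLM).contDiff.comp_contDiffOn h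

lemma contDiffOn_completion (x : ℝ) :
    ContDiffOn ℝ ∞ (fun τ => completion x τ) {τ | 0 < τ.im} := by
  simp_rw [← completionMoment_zero]
  exact contDiffOn_infty.mpr fun m => contDiffOn_completionMoment m 0 x

/-! ### Harmonicity -/

lemma poleGap_of_norm_eq_one {z q : ℂ} {r : ℝ} (hz : ‖z‖ = 1) (hq : ‖q‖ ≤ r) (hr : r ≤ 1) :
    PoleGap (1 - r) z q := by
  have key : ∀ z : ℂ, ‖z‖ = 1 → ∀ j : ℕ, 1 - r ≤ ‖1 - z * q ^ (j + 1)‖ := by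
    intro z hz j
    have h1 : ‖z * q ^ (j + 1)‖ ≤ r := by
      rw [norm_mul, hz, one_mul, norm_pow, pow_succ]
      exact (mul_le_of_le_one_left (norm_nonneg _)
        (pow_le_one₀ (norm_nonneg _) (hq.trans hr))).trans hq
    have h2 := norm_sub_norm_le (1 : ℂ) (z * q ^ (j + 1))
    rw [norm_one] at h2
    linarith
  exact fun j => ⟨key z hz j, key z⁻¹ (by rw [norm_inv, hz, inv_one]) j⟩

lemma norm_expTwoPi_ofReal (x : ℝ) : ‖expTwoPi x‖ = 1 := by
  rw [norm_expTwoPi, ofReal_im, mul_zero, Real.exp_zero]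

lemma differentiableOn_normRank (x : ℝ) :
    DifferentiableOn ℂ (fun τ => normRank x τ) {τ | 0 < τ.im} := by
  intro τ hτ
  have hτ' : 0 < τ.im := hτ
  have hr : Real.exp (-2 * Real.pi * (τ.im / 2)) < 1 := by
    rw [Real.exp_lt_one_iff]
    nlinarith [Real.pi_pos]
  have hle : ∀ w ∈ {w : ℂ | τ.im / 2 < w.im},
      ‖expTwoPi w‖ ≤ Real.exp (-2 * Real.pi * (τ.im / 2)) := by
    intro w hw
    have hw' : τ.im / 2 < w.im := hw
    rw [norm_expTwoPi, Real.exp_le_exp]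
    nlinarith [Real.pi_pos]
  have h := differentiableOn_rankSeries (isOpen_lt_im (τ.im / 2)) (f := fun _ => expTwoPi x)
    (g := expTwoPi) (differentiableOn_const _) differentiable_expTwoPi.differentiableOn
    (fun _ _ => expTwoPi_ne_zero _) (sub_pos.mpr hr) (Real.exp_pos _).le hr hle
    fun w hw => poleGap_of_norm_eq_one (norm_expTwoPi_ofReal x) (hle w hw) hr.le
  refine ((h.const_mul _).differentiableAt ((isOpen_lt_im _).mem_nhds ?_)).differentiableWithinAt
  change τ.im / 2 < τ.im
  linarith

lemma contDiffOn_rankHat (x : ℝ) : ContDiffOn ℝ ∞ (fun τ => rankHat x τ) {τ | 0 < τ.im} :=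
  (((differentiableOn_normRank x).contDiffOn (isOpen_lt_im 0)).restrict_scalars ℝ).add
    (contDiffOn_completion x)

lemma hasDbarAt_rankHat (x : ℝ) {τ : ℂ} (hτ : 0 < τ.im) :
    HasDbarAt (fun τ => rankHat x τ) (-(2 * I / √τ.im) * shadowTheta 1 x (conj τ)) τ := by
  have h1 := ((differentiableOn_normRank x).differentiableAt
    ((isOpen_lt_im 0).mem_nhds hτ)).hasFDerivAt.restrictScalars ℝ
  have h2 := hasFDerivAt_completionMoment 0 x hτ
  have h3 : completionMoment 0 x = fun τ => completion x τ := funext (completionMoment_zero x)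
  rw [h3] at h2
  refine ⟨_, h1.add h2, ?_⟩
  have h4 : ∀ L : ℂ →L[ℂ] ℂ, L I = I * L 1 := fun L => by
    rw [← smul_eq_mul I (L 1), ← L.map_smul, smul_eq_mul, mul_one]
  simp only [add_apply, ContinuousLinearMap.coe_restrictScalars', h4, completionMomentDeriv,
    ContinuousLinearMap.smulRight_apply, imCLM_apply, smul_apply, ContinuousLinearMap.id_apply,
    one_im, I_im, smul_eq_mul, zero_smul, one_smul, zero_add]
  push_cast
  linear_combination (fderiv ℂ (fun τ => normRank x τ) τ 1 -
    2 * Real.pi * I * completionMoment 2 x τ) * I_sq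

/-- The hyperbolic Laplacian factors through `∂/∂x + i ∂/∂y`. -/
lemma hyperbolicLaplacian_eq {f : ℂ → ℂ} {z : ℂ} (hf : ContDiffAt ℝ 2 f z) (k : ℝ) :
    hyperbolicLaplacian k f z =
      -((z.im : ℂ) ^ 2) * (fderiv ℝ (fun w => partialX f w + I * partialY f w) z 1 -
        I * fderiv ℝ (fun w => partialX f w + I * partialY f w) z I) +
      I * k * z.im * (partialX f z + I * partialY f z) := by
  -- Symmetry of the mixed partials makes (∂x - i∂y)(∂x + i∂y) equal to ∂x² + ∂y².
  have hsymm := hf.isSymmSndFDerivAt (by simp)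
  have hd : DifferentiableAt ℝ (fderiv ℝ f) z :=
    (hf.fderiv_right (m := 1) (by norm_num)).differentiableAt (by norm_num)
  have hv : ∀ v : ℂ, HasFDerivAt (fun w => fderiv ℝ f w v)
      ((ContinuousLinearMap.apply ℝ ℂ v).comp (fderiv ℝ (fderiv ℝ f) z)) z := fun v =>
    (ContinuousLinearMap.apply ℝ ℂ v).hasFDerivAt.comp z hd.hasFDerivAt
  have h := (hv 1).add ((hv I).const_mul I)
  have h' : fderiv ℝ (fun w => partialX f w + I * partialY f w) z = _ := h.fderiv
  have hs : fderiv ℝ (fderiv ℝ f) z 1 I = fderiv ℝ (fderiv ℝ f) z I 1 := hsymm 1 I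
  have hX : partialX (partialX f) z = fderiv ℝ (fderiv ℝ f) z 1 1 := by
    change fderiv ℝ (fun w => fderiv ℝ f w 1) z 1 = _
    rw [(hv 1).fderiv]
    rfl
  have hY : partialY (partialY f) z = fderiv ℝ (fderiv ℝ f) z I I := by
    change fderiv ℝ (fun w => fderiv ℝ f w I) z I = _
    rw [(hv I).fderiv]
    rfl
  rw [hyperbolicLaplacian, h', hX, hY]
  simp only [add_apply, smul_apply, ContinuousLinearMap.comp_apply,
    ContinuousLinearMap.apply_apply, smul_eq_mul, hs]
  linear_combination (-(z.im : ℂ) ^ 2 * fderiv ℝ (fderiv ℝ f) z I I) * I_sq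

/-- ∂x - i∂y annihilates the antiholomorphic factor and only sees y^(-1/2), on which it acts as
multiplication by i/(2y). This balances the first-order term of the Laplacian exactly in weight 1/2.
-/
lemma hasFDerivAt_shadow (x : ℝ) {τ : ℂ} (hτ : 0 < τ.im) (K : ℂ) :
    ∃ L : ℂ →L[ℝ] ℂ,
      HasFDerivAt (fun τ : ℂ => K * (-(2 * I / √τ.im) * shadowTheta 1 x (conj τ))) L τ ∧
      L 1 - I * L I = I / (2 * τ.im) * (K * (-(2 * I / √τ.im) * shadowTheta 1 x (conj τ))) := by
  have hopen : IsOpen {w : ℂ | w.im < 0} := isOpen_lt Complex.continuous_im continuous_const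
  have hmem : conj τ ∈ {w : ℂ | w.im < 0} := by simpa using hτ
  have h1 := ((differentiableOn_shadowTheta 1 x).differentiableAt
    (hopen.mem_nhds hmem)).hasFDerivAt.restrictScalars ℝ
  have h2 : HasFDerivAt (fun τ : ℂ => shadowTheta 1 x (conj τ)) _ τ :=
    h1.comp τ conjCLE.hasFDerivAt
  have h3 : HasFDerivAt (fun τ : ℂ => (√τ.im)⁻¹) ((-(1 / (2 * √τ.im)) / √τ.im ^ 2) • imCLM) τ :=
    ((Real.hasDerivAt_sqrt hτ.ne').inv (Real.sqrt_pos.mpr hτ).ne').comp_hasFDerivAt τ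
      (imCLM.hasFDerivAt (x := τ))
  have h4 := (ofRealCLM.hasFDerivAt (x := (√τ.im)⁻¹)).comp τ h3
  have h5 := (h4.mul h2).const_mul (K * (-(2 * I)))
  refine ⟨_, h5.congr_of_eventuallyEq (Eventually.of_forall fun v => ?_), ?_⟩
  · simp
    ring
  have h6 : ∀ L : ℂ →L[ℂ] ℂ, L (-I) = -I * L 1 := fun L => by
    rw [← smul_eq_mul (-I) (L 1), ← L.map_smul, smul_eq_mul, mul_one]
  have hs : (√τ.im : ℂ) ≠ 0 := by exact_mod_cast (Real.sqrt_pos.mpr hτ).ne'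
  have hsq : (τ.im : ℂ) = (√τ.im : ℂ) ^ 2 := by exact_mod_cast (Real.sq_sqrt hτ.le).symm
  simp only [h6, smul_apply, add_apply, ContinuousLinearMap.comp_apply, Function.comp_apply,
    ContinuousLinearMap.coe_restrictScalars', ContinuousLinearEquiv.coe_coe, conjCLE_apply,
    imCLM_apply, ofRealCLM_apply, map_one, conj_I, one_im, I_im, smul_eq_mul, mul_zero, mul_one,
    ofReal_zero, add_zero, hsq]
  push_cast
  generalize (fderiv ℂ (shadowTheta 1 x) (conj τ)) 1 = d
  linear_combination (-(2 * K * I * (√τ.im : ℂ)⁻¹ * d)) * I_sq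

lemma hyperbolicLaplacian_mul_rankHat (x : ℝ) {τ : ℂ} (hτ : 0 < τ.im) (K : ℂ) :
    hyperbolicLaplacian (1 / 2) (fun τ => K * rankHat x τ) τ = 0 := by
  have hU : {τ : ℂ | 0 < τ.im} ∈ 𝓝 τ := (isOpen_lt_im 0).mem_nhds hτ
  have hsm : ContDiffAt ℝ 2 (fun τ => K * rankHat x τ) τ :=
    ((contDiffOn_const.mul (contDiffOn_rankHat x)).contDiffAt hU).of_le
      (WithTop.coe_le_coe.mpr (le_top : (2 : ℕ∞) ≤ ⊤))
  have hD : ∀ w : ℂ, 0 < w.im → partialX (fun τ => K * rankHat x τ) w +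
      I * partialY (fun τ => K * rankHat x τ) w =
        K * (-(2 * I / √w.im) * shadowTheta 1 x (conj w)) := by
    intro w hw
    obtain ⟨L, hL, hd⟩ := hasDbarAt_rankHat x hw
    rw [partialX, partialY, (hL.const_mul K).fderiv, ← hd]
    simp only [smul_apply, smul_eq_mul]
    ring
  obtain ⟨L, hL, hd⟩ := hasFDerivAt_shadow x hτ K
  have hL' := hL.congr_of_eventuallyEq (eventually_of_mem hU hD)
  rw [hyperbolicLaplacian_eq hsm, hL'.fderiv, hd, hD τ hτ]
  have hne : (τ.im : ℂ) ≠ 0 := by exact_mod_cast hτ.ne'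
  push_cast
  generalize K * (-(2 * I / √τ.im) * shadowTheta 1 x (conj τ)) = D
  field_simp
  ring

lemma hyperbolicLaplacian_congr {f g : ℂ → ℂ} {z : ℂ} (h : f =ᶠ[𝓝 z] g) (k : ℝ) :
    hyperbolicLaplacian k f z = hyperbolicLaplacian k g z := by
  have h1 := h.fderiv (𝕜 := ℝ)
  have hX : partialX f =ᶠ[𝓝 z] partialX g := h1.mono fun w hw => by rw [partialX, hw, partialX]
  have hY : partialY f =ᶠ[𝓝 z] partialY g := h1.mono fun w hw => by rw [partialY, hw, partialY]
  rw [hyperbolicLaplacian, hyperbolicLaplacian, hX.eq_of_nhds, hY.eq_of_nhds, partialX,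
    hX.fderiv_eq, partialY, hY.fderiv_eq, ← partialX.eq_1, ← partialY.eq_1]

lemma completedRank_comp_ofComplex {a : ℤ} {c : ℕ} (hc : 0 < c) (hac : ¬ (c : ℤ) ∣ 2 * a) {w : ℂ}
    (hw : 0 < w.im) : (completedRank a c ∘ UpperHalfPlane.ofComplex) w =
      (1 - zetaPow a c) / (1 + zetaPow a c) * rankHat ((a / c : ℝ) : ℂ) w := by
  rw [Function.comp_apply, UpperHalfPlane.ofComplex_apply_of_im_pos hw, completedRank_eq hc hac]

theorem contDiffOn_completedRank {a : ℤ} {c : ℕ} (hc : 0 < c) (hac : ¬ (c : ℤ) ∣ 2 * a) :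
    ContDiffOn ℝ ∞ (completedRank a c ∘ UpperHalfPlane.ofComplex) {z : ℂ | 0 < z.im} :=
  (contDiffOn_const.mul (contDiffOn_rankHat _)).congr
    fun _ hw => completedRank_comp_ofComplex hc hac hw

theorem hyperbolicLaplacian_completedRank {a : ℤ} {c : ℕ} (hc : 0 < c)
    (hac : ¬ (c : ℤ) ∣ 2 * a) (τ : ℍ) :
    hyperbolicLaplacian (1 / 2) (completedRank a c ∘ UpperHalfPlane.ofComplex) τ = 0 := by
  rw [hyperbolicLaplacian_congr (eventually_of_mem ((isOpen_lt_im 0).mem_nhds τ.im_pos)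
    fun w hw => completedRank_comp_ofComplex hc hac hw)]
  exact hyperbolicLaplacian_mul_rankHat _ τ.im_pos _

/-! ### Growth at the cusps -/

lemma natCast_mul_pow_mul_one_sub_le {s : ℝ} (h0 : 0 ≤ s) (h1 : s ≤ 1) (n : ℕ) :
    n * s ^ n * (1 - s) ≤ 1 - s ^ n := by
  induction n with
  | zero => simp
  | succ n ih =>
    have h2 := mul_le_mul_of_nonneg_left ih h0
    have h3 : 0 ≤ (1 - s) * (1 - s ^ (n + 1)) :=
      mul_nonneg (sub_nonneg.mpr h1) (sub_nonneg.mpr (pow_le_one₀ h0 h1))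
    push_cast
    rw [pow_succ] at h3 ⊢
    nlinarith

/-- The j-th factor is at least 1 - s^(2j) ≥ 1 - s^j ≥ j s^j (1-s). With ‖q‖ = s², the powers of s
from two such products equal the power of ‖q‖ in the numerator of the rank series. -/
lemma factorial_mul_le_norm_qPochhammer {z q : ℂ} {s : ℝ} (hz : ‖z‖ = 1) (h0 : 0 ≤ s)
    (h1 : s ≤ 1) (hq : ‖q‖ = s ^ 2) (n : ℕ) :
    s ^ (n * (n + 1) / 2) * (n.factorial * (1 - s) ^ n) ≤ ‖qPochhammer (z * q) q n‖ := by
  induction n with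
  | zero => simp [qPochhammer]
  | succ n ih =>
    have h2 := natCast_mul_pow_mul_one_sub_le h0 h1 (n + 1)
    have h3 : 1 - s ^ (n + 1) ≤ ‖1 - z * q * q ^ n‖ := by
      have h4 := norm_sub_norm_le (1 : ℂ) (z * q * q ^ n)
      rw [norm_one, mul_assoc, ← pow_succ', norm_mul, hz, one_mul, norm_pow, hq, ← pow_mul,
        mul_comm 2, pow_mul, sq] at h4
      rw [mul_assoc, ← pow_succ']
      have h5 : s ^ (n + 1) * s ^ (n + 1) ≤ s ^ (n + 1) :=
        mul_le_of_le_one_right (pow_nonneg h0 _) (pow_le_one₀ h0 h1)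
      linarith
    rw [qPochhammer_succ, norm_mul]
    calc _ = s ^ (n * (n + 1) / 2) * (n.factorial * (1 - s) ^ n) *
          (((n + 1 : ℕ) : ℝ) * s ^ (n + 1) * (1 - s)) := by
          rw [triangle_succ, pow_add, Nat.factorial_succ]
          push_cast
          ring
      _ ≤ _ := mul_le_mul ih (h2.trans h3)
          (mul_nonneg (by positivity) (sub_nonneg.mpr h1)) (norm_nonneg _)

/-- The powers of s cancel and two factorials remain: one copy is bounded by the exponential, the
other is kept as a term of the exponential series. Summing gives exp(4/(1-s)), which is exp(O(1/y))
as y → 0. -/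
lemma norm_rankTerm_le_factorial {z q : ℂ} {s : ℝ} (hz : ‖z‖ = 1) (h0 : 0 < s) (h1 : s < 1)
    (hq : ‖q‖ = s ^ 2) (n : ℕ) :
    ‖rankTerm z q n‖ ≤ Real.exp (2 / (1 - s)) * ((2 / (1 - s)) ^ n / n.factorial) := by
  have h1' : 0 < 1 - s := sub_pos.mpr h1
  have hd : 0 < s ^ (n * (n + 1) / 2) * (n.factorial * (1 - s) ^ n) := by positivity
  have ha := factorial_mul_le_norm_qPochhammer hz h0.le h1.le hq n
  have hb := factorial_mul_le_norm_qPochhammer (z := z⁻¹) (by rw [norm_inv, hz, inv_one]) h0.le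
    h1.le hq n
  have hn := norm_rankNumerator_le (q := q) (by rw [hq]; exact pow_le_one₀ h0.le h1.le) n
  have h2 : (1 : ℝ) ≤ 2 ^ n := one_le_pow₀ one_le_two
  have hexp : (2 / (1 - s)) ^ n / n.factorial ≤ Real.exp (2 / (1 - s)) :=
    Real.pow_div_factorial_le_exp _ (by positivity) n
  rw [rankTerm, norm_div, norm_mul]
  calc _ ≤ 2 ^ n * ‖q‖ ^ (n * (n + 1) / 2) / ((s ^ (n * (n + 1) / 2) * (n.factorial * (1 - s) ^ n)) *
        (s ^ (n * (n + 1) / 2) * (n.factorial * (1 - s) ^ n))) := by gcongr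
    _ = 2 ^ n / ((n.factorial * (1 - s) ^ n) * (n.factorial * (1 - s) ^ n)) := by
        rw [hq, ← pow_mul, mul_comm 2, pow_mul, sq]
        field_simp
    _ ≤ 2 ^ n * 2 ^ n / ((n.factorial * (1 - s) ^ n) * (n.factorial * (1 - s) ^ n)) := by
        gcongr
        exact le_mul_of_one_le_left (by positivity) h2
    _ = (2 / (1 - s)) ^ n / n.factorial * ((2 / (1 - s)) ^ n / n.factorial) := by
        rw [div_pow]
        field_simp
    _ ≤ _ := mul_le_mul_of_nonneg_right hexp (by positivity)

lemma norm_rankSeries_le {z τ : ℂ} (hz : ‖z‖ = 1) (hτ : 0 < τ.im) :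
    ‖rankSeries z (expTwoPi τ)‖ ≤ Real.exp (4 + 4 / τ.im) := by
  set s := Real.exp (-(Real.pi * τ.im)) with hs
  have hpos : 0 < Real.pi * τ.im := by positivity
  have h0 : 0 < s := Real.exp_pos _
  have h1 : s < 1 := Real.exp_lt_one_iff.mpr (by linarith)
  have h1' : 0 < 1 - s := sub_pos.mpr h1
  have hq : ‖expTwoPi τ‖ = s ^ 2 := by
    rw [norm_expTwoPi, hs, ← Real.exp_nat_mul]
    congr 1
    push_cast
    ring
  have hsum := (NormedSpace.expSeries_div_hasSum_exp (2 / (1 - s))).mul_left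
    (Real.exp (2 / (1 - s)))
  have h2 := tsum_of_norm_bounded hsum fun n => norm_rankTerm_le_factorial hz h0 h1 hq n
  refine h2.trans ?_
  rw [← Real.exp_eq_exp_ℝ, ← Real.exp_add, Real.exp_le_exp]
  have h3 : s * (1 + τ.im) ≤ 1 := by
    have h4 : 1 + τ.im ≤ Real.exp (Real.pi * τ.im) := by
      have := Real.add_one_le_exp (Real.pi * τ.im)
      nlinarith [Real.pi_gt_three]
    calc s * (1 + τ.im) ≤ s * Real.exp (Real.pi * τ.im) := by gcongr
      _ = 1 := by rw [hs, ← Real.exp_add]; simp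
  have h5 : 1 / (1 - s) ≤ 1 + 1 / τ.im := by
    rw [div_le_iff₀ h1']
    field_simp
    nlinarith
  calc 2 / (1 - s) + 2 / (1 - s) = 4 * (1 / (1 - s)) := by ring
    _ ≤ 4 * (1 + 1 / τ.im) := by gcongr
    _ = _ := by ring

/-- At a real point the term n = 0 vanishes, and the others are bounded through exp(-X) ≤ 1/X. -/
lemma norm_completion_le (x : ℝ) {τ : ℂ} (hτ : 0 < τ.im) :
    ‖completion x τ‖ ≤ 1 / τ.im * ∑' n : ℤ, 1 / (n : ℝ) ^ 2 := by
  have hsum := (Real.summable_one_div_int_pow.mpr one_lt_two).hasSum.mul_left (1 / τ.im)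
  refine tsum_of_norm_bounded hsum fun n => ?_
  rcases eq_or_ne n 0 with rfl | hn
  · simp [signGap, gaussE_zero]
  have hn' : (0 : ℝ) < (n : ℝ) ^ 2 := by positivity
  refine (norm_signGap_mul_phase_le hτ n x).trans ?_
  rw [ofReal_im, mul_zero, add_zero]
  have h1 := Real.add_one_le_exp (2 * Real.pi * (n ^ 2 * τ.im))
  have h2 : 2 * (n ^ 2 * τ.im) ≤ Real.exp (2 * Real.pi * (n ^ 2 * τ.im)) := by
    have : 0 ≤ n ^ 2 * τ.im := by positivity
    nlinarith [Real.pi_gt_three]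
  rw [show -2 * Real.pi * (n ^ 2 * τ.im) = -(2 * Real.pi * (n ^ 2 * τ.im)) by ring, Real.exp_neg,
    ← div_eq_mul_inv, div_mul_div_comm, one_mul, div_le_div_iff₀ (Real.exp_pos _) (by positivity)]
  linarith

lemma exists_norm_completedRank_le {a : ℤ} {c : ℕ} (hc : 0 < c) (hac : ¬ (c : ℤ) ∣ 2 * a) :
    ∃ K : ℝ, 0 ≤ K ∧ ∀ τ : ℍ, ‖completedRank a c τ‖ ≤ K * Real.exp (4 / τ.im) := by
  set x : ℝ := a / c with hx
  set L : ℝ := ‖(1 - zetaPow a c) / (1 + zetaPow a c)‖ with hL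
  set M : ℝ := ‖(1 + expTwoPi x) / (1 - expTwoPi x)‖ with hM
  set S : ℝ := ∑' n : ℤ, 1 / (n : ℝ) ^ 2 with hS
  have hS0 : 0 ≤ S := tsum_nonneg fun n => by positivity
  refine ⟨L * (M * Real.exp 4 + S), by positivity, fun τ => ?_⟩
  have hy : 0 < τ.im := τ.im_pos
  have h1 : ‖normRank x τ‖ ≤ M * (Real.exp 4 * Real.exp (4 / τ.im)) := by
    rw [normRank, norm_mul, ← Real.exp_add]
    exact mul_le_mul_of_nonneg_left
      (norm_rankSeries_le (norm_expTwoPi_ofReal x) τ.im_pos) (norm_nonneg _)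
  have h2 : ‖completion x τ‖ ≤ S * Real.exp (4 / τ.im) := by
    refine (norm_completion_le x τ.im_pos).trans ?_
    rw [mul_comm]
    refine mul_le_mul_of_nonneg_left ?_ hS0
    have h3 := Real.add_one_le_exp (4 / τ.im)
    have h4 : 1 / τ.im ≤ 4 / τ.im := by gcongr; norm_num
    rw [UpperHalfPlane.coe_im]
    linarith
  rw [completedRank_eq hc hac, norm_mul, ← hL, mul_assoc]
  refine mul_le_mul_of_nonneg_left ((norm_add_le _ _).trans ((add_le_add h1 h2).trans ?_))
    (norm_nonneg _)
  exact le_of_eq (by ring)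

lemma abs_extJacobi_le_one (m n : ℤ) : |extJacobi m n| ≤ 1 := by
  rcases jacobiSym.trichotomy m n.natAbs with h | h | h <;> unfold extJacobi <;> split_ifs <;>
    simp [h]

/-- A translation of the variable by a multiple of the level does not increase the absolute value
of a form slashed by a matrix. -/
lemma norm_slash_T_zpow_le {c : ℕ} {F : ℍ → ℂ}
    (hF : ∀ A ∈ levelGroup c, ∀ τ : ℍ, F (A • τ) =
      ((extJacobi (A 1 0) (A 1 1) : ℤ) : ℂ) * csqrt (autFactor A τ) * F τ)
    (B : SL(2, ℤ)) (k : ℤ) (τ : ℍ) :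
    ‖(csqrt (autFactor B (ModularGroup.T ^ ((16 * c ^ 2 : ℤ) * k) • τ)))⁻¹ *
      F (B • ModularGroup.T ^ ((16 * c ^ 2 : ℤ) * k) • τ)‖ ≤
      ‖(csqrt (autFactor B τ))⁻¹ * F (B • τ)‖ := by
  set P := ModularGroup.T ^ ((16 * c ^ 2 : ℤ) * k) with hP
  have hPmem : P ∈ CongruenceSubgroup.Gamma (16 * c ^ 2) := by
    have := CongruenceSubgroup.ModularGroup_T_pow_mem_Gamma (16 * c ^ 2 : ℤ)
      ((16 * c ^ 2 : ℤ) * k) (dvd_mul_right _ _)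
    rwa [show (16 * c ^ 2 : ℤ).natAbs = 16 * c ^ 2 by
      exact_mod_cast Int.natAbs_natCast (16 * c ^ 2)] at this
  -- Γ(16c²) is normal, so the same translation width works at every cusp.
  have hmem : B * P * B⁻¹ ∈ levelGroup c :=
    Gamma_le_levelGroup c ((CongruenceSubgroup.Gamma_normal _).conj_mem _ hPmem B)
  have hsmul : (B * P * B⁻¹) • B • τ = B • P • τ := by
    rw [smul_smul, inv_mul_cancel_right, mul_smul]
  have hPone : autFactor P τ = 1 := by
    simp [autFactor, hP, ModularGroup.coe_T_zpow]
  have haut : autFactor (B * P * B⁻¹) (B • τ) * autFactor B τ = autFactor B (P • τ) := by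
    rw [← autFactor_mul, inv_mul_cancel_right, autFactor_mul, hPone, mul_one]
  have h := hF _ hmem (B • τ)
  rw [hsmul] at h
  have hne := norm_pos_iff.mpr (csqrt_ne_zero (autFactor_ne_zero B (P • τ)))
  have hne' := norm_pos_iff.mpr (csqrt_ne_zero (autFactor_ne_zero B τ))
  have hn : ‖csqrt (autFactor (B * P * B⁻¹) (B • τ))‖ * ‖csqrt (autFactor B τ)‖ =
      ‖csqrt (autFactor B (P • τ))‖ := by
    rw [norm_csqrt, norm_csqrt, norm_csqrt, ← Real.sqrt_mul (norm_nonneg _), ← norm_mul, haut]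
  have hJ : ‖((extJacobi ((B * P * B⁻¹) 1 0) ((B * P * B⁻¹) 1 1) : ℤ) : ℂ)‖ ≤ 1 := by
    rw [Complex.norm_intCast]
    exact_mod_cast abs_extJacobi_le_one _ _
  rw [h, norm_mul, norm_mul, norm_mul, norm_mul, norm_inv, norm_inv, ← hn]
  rw [← hn] at hne
  have hne'' : 0 < ‖csqrt (autFactor (B * P * B⁻¹) (B • τ))‖ :=
    pos_of_mul_pos_left hne (norm_nonneg _)
  calc _ = ‖((extJacobi ((B * P * B⁻¹) 1 0) ((B * P * B⁻¹) 1 1) : ℤ) : ℂ)‖ *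
        (‖csqrt (autFactor B τ)‖⁻¹ * ‖F (B • τ)‖) := by
        field_simp
    _ ≤ 1 * (‖csqrt (autFactor B τ)‖⁻¹ * ‖F (B • τ)‖) := by gcongr
    _ = _ := one_mul _

lemma one_le_norm_autFactor (B : SL(2, ℤ)) {τ : ℍ} (hτ : 1 ≤ τ.im) : 1 ≤ ‖autFactor B τ‖ := by
  by_cases h : B 1 0 = 0
  · have hdet := det_eq B
    rw [h, mul_zero, sub_zero] at hdet
    have h1 : |B 1 1| = 1 := Int.isUnit_iff_abs_eq.mp (IsUnit.of_mul_eq_one_right _ hdet)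
    rw [autFactor, h, Int.cast_zero, zero_mul, zero_add, Complex.norm_intCast]
    exact_mod_cast h1.ge
  · have h1 : (1 : ℝ) ≤ |((B 1 0 : ℤ) : ℝ)| := by exact_mod_cast Int.one_le_abs h
    calc (1 : ℝ) ≤ |((B 1 0 : ℤ) : ℝ)| * |τ.im| := by
          rw [abs_of_pos τ.im_pos]
          exact one_le_mul_of_one_le_of_one_le h1 hτ
      _ = |(autFactor B τ).im| := by rw [autFactor_im, abs_mul]
      _ ≤ _ := Complex.abs_im_le_norm _

/-- 1/Im(Bτ) equals |γτ+δ|²/y, which is O(y) while Re τ stays bounded and y ≥ 1. So the global bound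
exp(4/Im) becomes linear exponential growth. -/
theorem completedRank_growth {a : ℤ} {c : ℕ} (hc : 0 < c) (hac : ¬ (c : ℤ) ∣ 2 * a)
    (B : SL(2, ℤ)) : ∃ C : ℝ,
    (fun τ : ℍ => (csqrt (autFactor B τ))⁻¹ * completedRank a c (B • τ))
      =O[UpperHalfPlane.atImInfty] fun τ : ℍ => Real.exp (C * τ.im) := by
  obtain ⟨K, hK0, hK⟩ := exists_norm_completedRank_le hc hac
  set N : ℝ := 16 * c ^ 2 with hN
  have hN0 : 0 < N := by positivity
  set γ : ℝ := |((B 1 0 : ℤ) : ℝ)| with hγ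
  set δ : ℝ := |((B 1 1 : ℤ) : ℝ)| with hδ
  have hbound : ∀ τ : ℍ, 1 ≤ τ.im → |τ.re| ≤ N →
      ‖(csqrt (autFactor B τ))⁻¹ * completedRank a c (B • τ)‖ ≤
        K * Real.exp (4 * (γ * N + δ + γ) ^ 2 * τ.im) := by
    intro τ h1 hre
    have hw1 := one_le_norm_autFactor B h1
    have hw2 : ‖autFactor B τ‖ ≤ (γ * N + δ + γ) * τ.im := by
      have h2 : |τ.re| ≤ N * τ.im := hre.trans (le_mul_of_one_le_right hN0.le h1)
      have h3 : δ ≤ δ * τ.im := le_mul_of_one_le_right (abs_nonneg _) h1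
      calc ‖autFactor B τ‖ ≤ |(autFactor B τ).re| + |(autFactor B τ).im| :=
            Complex.norm_le_abs_re_add_abs_im _
        _ ≤ γ * |τ.re| + δ + γ * τ.im := by
            rw [autFactor_re, autFactor_im, abs_mul, abs_of_pos τ.im_pos]
            gcongr
            exact (abs_add_le _ _).trans (by rw [abs_mul])
        _ ≤ γ * (N * τ.im) + δ * τ.im + γ * τ.im := by gcongr
        _ = _ := by ring
    have hexp : 4 / (B • τ).im ≤ 4 * (γ * N + δ + γ) ^ 2 * τ.im := by
      have hy := τ.im_pos
      rw [im_smul_eq, div_div_eq_mul_div, div_le_iff₀ hy]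
      calc 4 * ‖autFactor B τ‖ ^ 2 ≤ 4 * ((γ * N + δ + γ) * τ.im) ^ 2 := by gcongr
        _ = _ := by ring
    rw [norm_mul, norm_inv, norm_csqrt]
    have h4 : (√‖autFactor B τ‖)⁻¹ ≤ 1 := inv_le_one_of_one_le₀ (Real.one_le_sqrt.mpr hw1)
    calc _ ≤ 1 * (K * Real.exp (4 / (B • τ).im)) := by
          gcongr
          exact hK _
      _ ≤ _ := by
          rw [one_mul]
          gcongr
  refine ⟨4 * (γ * N + δ + γ) ^ 2, Asymptotics.IsBigO.of_bound K ?_⟩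
  have hev : ∀ᶠ τ : ℍ in UpperHalfPlane.atImInfty, 1 ≤ τ.im :=
    tendsto_comap.eventually (eventually_ge_atTop 1)
  filter_upwards [hev] with τ hτ
  rw [Real.norm_of_nonneg (Real.exp_pos _).le]
  -- The estimate must be uniform in Re τ, so τ is first translated into a strip of width 16c².
  set k : ℤ := ⌊τ.re / N⌋ with hk
  set σ : ℍ := ModularGroup.T ^ (-((16 * c ^ 2 : ℤ) * k)) • τ with hσ
  have hτσ : τ = ModularGroup.T ^ ((16 * c ^ 2 : ℤ) * k) • σ := by
    rw [hσ, smul_smul, ← zpow_add, add_neg_cancel, zpow_zero, one_smul]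
  have him : σ.im = τ.im := ModularGroup.im_T_zpow_smul _ _
  have hre : σ.re = τ.re - N * k := by
    rw [hσ, ModularGroup.re_T_zpow_smul]
    push_cast
    ring
  have hre' : |σ.re| ≤ N := by
    have h1 : (k : ℝ) ≤ τ.re / N := Int.floor_le _
    have h2 : τ.re / N < k + 1 := Int.lt_floor_add_one _
    rw [le_div_iff₀ hN0] at h1
    rw [div_lt_iff₀ hN0] at h2
    rw [hre, abs_le]
    constructor <;> nlinarith
  have h := (norm_slash_T_zpow_le (fun A hA τ => completedRank_smul hc hac hA τ) B k σ).trans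
    (hbound σ (him ▸ hτ) hre')
  rwa [← hτσ, him] at h

end OverpartitionRank

theorem corollary4p3 (a : ℤ) (c : ℕ) (hc : 0 < c) (hac : ¬ (c : ℤ) ∣ 2 * a) :
    OverpartitionRank.IsHarmonicWeakMaassForm 1 (OverpartitionRank.levelGroup c)
      (OverpartitionRank.completedRank a c) ∧
    ∀ A ∈ OverpartitionRank.levelGroup c, ∀ τ : UpperHalfPlane,
      OverpartitionRank.completedRank a c (A • τ) =
        ((OverpartitionRank.extJacobi (A 1 0) (A 1 1) : ℤ) : ℂ) *
          OverpartitionRank.csqrt (OverpartitionRank.autFactor A τ) *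
          OverpartitionRank.completedRank a c τ := by
  have htransform := fun A hA τ => OverpartitionRank.completedRank_smul (A := A) hc hac hA τ
  refine ⟨⟨odd_one, ⟨16 * c ^ 2, by positivity, OverpartitionRank.Gamma_le_levelGroup c⟩,
    OverpartitionRank.levelGroup_le_Gamma0_four c, fun A hA τ => ?_,
    OverpartitionRank.contDiffOn_completedRank hc hac, fun τ => ?_, fun B => ?_⟩, htransform⟩
  -- On this group δ ≡ 1 mod 4, so ε(δ) = 1.
  · rw [htransform A hA τ, zpow_one, zpow_one, OverpartitionRank.epsilonFactor,
      if_pos (OverpartitionRank.entries_of_mem_levelGroup hA).2.1, one_zpow, mul_one]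
  · simpa using OverpartitionRank.hyperbolicLaplacian_completedRank hc hac τ
  · simpa using OverpartitionRank.completedRank_growth hc hac B
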